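/- **Algebraic freeness on box inclusions.** Let $\mathbb A$ be an infinite set of names and $2=\{0,1\}$. *Conventions.* A nominal set is a set with an action of the group of finite permutations of $\mathbb A$ in which every element has a finite support; $x\# y$ means that $x$ and $y$ have disjoint finite supports. A 01-substitution set is a nominal set $X$ with an equivariant map $(x,a,i)\mapsto x(a:=i)$, $X\times\mathbb A\times 2\to X$, such that $a\# x(a:=i)$; $x(a:=i)=x$ if $a\# x$; and $x(a:=i)(a':=i')=x(a':=i')(a:=i)$ if $a\ne a'$. With the equivariant maps that preserve the substitutions they form a category $\mathsf{01Sub}$. For $i\in 2$, a finite $A\subseteq\mathbb A$ and $a\in A$, an $i$-open $(A,a)$-box over $f:X\to Y$ is a pair $(u,y)$ with $y\in Y$ and $u:(A\times 2)\setminus\{(a,i)\}\to X$ such that, for all $(b,j),(b',j')$ in the domain of $u$, $b\# u(b,j)$; $u(b,j)(b':=j')=u(b',j')(b:=j)$ if $b\neq b'$; and $f(u(b,j))=y(b:=j)$. *The factorisation system.* For $f:X\to Y$ let $K_0f=X$ and, for $n\ge 1$, let $K_nf$ be the disjoint union of $X$, of the set of all open boxes $(u,y)$ in $K_{n-1}f$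 over $Y$ (for both $i\in 2$), and of the set of all name abstractions $\langle a\rangle(u,y)$ of an $i$-open $(A,a)$-box $(u,y)$ in $K_{n-1}f$ (for both $i\in 2$, kept disjoint), the latter taken up to $\alpha$-equivalence. Permutations act componentwise. Substitution on $X$ is that of $X$. For an $i$-open $(A,a)$-box, $(u,y)(b:=j)$ is $u(b,j)$ if $(b,j)\in(A\times2)\setminus\{(a,i)\}$, it is $\langle a\rangle (u,y)$ if $(b,j)=(a,i)$, and it is $(u(b:=j),y(b:=j))$ if $b\notin A$. Choosing the bound name $a\neq b$, $\langle a\rangle(u,y)(b:=j)$ is $u(b,j)(a:=i)$ if $b\in A$ and $\langle a\rangle(u(b:=j),y(b:=j))$ otherwise. Let $Kf=\operatorname{colim}_nK_nf$, let $\lambda_f:X\to Kf$ be the inclusion, and let $\rho_f:Kf\to Y$ be given by $x\mapsto f(x)$, $(u,y)\mapsto y$, $\langle a\rangle(u,y)\mapsto y(a:=i)$. For a square $(h,k):f\to g$ the map $K(h,k)$ is determined by $x\mapsto h(x)$ and $(u,y)\mapsto (K(h,k)\circ u,k(y))$. Define $\sigma_f:Kf\to K\lambda_f$ by $x\mapsto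 x$, $(u,y)\mapsto(\sigma_f\circ u,(u,y))$, and $\pi_f:K\rho_f\to Kf$ by $z\mapsto z$ for $z\in Kf$, $(u,y)\mapsto(\pi_f\circ u,y)$. (Since these maps preserve substitution, this fixes them on abstracted boxes.) These data are an algebraic weak factorisation system on $\mathsf{01Sub}$: $L:f\mapsto\lambda_f$ is a comonad $\mathbb L$ with comultiplication $(1,\sigma_f)$, and $R:f\mapsto\rho_f$ is a monad $\mathbb R$ with multiplication $(\pi_f,1)$, on the arrow category $\mathsf{01Sub}^{\mathbf 2}$. Let $\mathbb L\text{-}\mathbf{Map}$ be the category of $\mathbb L$-coalgebras and $\mathbb R\text{-}\mathbf{Map}$ the category of $\mathbb R$-algebras. *The diagram.* For a finite $A\subseteq\mathbb A$, let $\square_A$ be the set of functions $f:A\to\mathbb A\amalg 2$ that are injective on $f^{-1}(\mathbb A)$, with $(\pi f)(x)=\pi(f(x))$ if $f(x)\in\mathbb A$, $(\pi f)(x)=f(x)$ otherwise, and $f(c:=k)(x)=k$ if $f(x)=c$, $f(c:=k)(x)=f(x)$ otherwise. For $a\in A$, let $\sqcup^i_{A,a}\subseteq\square_A$ consist of those $f$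 with $f(b)=j$ for some $(b,j)\in(A\times2)\setminus\{(a,i)\}$. Let $X\ast Y=\{(x,y)\in X\times Y: x\# y\}$, with componentwise structure. Let $\mathcal J$ be the category whose objects are the $(i,A,a,B)$ with $i\in2$, $A,B\subseteq\mathbb A$ finite and $a\in A$. There are morphisms $(i,A,a,B)\to(i',A',a',B')$ only if $i=i'$, and then they are the pairs $(f,g)$ of a bijection $f:A'\to A$ with $f(a')=a$ and a function $g:B'\to B\amalg2$ that is injective on $g^{-1}(B)$; the composite of $(f,g)$ followed by $(f',g')$ is $(f\circ f',(g\amalg 1_2)\circ g')$, up to the identification $2\amalg2\to 2$. Let $J:\mathcal J\to\mathsf{01Sub}^{\mathbf2}$ be the functor that sends $(i,A,a,B)$ to the inclusion $\sqcup^i_{A,a}\ast\square_B\hookrightarrow\square_A\ast\square_B$ and acts on morphisms by precomposition with $f$ and with $g$ (extended by the identity on $2$). *Lifting.* For a functor $U:\mathcal C\to\mathsf{01Sub}^{\mathbf2}$, let $\mathcal C^\pitchfork$ be the category whose objects are the arrows $p$ of $\mathsf{01Sub}$ with a choice of a diagonal filler $\phi(c,s)$ for each $c\in\mathcal C$ and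 each square $s:Uc\to p$, subject to $\phi(c,s\circ Um)=\phi(c',s)\circ\operatorname{cod}(Um)$ for $m:c\to c'$ and $s:Uc'\to p$, and whose morphisms are the squares that commute with the chosen fillers. A functor $\eta:\mathcal C\to\mathcal C'$ over $\mathsf{01Sub}^{\mathbf2}$ induces $\eta^\pitchfork:\mathcal C'^\pitchfork\to\mathcal C^\pitchfork$ by restriction. Let $\operatorname{lift}:\mathbb R\text{-}\mathbf{Map}\to\mathbb L\text{-}\mathbf{Map}^\pitchfork$ send an algebra $(p,\,t:Kp\to\operatorname{dom}p)$ to $p$ with the fillers $t\circ K(s)\circ c$ for coalgebras $(q,\,c:\operatorname{cod}q\to Kq)$ and squares $s:q\to p$. **Theorem.** There is a functor $\eta:\mathcal J\to\mathbb L\text{-}\mathbf{Map}$ whose composite with the forgetful functor $\mathbb L\text{-}\mathbf{Map}\to\mathsf{01Sub}^{\mathbf2}$ is $J$ and such that the composite $$\mathbb R\text{-}\mathbf{Map}\xrightarrow{\ \operatorname{lift}\ }\mathbb L\text{-}\mathbf{Map}^\pitchfork\xrightarrow{\ \eta^\pitchfork\ }\mathcal J^\pitchfork$$ is an isomorphism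 of categories. That is, the algebraic weak factorisation system is algebraically free on $J$ in Garner's sense. -/

import Mathlib

open CategoryTheory
open scoped Pointwise

universe u

set_option linter.unusedSectionVars false

namespace ZeroOneSub

section Names

variable (𝔸 : Type u)

/-- The group of finite permutations of the set of names. -/
def FinPerm : Subgroup (Equiv.Perm 𝔸) where
  carrier := {π | {a | π a ≠ a}.Finite}
  one_mem' := by simp
  mul_mem' := by
    intro π π' h h'
    refine (h.union h').subset fun a ha => ?_
    by_contra hc
    simp only [Set.mem_union, Set.mem_ofPred_eq, not_or, not_not] at hc
    exact ha (by simp [hc.1, hc.2])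
  inv_mem' := by
    intro π h
    refine Set.Finite.subset h fun a ha hc => ha ?_
    rw [Equiv.Perm.inv_eq_iff_eq, hc]

variable {𝔸}

/-- `x` is fresh for `y`: they have disjoint finite supports. -/
def Fresh {X Y : Type u} [MulAction (FinPerm 𝔸) X] [MulAction (FinPerm 𝔸) Y] (x : X) (y : Y) :
    Prop :=
  ∃ A B : Finset 𝔸, MulAction.Supports (FinPerm 𝔸) (A : Set 𝔸) x ∧
    MulAction.Supports (FinPerm 𝔸) (B : Set 𝔸) y ∧ Disjoint A B

variable [DecidableEq 𝔸]

/-- The transposition of two names. -/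
def sw (a b : 𝔸) : FinPerm 𝔸 :=
  ⟨Equiv.swap a b, (Set.toFinite {a, b}).subset fun c hc => by
    by_contra h
    simp only [Set.mem_insert_iff, Set.mem_singleton_iff, not_or] at h
    exact hc (Equiv.swap_apply_of_ne_of_ne h.1 h.2)⟩

theorem sw_left (a b : 𝔸) : sw a b • a = b := Equiv.swap_apply_left a b
theorem sw_right (a b : 𝔸) : sw a b • b = a := Equiv.swap_apply_right a b
theorem sw_ne {a b c : 𝔸} (h : c ≠ a) (h' : c ≠ b) : sw a b • c = c :=
  Equiv.swap_apply_of_ne_of_ne h h'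
theorem sw_comm (a b : 𝔸) : sw a b = sw b a := Subtype.ext (Equiv.swap_comm a b)
theorem sw_inv (a b : 𝔸) : (sw a b)⁻¹ = sw a b := Subtype.ext (Equiv.swap_inv a b)
theorem sw_sw (a b : 𝔸) : sw a b * sw a b = 1 := Subtype.ext (Equiv.swap_mul_self a b)
theorem smul_ne (π : FinPerm 𝔸) {a b : 𝔸} : π • a ≠ π • b ↔ a ≠ b := by simp
theorem mul_sw (π : FinPerm 𝔸) (a b : 𝔸) : π * sw a b = sw (π • a) (π • b) * π := by
  refine Subtype.ext (Equiv.ext fun c => ?_)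
  change π • (sw a b • c) = sw (π • a) (π • b) • π • c
  by_cases h : c = a
  · rw [h, sw_left, sw_left]
  by_cases h' : c = b
  · rw [h', sw_right, sw_right]
  · rw [sw_ne h h', sw_ne (by simpa using h) (by simpa using h')]

theorem supports_smul {X : Type u} [MulAction (FinPerm 𝔸) X] (π : FinPerm 𝔸) {S : Finset 𝔸} {x : X}
    (h : MulAction.Supports (FinPerm 𝔸) (S : Set 𝔸) x) :
    MulAction.Supports (FinPerm 𝔸) ((π • S : Finset 𝔸) : Set 𝔸) (π • x) := by
  intro τ hτ
  have := h (π⁻¹ * τ * π) fun b hb => by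
    have := @hτ (π • b) (by exact_mod_cast Finset.smul_mem_smul_finset (a := π) hb)
    rw [mul_smul, mul_smul, this, inv_smul_smul]
  rwa [mul_smul, mul_smul, inv_smul_eq_iff] at this

variable [Infinite 𝔸]

theorem exists_notMem (S : Finset 𝔸) : ∃ c : 𝔸, c ∉ S := Infinite.exists_notMem_finset S

theorem fresh_name_iff {X : Type u} [MulAction (FinPerm 𝔸) X] {a : 𝔸} {x : X} :
    Fresh (𝔸 := 𝔸) a x ↔
      ∃ S : Finset 𝔸, MulAction.Supports (FinPerm 𝔸) (S : Set 𝔸) x ∧ a ∉ S := by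
  constructor
  · rintro ⟨A, B, hA, hB, hd⟩
    refine ⟨B, hB, fun haB => ?_⟩
    obtain ⟨c, hc⟩ := exists_notMem (insert a A)
    simp only [Finset.mem_insert, not_or] at hc
    have haA : a ∉ A := fun haA => (Finset.disjoint_left.1 hd) haA haB
    have := hA (sw a c) fun b hb => sw_ne (fun h => haA (h ▸ hb)) (fun h => hc.2 (h ▸ hb))
    rw [sw_left] at this
    exact hc.1 this
  · rintro ⟨S, hS, ha⟩
    exact ⟨{a}, S, MulAction.supports_of_mem _ (by simp), hS, by simpa using ha⟩

theorem Fresh.smul {X Y : Type u} [MulAction (FinPerm 𝔸) X] [MulAction (FinPerm 𝔸) Y] {x : X}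
    {y : Y} (π : FinPerm 𝔸) (h : Fresh (𝔸 := 𝔸) x y) : Fresh (𝔸 := 𝔸) (π • x) (π • y) := by
  obtain ⟨A, B, hA, hB, hd⟩ := h
  refine ⟨π • A, π • B, supports_smul π hA, supports_smul π hB, ?_⟩
  rw [Finset.disjoint_left] at hd ⊢
  intro c hc
  rw [← Finset.inv_smul_mem_iff] at hc ⊢
  exact hd hc

/-- Freshness of a name, tested by transpositions with almost all names. -/
theorem fresh_iff_sw {X : Type u} [MulAction (FinPerm 𝔸) X]
    (hX : ∀ x : X, ∃ S : Finset 𝔸, MulAction.Supports (FinPerm 𝔸) (S : Set 𝔸) x) {a : 𝔸} {x : X} :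
    Fresh (𝔸 := 𝔸) a x ↔ ∃ S : Finset 𝔸, ∀ c ∉ S, sw a c • x = x := by
  constructor
  · rw [fresh_name_iff]
    rintro ⟨S, hS, ha⟩
    exact ⟨S, fun c hc => hS _ fun s hs =>
      sw_ne (fun h => ha (h ▸ hs)) (fun h => hc (h ▸ hs))⟩
  · rintro ⟨S, hS⟩
    obtain ⟨T, hT⟩ := hX x
    obtain ⟨c, hc⟩ := exists_notMem (S ∪ T)
    simp only [Finset.mem_union, not_or] at hc
    have h1 : Fresh (𝔸 := 𝔸) c x := fresh_name_iff.2 ⟨T, hT, hc.2⟩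
    have h2 := h1.smul (sw a c)
    rwa [hS c hc.1, sw_right] at h2

end Names

/-- A 01-substitution set: a nominal set with a 01-substitution operation, where
`sub x a i` is `x(a := i)` and `false`, `true` are the elements `0`, `1` of `2`. -/
structure Sub01 (𝔸 : Type u) [DecidableEq 𝔸] : Type (u + 1) where
  carrier : Type u
  [act : MulAction (FinPerm 𝔸) carrier]
  exists_supports : ∀ x : carrier, ∃ S : Finset 𝔸, MulAction.Supports (FinPerm 𝔸) (S : Set 𝔸) x
  sub : carrier → 𝔸 → Bool → carrier
  smul_sub : ∀ (π : FinPerm 𝔸) x a i, π • sub x a i = sub (π • x) (π • a) i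
  fresh_sub : ∀ x a i, Fresh (𝔸 := 𝔸) a (sub x a i)
  sub_of_fresh : ∀ x a i, Fresh (𝔸 := 𝔸) a x → sub x a i = x
  sub_comm : ∀ x a i a' i', a ≠ a' → sub (sub x a i) a' i' = sub (sub x a' i') a i

namespace Sub01

variable {𝔸 : Type u} [DecidableEq 𝔸]

instance : CoeSort (Sub01 𝔸) (Type u) := ⟨carrier⟩
attribute [instance] act

/-- Morphisms of 01-substitution sets. -/
@[ext] structure Hom (X Y : Sub01 𝔸) : Type u where
  toFun : X → Y
  map_smul : ∀ (π : FinPerm 𝔸) x, toFun (π • x) = π • toFun x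
  map_sub : ∀ x a i, toFun (X.sub x a i) = Y.sub (toFun x) a i

instance : Category (Sub01 𝔸) where
  Hom := Hom
  id X := ⟨id, fun _ _ => rfl, fun _ _ _ => rfl⟩
  comp f g := ⟨g.toFun ∘ f.toFun, fun π x => by simp [f.map_smul, g.map_smul],
    fun x a i => by simp [f.map_sub, g.map_sub]⟩

instance (X Y : Sub01 𝔸) : CoeFun (X ⟶ Y) fun _ => X → Y := ⟨Hom.toFun⟩

theorem hom_ext {X Y : Sub01 𝔸} {f g : X ⟶ Y} (h : ∀ x, f x = g x) : f = g :=
  Hom.ext (funext h)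

theorem comp_apply {X Y Z : Sub01 𝔸} (f : X ⟶ Y) (g : Y ⟶ Z) (x : X) : (f ≫ g) x = g (f x) := rfl

theorem id_apply {X : Sub01 𝔸} (x : X) : (𝟙 X : X ⟶ X) x = x := rfl

theorem hom_smul {X Y : Sub01 𝔸} (f : X ⟶ Y) (π : FinPerm 𝔸) (x : X) : f (π • x) = π • f x :=
  f.map_smul π x

theorem hom_sub {X Y : Sub01 𝔸} (f : X ⟶ Y) (x : X) (a : 𝔸) (i : Bool) :
    f (X.sub x a i) = Y.sub (f x) a i :=
  f.map_sub x a i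

theorem supports_hom {X Y : Sub01 𝔸} (f : X ⟶ Y) {S : Set 𝔸} {x : X}
    (h : MulAction.Supports (FinPerm 𝔸) S x) : MulAction.Supports (FinPerm 𝔸) S (f x) :=
  fun π hπ => by rw [← hom_smul, h π hπ]

theorem fresh_hom {X Y : Sub01 𝔸} (f : X ⟶ Y) {a : 𝔸} {x : X} (h : Fresh (𝔸 := 𝔸) a x) :
    Fresh (𝔸 := 𝔸) a (f x) := by
  obtain ⟨A, B, hA, hB, hd⟩ := h
  exact ⟨A, B, hA, supports_hom f hB, hd⟩

variable [Infinite 𝔸]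

theorem supports_sub (X : Sub01 𝔸) {S : Finset 𝔸} {x : X}
    (h : MulAction.Supports (FinPerm 𝔸) (S : Set 𝔸) x) (a : 𝔸) (i : Bool) :
    MulAction.Supports (FinPerm 𝔸) (S : Set 𝔸) (X.sub x a i) := by
  by_cases ha : a ∈ S
  · intro π hπ
    rw [X.smul_sub, h π hπ, hπ ha]
  · rwa [X.sub_of_fresh x a i (fresh_name_iff.2 ⟨S, h, ha⟩)]

theorem smul_eq_of_agree (X : Sub01 𝔸) {S : Finset 𝔸} {x : X}
    (h : MulAction.Supports (FinPerm 𝔸) (S : Set 𝔸) x) {π π' : FinPerm 𝔸}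
    (e : ∀ s ∈ S, π • s = π' • s) : π • x = π' • x := by
  have := h (π'⁻¹ * π) fun s hs => by rw [mul_smul, e s hs, inv_smul_smul]
  rwa [mul_smul, inv_smul_eq_iff] at this

end Sub01


/-- The index set `(A × 2) ∖ {(a, i)}` of the faces of an `i`-open `(A, a)`-box. -/
def InDom {𝔸 : Type u} (i : Bool) (A : Finset 𝔸) (a b : 𝔸) (j : Bool) : Prop :=
  b ∈ A ∧ ¬(b = a ∧ j = i)

/-- Formal elements: elements `x` of `X`, open boxes `(u, y)` serving as their own fillers, and
abstracted boxes `⟨a⟩(u, y)`. Only the values of `u` on `InDom i A a` matter. -/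
inductive Raw (𝔸 X Y : Type u) : Type u
  | base (x : X) : Raw 𝔸 X Y
  | box (i : Bool) (A : Finset 𝔸) (a : 𝔸) (u : 𝔸 → Bool → Raw 𝔸 X Y) (y : Y) : Raw 𝔸 X Y
  | comp (i : Bool) (A : Finset 𝔸) (a : 𝔸) (u : 𝔸 → Bool → Raw 𝔸 X Y) (y : Y) : Raw 𝔸 X Y

namespace Raw

section Action

variable {𝔸 X Y : Type u} [DecidableEq 𝔸] [MulAction (FinPerm 𝔸) X] [MulAction (FinPerm 𝔸) Y]

/-- The componentwise action of permutations. -/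
def perm (π : FinPerm 𝔸) : Raw 𝔸 X Y → Raw 𝔸 X Y
  | base x => base (π • x)
  | box i A a u y => box i (π • A) (π • a) (fun b j => perm π (u (π⁻¹ • b) j)) (π • y)
  | comp i A a u y => comp i (π • A) (π • a) (fun b j => perm π (u (π⁻¹ • b) j)) (π • y)

instance : MulAction (FinPerm 𝔸) (Raw 𝔸 X Y) where
  smul := perm
  one_smul r := by
    change perm 1 r = r
    induction r with
    | base x => simp [perm]
    | box i A a u y ih => simp [perm, ih]
    | comp i A a u y ih => simp [perm, ih]
  mul_smul π π' r := by
    change perm (π * π') r = perm π (perm π' r)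
    induction r with
    | base x => simp [perm, mul_smul]
    | box i A a u y ih => simp [perm, ih, mul_smul]
    | comp i A a u y ih => simp [perm, ih, mul_smul]

theorem smul_base (π : FinPerm 𝔸) (x : X) : π • (base x : Raw 𝔸 X Y) = base (π • x) := rfl
theorem smul_box (π : FinPerm 𝔸) (i A a) (u : 𝔸 → Bool → Raw 𝔸 X Y) (y : Y) : π • box i A a u y =
    box i (π • A) (π • a) (fun b j => π • u (π⁻¹ • b) j) (π • y) := rfl
theorem smul_comp (π : FinPerm 𝔸) (i A a) (u : 𝔸 → Bool → Raw 𝔸 X Y) (y : Y) : π • comp i A a u y =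
    comp i (π • A) (π • a) (fun b j => π • u (π⁻¹ • b) j) (π • y) := rfl

theorem inDom_smul {π : FinPerm 𝔸} {i A} {a b : 𝔸} {j} :
    InDom i (π • A) (π • a) b j ↔ InDom i A a (π⁻¹ • b) j := by
  simp only [InDom, Finset.inv_smul_mem_iff, inv_smul_eq_iff]

/-- Equality of formal elements: boxes are compared face by face, and `⟨a⟩(u, y)` stands for
`(u, y)` up to `α`-equivalence in the name `a`. -/
inductive Rel : Raw 𝔸 X Y → Raw 𝔸 X Y → Prop
  | base (x : X) : Rel (base x) (base x)
  | box {i A a u u' y} (h : ∀ b j, InDom i A a b j → Rel (u b j) (u' b j)) :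
      Rel (box i A a u y) (box i A a u' y)
  | comp {i A a u y A' a' u' y'} (S : Finset 𝔸)
      (h : ∀ c ∉ S, Rel (sw a c • Raw.box i A a u y) (sw a' c • Raw.box i A' a' u' y')) :
      Rel (comp i A a u y) (comp i A' a' u' y')

theorem Rel.smul {r r' : Raw 𝔸 X Y} (h : Rel r r') (π : FinPerm 𝔸) : Rel (π • r) (π • r') := by
  induction h generalizing π with
  | base x => exact .base _
  | box h ih => exact .box fun b j hb => ih _ _ (inDom_smul.1 hb) _
  | @comp i A a u y A' a' u' y' S h ih =>
    refine .comp (π • S) fun c hc => ?_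
    have := ih (π⁻¹ • c) (by rwa [Finset.inv_smul_mem_iff]) π
    rw [← mul_smul, ← mul_smul, mul_sw, mul_sw, smul_inv_smul, mul_smul, mul_smul] at this
    exact this

theorem Rel.symm {r r' : Raw 𝔸 X Y} (h : Rel r r') : Rel r' r := by
  induction h with
  | base x => exact .base _
  | box h ih => exact .box ih
  | comp S h ih => exact .comp S ih

theorem Rel.trans {r r' r'' : Raw 𝔸 X Y} (h : Rel r r') (h' : Rel r' r'') : Rel r r'' := by
  induction h generalizing r'' with
  | base x => exact h'
  | box h ih =>
    cases h' with
    | box h' => exact .box fun b j hb => ih b j hb (h' b j hb)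
  | comp S h ih =>
    cases h' with
    | comp S' h' =>
      refine .comp (S ∪ S') fun c hc => ?_
      simp only [Finset.mem_union, not_or] at hc
      exact ih c hc.1 (h' c hc.2)

theorem Rel.comp_congr {i A a y} {u u' : 𝔸 → Bool → Raw 𝔸 X Y}
    (h : ∀ b j, InDom i A a b j → Rel (u b j) (u' b j)) :
    Rel (Raw.comp i A a u y) (Raw.comp i A a u' y) :=
  .comp ∅ fun _ _ => (Rel.box h).smul _

theorem Rel.refl (r : Raw 𝔸 X Y) : Rel r r := by
  induction r with
  | base x => exact .base x
  | box i A a u y ih => exact .box fun b j _ => ih b j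
  | comp i A a u y ih => exact .comp_congr fun b j _ => ih b j

theorem Rel.of_eq {r r' : Raw 𝔸 X Y} (h : r = r') : Rel r r' := h ▸ .refl _

theorem Rel.box' {i A a u y A' a' u' y'} (hA : A = A') (ha : a = a') (hy : y = y')
    (h : ∀ b j, InDom i A a b j → Rel (u b j) (u' b j)) :
    Rel (Raw.box i A a u y : Raw 𝔸 X Y) (Raw.box i A' a' u' y') := by
  subst hA ha hy
  exact .box h

end Action

variable {𝔸 : Type u} [DecidableEq 𝔸] [Infinite 𝔸] {X Y : Sub01 𝔸}

theorem exists_supp (r : Raw 𝔸 X Y) : ∃ S : Finset 𝔸, ∀ π π' : FinPerm 𝔸,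
    (∀ s ∈ S, π • s = π' • s) → Rel (π • r) (π' • r) := by
  have key : ∀ (i A a) (u : 𝔸 → Bool → Raw 𝔸 X Y) (y : Y), (∀ b j, ∃ S : Finset 𝔸,
      ∀ π π' : FinPerm 𝔸, (∀ s ∈ S, π • s = π' • s) → Rel (π • u b j) (π' • u b j)) →
      ∃ S : Finset 𝔸, a ∈ S ∧ ∀ π π' : FinPerm 𝔸, (∀ s ∈ S, π • s = π' • s) →
        Rel (π • box i A a u y) (π' • box i A a u y) := by
    intro i A a u y ih
    choose S hS using ih
    obtain ⟨T, hT⟩ := Y.exists_supports y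
    refine ⟨insert a (T ∪ A ∪ A.biUnion fun b => S b false ∪ S b true), by simp, ?_⟩
    intro π π' e
    simp only [Finset.mem_insert, Finset.mem_union, Finset.mem_biUnion] at e
    have hA : π • A = π' • A := Finset.image_congr fun s hs => e s (by simp_all)
    refine Rel.box' hA (e a (by simp)) (Y.smul_eq_of_agree hT fun s hs => e s (by simp [hs])) ?_
    intro b j hb
    have hbA : π⁻¹ • b ∈ A := (inDom_smul.1 hb).1
    have : π⁻¹ • b = π'⁻¹ • b := by
      rw [eq_inv_smul_iff, ← e _ (by simp [hbA]), smul_inv_smul]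
    rw [← this]
    refine hS _ _ _ _ fun s hs => e s (Or.inr (Or.inr ⟨_, hbA, ?_⟩))
    cases j <;> simp [hs]
  induction r with
  | base x =>
    obtain ⟨T, hT⟩ := X.exists_supports x
    exact ⟨T, fun π π' e => .of_eq (congrArg base (X.smul_eq_of_agree hT e))⟩
  | box i A a u y ih => exact (key i A a u y ih).imp fun S h => h.2
  | comp i A a u y ih =>
    obtain ⟨S, ha, hS⟩ := key i A a u y ih
    refine ⟨S, fun π π' e => .comp ∅ fun c _ => ?_⟩
    have := hS (sw (π • a) c * π) (sw (π • a) c * π') fun s hs => by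
      rw [mul_smul, mul_smul, e s hs]
    rw [mul_smul, mul_smul] at this
    simp only [← e a ha]
    simp only [smul_box π, smul_box π', ← e a ha] at this
    exact this

/-- `⟨a⟩(u, y)` can be renamed along any sufficiently fresh name. -/
theorem exists_rename (i A a) (u : 𝔸 → Bool → Raw 𝔸 X Y) (y : Y) : ∃ S : Finset 𝔸, ∀ c ∉ S,
    Rel (sw a c • comp i A a u y) (comp i A a u y) := by
  obtain ⟨S, hS⟩ := exists_supp (box i A a u y)
  refine ⟨S, fun c hc => .comp (insert c S) fun d hd => ?_⟩
  simp only [Finset.mem_insert, not_or] at hd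
  rw [sw_left]
  have := hS (sw c d * sw a c) (sw a d) fun s hs => by
    have h1 : s ≠ c := fun h => hc (h ▸ hs)
    have h2 : s ≠ d := fun h => hd.2 (h ▸ hs)
    rw [mul_smul]
    by_cases h : s = a
    · rw [h, sw_left, sw_left, sw_left]
    · rw [sw_ne h h1, sw_ne h1 h2, sw_ne h h2]
  rw [mul_smul, smul_box (sw a c), sw_left] at this
  exact this

/-- The name `a` is fresh for the element represented by `r`. -/
def Fr (a : 𝔸) (r : Raw 𝔸 X Y) : Prop := ∃ S : Finset 𝔸, ∀ c ∉ S, Rel (sw a c • r) r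

/-- The substitution operation. -/
def sub : Raw 𝔸 X Y → 𝔸 → Bool → Raw 𝔸 X Y
  | base x, d, j => base (X.sub x d j)
  | box i A a u y, d, j =>
    if d ∈ A then if d = a ∧ j = i then comp i A a u y else u d j
    else box i A a (fun b k => sub (u b k) d j) (Y.sub y d j)
  | comp i A a u y, d, j =>
    if d = a then comp i A a u y
    else if d ∈ A then sub (u d j) a i
    else comp i A a (fun b k => sub (u b k) d j) (Y.sub y d j)

/-- The map to `Y`. -/
def rho (f : X ⟶ Y) : Raw 𝔸 X Y → Y
  | base x => f x
  | box _ _ _ _ y => y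
  | comp i _ a _ y => Y.sub y a i

/-- Well-formed formal elements: hereditarily, `(u, y)` is an open box over `rho`. -/
def WF (f : X ⟶ Y) : Raw 𝔸 X Y → Prop
  | base _ => True
  | box i A a u y | comp i A a u y => a ∈ A ∧ ∀ b j, InDom i A a b j →
      WF f (u b j) ∧ Fr b (u b j) ∧ rho f (u b j) = Y.sub y b j ∧
        ∀ b' j', InDom i A a b' j' → b ≠ b' → Rel (sub (u b j) b' j') (sub (u b' j') b j)

theorem smul_sub (π : FinPerm 𝔸) (r : Raw 𝔸 X Y) (d j) :
    π • sub r d j = sub (π • r) (π • d) j := by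
  induction r generalizing d j with
  | base x => simp only [sub, smul_base, X.smul_sub]
  | box i A a u y ih =>
    simp only [sub, smul_box, Finset.smul_mem_smul_finset_iff, smul_left_cancel_iff]
    split_ifs <;> simp [smul_comp, smul_box, ih, Y.smul_sub]
  | comp i A a u y ih =>
    simp only [sub, smul_comp, Finset.smul_mem_smul_finset_iff, smul_left_cancel_iff]
    split_ifs <;> simp [smul_comp, ih, Y.smul_sub]

theorem rho_smul (f : X ⟶ Y) (π : FinPerm 𝔸) (r : Raw 𝔸 X Y) : rho f (π • r) = π • rho f r := by
  cases r <;> simp [smul_base, smul_box, smul_comp, rho, Sub01.hom_smul, Y.smul_sub]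

theorem Fr.smul {a : 𝔸} {r : Raw 𝔸 X Y} (h : Fr a r) (π : FinPerm 𝔸) : Fr (π • a) (π • r) := by
  obtain ⟨S, hS⟩ := h
  refine ⟨π • S, fun c hc => ?_⟩
  have := (hS (π⁻¹ • c) (by rwa [Finset.inv_smul_mem_iff])).smul π
  rwa [← mul_smul, mul_sw, smul_inv_smul, mul_smul] at this

theorem WF.smul {f : X ⟶ Y} {r : Raw 𝔸 X Y} (h : WF f r) (π : FinPerm 𝔸) : WF f (π • r) := by
  have key : ∀ (i A a) (u : 𝔸 → Bool → Raw 𝔸 X Y) (y : Y),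
      (∀ b j, WF f (u b j) → ∀ π : FinPerm 𝔸, WF f (π • u b j)) → ∀ π : FinPerm 𝔸,
      WF f (box i A a u y) → WF f (π • box i A a u y) := by
    rintro i A a u y ih π ⟨ha, h⟩
    refine ⟨Finset.smul_mem_smul_finset ha, fun b j hb => ?_⟩
    obtain ⟨h1, h2, h3, h4⟩ := h _ _ (inDom_smul.1 hb)
    refine ⟨ih _ _ h1 _, ?_, ?_, fun b' j' hb' hne => ?_⟩
    · have := h2.smul π
      rwa [smul_inv_smul] at this
    · change rho f (π • u (π⁻¹ • b) j) = _
      rw [rho_smul, h3, Y.smul_sub, smul_inv_smul]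
    · change Rel (sub (π • u (π⁻¹ • b) j) b' j') (sub (π • u (π⁻¹ • b') j') b j)
      simpa [smul_sub] using (h4 _ _ (inDom_smul.1 hb') (by simpa using hne)).smul π
  induction r generalizing π with
  | base x => trivial
  | box i A a u y ih => exact key i A a u y (fun b j h π => ih b j h π) π h
  | comp i A a u y ih => exact key i A a u y (fun b j h π => ih b j h π) π h

theorem rho_rel (f : X ⟶ Y) {r r' : Raw 𝔸 X Y} (h : Rel r r') : rho f r = rho f r' := by
  induction h with
  | base x => rfl
  | box h ih => rfl
  | @comp i A a u y A' a' u' y' S h ih =>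
    obtain ⟨T, hT⟩ := (fresh_iff_sw Y.exists_supports).1 (Y.fresh_sub y a i)
    obtain ⟨T', hT'⟩ := (fresh_iff_sw Y.exists_supports).1 (Y.fresh_sub y' a' i)
    obtain ⟨c, hc⟩ := exists_notMem (S ∪ T ∪ T')
    simp only [Finset.mem_union, not_or] at hc
    have h1 : sw a c • y = sw a' c • y' := ih c hc.1.1
    change Y.sub y a i = Y.sub y' a' i
    rw [← hT c hc.1.2, ← hT' c hc.2, Y.smul_sub, Y.smul_sub, sw_left, sw_left, h1]

theorem Fr.rel {a : 𝔸} {r r' : Raw 𝔸 X Y} (h : Fr a r) (e : Rel r r') : Fr a r' := by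
  obtain ⟨S, hS⟩ := h
  exact ⟨S, fun c hc => ((e.symm.smul _).trans (hS c hc)).trans e⟩

theorem Rel.box_inv {i A a u y i' A' a' u' y'}
    (h : Rel (Raw.box i A a u y : Raw 𝔸 X Y) (Raw.box i' A' a' u' y')) :
    A = A' ∧ a = a' ∧ y = y' ∧ ∀ b j, InDom i A a b j → Rel (u b j) (u' b j) := by
  cases h with
  | box h => exact ⟨rfl, rfl, rfl, h⟩

theorem exists_sub_rel (r : Raw 𝔸 X Y) : ∃ S : Finset 𝔸, ∀ d ∉ S, ∀ j, Rel (sub r d j) r := by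
  have key : ∀ (i A a) (u : 𝔸 → Bool → Raw 𝔸 X Y) (y : Y),
      (∀ b k, ∃ S : Finset 𝔸, ∀ d ∉ S, ∀ j, Rel (sub (u b k) d j) (u b k)) →
      ∃ S : Finset 𝔸, ∀ d ∉ S, d ≠ a ∧ d ∉ A ∧ ∀ j, Y.sub y d j = y ∧
        ∀ b k, InDom i A a b k → Rel (sub (u b k) d j) (u b k) := by
    intro i A a u y ih
    choose S hS using ih
    obtain ⟨T, hT⟩ := Y.exists_supports y
    refine ⟨insert a (T ∪ A ∪ A.biUnion fun b => S b false ∪ S b true), fun d hd => ?_⟩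
    simp only [Finset.mem_insert, Finset.mem_union, Finset.mem_biUnion, not_or, not_exists,
      not_and] at hd
    refine ⟨hd.1, hd.2.1.2, fun j => ⟨Y.sub_of_fresh _ _ _ (fresh_name_iff.2 ⟨T, hT, hd.2.1.1⟩),
      fun b k hb => hS b k d ?_ j⟩⟩
    have := hd.2.2 b hb.1
    cases k
    · exact this.1
    · exact this.2
  induction r with
  | base x =>
    obtain ⟨T, hT⟩ := X.exists_supports x
    exact ⟨T, fun d hd j => .of_eq (congrArg base
      (X.sub_of_fresh _ _ _ (fresh_name_iff.2 ⟨T, hT, hd⟩)))⟩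
  | box i A a u y ih =>
    obtain ⟨S, hS⟩ := key i A a u y ih
    refine ⟨S, fun d hd j => ?_⟩
    obtain ⟨-, h2, h3⟩ := hS d hd
    simp only [sub, h2, if_false, (h3 j).1]
    exact .box (h3 j).2
  | comp i A a u y ih =>
    obtain ⟨S, hS⟩ := key i A a u y ih
    refine ⟨S, fun d hd j => ?_⟩
    obtain ⟨h1, h2, h3⟩ := hS d hd
    simp only [sub, h1, h2, if_false, (h3 j).1]
    exact .comp_congr (h3 j).2

theorem fr_cell {i A} {a : 𝔸} {u : 𝔸 → Bool → Raw 𝔸 X Y} {y : Y} {d : 𝔸} (ha : a ∈ A) (hd : d ∉ A)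
    (hy : Fresh (𝔸 := 𝔸) d y) (h : ∀ b j, InDom i A a b j → Fr d (u b j)) :
    Fr d (box i A a u y) ∧ Fr d (comp i A a u y) := by
  have : ∀ b j, ∃ S : Finset 𝔸, InDom i A a b j → ∀ c ∉ S, Rel (sw d c • u b j) (u b j) := by
    intro b j
    by_cases hb : InDom i A a b j
    · exact (h b j hb).imp fun S hS _ => hS
    · exact ⟨∅, fun h => absurd h hb⟩
  choose S hS using this
  obtain ⟨T, hT⟩ := (fresh_iff_sw Y.exists_supports).1 hy
  have key : ∀ c ∉ T ∪ A ∪ A.biUnion fun b => S b false ∪ S b true,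
      sw d c • A = A ∧ sw d c • a = a ∧ sw d c • y = y ∧
        ∀ b j, InDom i A a b j → Rel (sw d c • u ((sw d c)⁻¹ • b) j) (u b j) := by
    intro c hc
    simp only [Finset.mem_union, Finset.mem_biUnion, not_or, not_exists, not_and] at hc
    have hfix : ∀ b ∈ A, sw d c • b = b := fun b hb =>
      sw_ne (fun h => hd (h ▸ hb)) (fun h => hc.1.2 (h ▸ hb))
    refine ⟨?_, hfix a ha, hT c hc.1.1, fun b j hb => ?_⟩
    · exact (Finset.image_congr fun b hb => hfix b hb).trans Finset.image_id
    · rw [sw_inv, hfix b hb.1]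
      refine hS b j hb c ?_
      have := hc.2 b hb.1
      cases j
      · exact this.1
      · exact this.2
  generalize T ∪ A ∪ A.biUnion (fun b => S b false ∪ S b true) = S' at key
  constructor
  · refine ⟨S', fun c hc => ?_⟩
    obtain ⟨h1, h2, h3, h4⟩ := key c hc
    rw [smul_box, h1, h2, h3]
    exact .box h4
  · refine ⟨S', fun c hc => ?_⟩
    obtain ⟨h1, h2, h3, h4⟩ := key c hc
    rw [smul_comp, h1, h2, h3]
    exact .comp_congr h4

theorem rename_sub {i A} {a : 𝔸} {u : 𝔸 → Bool → Raw 𝔸 X Y} {y : Y}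
    (h : ∀ b j, b ∈ A → b ≠ a → Fr a (sub (u b j) a i)) (d : 𝔸) (j : Bool) : ∃ S : Finset 𝔸, ∀ c ∉ S,
      Rel (sub (sw a c • comp i A a u y) d j) (sub (comp i A a u y) d j) := by
  by_cases hd : d = a
  · subst hd
    obtain ⟨S, hS⟩ := exists_sub_rel (comp i A d u y)
    obtain ⟨T, hT⟩ := exists_rename i A d u y
    refine ⟨S ∪ T, fun c hc => ?_⟩
    simp only [Finset.mem_union, not_or] at hc
    have e := smul_sub (sw d c) (comp i A d u y) c j
    rw [sw_right] at e
    rw [← e]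
    refine (((hS c hc.1 j).smul _).trans (hT c hc.2)).trans (.of_eq ?_)
    simp [sub]
  · have : Fr a (sub (comp i A a u y) d j) := by
      simp only [sub, hd, if_false]
      split_ifs with hA
      · exact h d j hA hd
      · exact exists_rename _ _ _ _ _
    obtain ⟨S, hS⟩ := this
    refine ⟨insert d S, fun c hc => ?_⟩
    simp only [Finset.mem_insert, not_or] at hc
    have e := smul_sub (sw a c) (comp i A a u y) d j
    rw [sw_ne hd (Ne.symm hc.1)] at e
    rw [← e]
    exact hS c hc.2

theorem sub_aux (f : X ⟶ Y) (r : Raw 𝔸 X Y) (hr : WF f r) : (∀ d j, Fr d (sub r d j)) ∧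
    ∀ r', WF f r' → Rel r r' → ∀ d j, Rel (sub r d j) (sub r' d j) := by
  induction r with
  | base x =>
    refine ⟨fun d j => ?_, fun r' _ h d j => ?_⟩
    · obtain ⟨T, hT⟩ := (fresh_iff_sw X.exists_supports).1 (X.fresh_sub x d j)
      exact ⟨T, fun c hc => .of_eq (congrArg base (hT c hc))⟩
    · cases h
      exact .refl _
  | box i A a u y ih =>
    obtain ⟨ha, h⟩ := hr
    have ih1 := fun b j hb => (ih b j (h b j hb).1).1
    have ih2 := fun b j hb => (ih b j (h b j hb).1).2
    refine ⟨fun d j => ?_, fun r' hr' hrel d j => ?_⟩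
    · simp only [sub]
      split_ifs with h1 h2
      · rw [h2.1]
        exact exists_rename _ _ _ _ _
      · exact (h d j ⟨h1, h2⟩).2.1
      · exact (fr_cell ha h1 (Y.fresh_sub _ _ _) fun b k hb => ih1 b k hb d j).1
    · cases hrel with
      | box hu =>
        simp only [sub]
        split_ifs with h1 h2
        · exact .comp_congr hu
        · exact hu d j ⟨h1, h2⟩
        · exact .box fun b k hb => ih2 b k hb _ (hr'.2 b k hb).1 (hu b k hb) d j
  | comp i A a u y ih =>
    obtain ⟨ha, h⟩ := hr
    have ih1 := fun b j hb => (ih b j (h b j hb).1).1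
    have ih2 := fun b j hb => (ih b j (h b j hb).1).2
    refine ⟨fun d j => ?_, fun r' hr' hrel d j => ?_⟩
    · simp only [sub]
      split_ifs with h1 h2
      · rw [h1]
        exact exists_rename _ _ _ _ _
      · have hb : InDom i A a d j := ⟨h2, fun h => h1 h.1⟩
        obtain ⟨S, hS⟩ := (h d j hb).2.1
        refine ⟨insert a S, fun c hc => ?_⟩
        simp only [Finset.mem_insert, not_or] at hc
        rw [smul_sub, sw_ne (Ne.symm h1) (Ne.symm hc.1)]
        exact (ih2 d j hb _ ((h d j hb).1.smul _) (hS c hc.2).symm a i).symm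
      · exact (fr_cell ha h2 (Y.fresh_sub _ _ _) fun b k hb => ih1 b k hb d j).2
    · cases hrel with
      | @comp _ _ _ _ _ A' a' u' y' S hS =>
        have ih3 : ∀ (π : FinPerm 𝔸) b j, InDom i A a b j → ∀ r', WF f r' →
            Rel (π • u b j) r' → ∀ d j', Rel (sub (π • u b j) d j') (sub r' d j') := by
          intro π b j hb r' hr' e d j'
          have := (ih2 b j hb (π⁻¹ • r') (hr'.smul _) (by simpa using e.smul π⁻¹)
            (π⁻¹ • d) j').smul π
          simpa [smul_sub] using this
        have key : ∀ c ∉ S, sw a c • A = sw a' c • A' ∧ sw a c • y = sw a' c • y' ∧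
            ∀ b j, InDom i (sw a c • A) c b j → ∀ d j',
            Rel (sub (sw a c • u ((sw a c)⁻¹ • b) j) d j')
              (sub (sw a' c • u' ((sw a' c)⁻¹ • b) j) d j') := by
          intro c hc
          obtain ⟨h1, h2, h3, h4⟩ := (hS c hc).box_inv
          refine ⟨h1, h3, fun b j hb => ?_⟩
          have hb' : InDom i (sw a c • A) (sw a c • a) b j := by rwa [sw_left]
          have hb'' : InDom i (sw a' c • A') (sw a' c • a') b j := by rwa [← h1, ← h2]
          exact ih3 _ _ _ (inDom_smul.1 hb') _ ((hr'.2 _ _ (inDom_smul.1 hb'')).1.smul _)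
            (h4 b j hb')
        have hfr : ∀ b j, b ∈ A' → b ≠ a' → Fr a' (sub (u' b j) a' i) := by
          intro b j hb hba
          obtain ⟨c, hc⟩ := exists_notMem S
          obtain ⟨h1, -, h3⟩ := key c hc
          have hb1 : InDom i (sw a c • A) c (sw a' c • b) j := by
            rw [h1]
            refine ⟨Finset.smul_mem_smul_finset hb, fun h => hba ?_⟩
            exact smul_left_cancel (sw a' c) (h.1.trans (sw_left a' c).symm)
          have hb2 : InDom i A a ((sw a c)⁻¹ • sw a' c • b) j := by
            refine inDom_smul.1 ?_
            rwa [sw_left]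
          have h5 := ((ih1 _ _ hb2 a i).smul (sw a c))
          rw [smul_sub, sw_left] at h5
          have h6 := (h5.rel (h3 _ _ hb1 c i)).smul (sw a' c)
          simpa [smul_sub, sw_right, ← mul_smul, sw_sw] using h6
        obtain ⟨S1, h1⟩ := rename_sub (y := y)
          (fun b j hb hba => ih1 b j ⟨hb, fun h => hba h.1⟩ a i) d j
        obtain ⟨S2, h2⟩ := rename_sub (y := y') hfr d j
        obtain ⟨c, hc⟩ := exists_notMem (insert d (S ∪ S1 ∪ S2))
        simp only [Finset.mem_insert, Finset.mem_union, not_or] at hc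
        refine (h1 c hc.2.1.2).symm.trans (Rel.trans ?_ (h2 c hc.2.2))
        obtain ⟨hA, hy, hu⟩ := key c hc.2.1.1
        simp only [smul_comp, sub, sw_left, ← hA, ← hy, Ne.symm hc.1, if_false]
        split_ifs with hd
        · exact hu d j ⟨hd, fun h => hc.1 h.1.symm⟩ c i
        · exact .comp_congr fun b k hb => hu b k hb d j

theorem sub_rel {f : X ⟶ Y} {r r' : Raw 𝔸 X Y} (hr : WF f r) (hr' : WF f r') (h : Rel r r')
    (d : 𝔸) (j : Bool) : Rel (sub r d j) (sub r' d j) :=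
  (sub_aux f r hr).2 r' hr' h d j

theorem sub_of_fr {f : X ⟶ Y} {r : Raw 𝔸 X Y} (hr : WF f r) {a : 𝔸} (h : Fr a r) (j : Bool) :
    Rel (sub r a j) r := by
  obtain ⟨S, hS⟩ := h
  obtain ⟨T, hT⟩ := exists_sub_rel r
  obtain ⟨c, hc⟩ := exists_notMem (S ∪ T)
  simp only [Finset.mem_union, not_or] at hc
  have h1 := sub_rel (hr.smul _) hr (hS c hc.1) a j
  have h2 := (hT c hc.2 j).smul (sw a c)
  rw [smul_sub, sw_right] at h2
  exact (h1.symm.trans h2).trans (hS c hc.1)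

theorem fr_sub {f : X ⟶ Y} {r : Raw 𝔸 X Y} (hr : WF f r) {b : 𝔸} (h : Fr b r) {d : 𝔸} (hd : d ≠ b)
    (j : Bool) : Fr b (sub r d j) := by
  obtain ⟨S, hS⟩ := h
  refine ⟨insert d S, fun c hc => ?_⟩
  simp only [Finset.mem_insert, not_or] at hc
  rw [smul_sub, sw_ne hd (Ne.symm hc.1)]
  exact sub_rel (hr.smul _) hr (hS c hc.2) d j

theorem rho_sub {f : X ⟶ Y} {r : Raw 𝔸 X Y} (hr : WF f r) (d : 𝔸) (j : Bool) :
    rho f (sub r d j) = Y.sub (rho f r) d j := by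
  induction r generalizing d j with
  | base x => exact Sub01.hom_sub f x d j
  | box i A a u y ih =>
    simp only [sub]
    split_ifs with h1 h2
    · simp [rho, h2]
    · exact (hr.2 d j ⟨h1, h2⟩).2.2.1
    · rfl
  | comp i A a u y ih =>
    simp only [sub]
    split_ifs with h1 h2
    · rw [h1]
      exact (Y.sub_of_fresh _ _ _ (Y.fresh_sub _ _ _)).symm
    · have hb : InDom i A a d j := ⟨h2, fun h => h1 h.1⟩
      rw [ih d j (hr.2 d j hb).1, (hr.2 d j hb).2.2.1, Y.sub_comm _ _ _ _ _ h1]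
      rfl
    · exact Y.sub_comm _ _ _ _ _ h1

theorem wf_sub_aux {f : X ⟶ Y} {r : Raw 𝔸 X Y} (hr : WF f r) : (∀ d j, WF f (sub r d j)) ∧
    ∀ d j d' j', d ≠ d' → Rel (sub (sub r d j) d' j') (sub (sub r d' j') d j) := by
  have key : ∀ (i A a) (u : 𝔸 → Bool → Raw 𝔸 X Y) (y : Y), WF f (box i A a u y) →
      (∀ b j, InDom i A a b j → (∀ d j', WF f (sub (u b j) d j')) ∧ ∀ d j₁ d' j', d ≠ d' →
        Rel (sub (sub (u b j) d j₁) d' j') (sub (sub (u b j) d' j') d j₁)) →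
      ∀ d k, d ∉ A → WF f (box i A a (fun b j => sub (u b j) d k) (Y.sub y d k)) := by
    rintro i A a u y ⟨ha, h⟩ ih d k hd
    refine ⟨ha, fun b j hb => ?_⟩
    obtain ⟨h1, h2, h3, h4⟩ := h b j hb
    have hdb : d ≠ b := fun h => hd (h ▸ hb.1)
    refine ⟨(ih b j hb).1 d k, fr_sub h1 h2 hdb k, ?_, fun b' j' hb' hne => ?_⟩
    · rw [rho_sub h1, h3, Y.sub_comm _ _ _ _ _ hdb]
    · have hdb' : d ≠ b' := fun h => hd (h ▸ hb'.1)
      refine ((ih b j hb).2 _ _ _ _ hdb').trans (Rel.trans ?_ ((ih b' j' hb').2 _ _ _ _ hdb).symm)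
      exact sub_rel ((ih b j hb).1 _ _) ((ih b' j' hb').1 _ _) (h4 b' j' hb' hne) d k
  induction r with
  | base x =>
    exact ⟨fun _ _ => trivial, fun d j d' j' h => .of_eq (congrArg base (X.sub_comm _ _ _ _ _ h))⟩
  | box i A a u y ih =>
    have ih' := fun b j hb => ih b j (hr.2 b j hb).1
    have hr0 := hr
    obtain ⟨ha, h⟩ := hr
    refine ⟨fun d j => ?_, fun d j d' j' hne => ?_⟩
    · simp only [sub]
      split_ifs with h1 h2
      · exact hr0
      · exact (h d j ⟨h1, h2⟩).1
      · exact key i A a u y hr0 ih' d j h1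
    · by_cases hd : d ∈ A <;> by_cases hd' : d' ∈ A
      · by_cases h1 : d = a ∧ j = i
        · have h2 : d' ≠ a := fun h => hne (h1.1.trans h.symm)
          simp only [sub, ha, hd', h1, h2, if_true, if_false, false_and, and_self]
          exact .refl _
        · by_cases h2 : d' = a ∧ j' = i
          · have h3 : d ≠ a := fun h => hne (h.trans h2.1.symm)
            simp only [sub, ha, hd, h2, h3, if_true, if_false, false_and, and_self]
            exact .refl _
          · simp only [sub, hd, hd', h1, h2, if_true, if_false]
            exact (h d j ⟨hd, h1⟩).2.2.2 d' j' ⟨hd', h2⟩ hne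
      · by_cases h1 : d = a ∧ j = i
        · have h2 : d' ≠ a := fun h => hne (h1.1.trans h.symm)
          simp only [sub, ha, hd', h1, h2, if_true, if_false, and_self]
          exact .refl _
        · simp only [sub, hd, hd', h1, if_true, if_false]
          exact .refl _
      · by_cases h1 : d' = a ∧ j' = i
        · have h2 : d ≠ a := fun h => hne (h.trans h1.1.symm)
          simp only [sub, hd, ha, h1, h2, if_true, if_false, and_self]
          exact .refl _
        · simp only [sub, hd, hd', h1, if_true, if_false]
          exact .refl _
      · simp only [sub, hd, hd', if_false]
        exact .box' rfl rfl (Y.sub_comm _ _ _ _ _ hne) fun b k hb => (ih' b k hb).2 _ _ _ _ hne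
  | comp i A a u y ih =>
    have ih' := fun b j hb => ih b j (hr.2 b j hb).1
    have hr0 : WF f (box i A a u y) := hr
    obtain ⟨ha, h⟩ := hr
    have hbind : ∀ j d' j', d' ≠ a → Rel (sub (sub (comp i A a u y) d' j') a j)
        (sub (comp i A a u y) d' j') := by
      intro j d' j' hd'
      simp only [sub, hd', if_false]
      split_ifs with h1
      · have hb : InDom i A a d' j' := ⟨h1, fun h => hd' h.1⟩
        exact sub_of_fr ((ih' d' j' hb).1 _ _) ((sub_aux f _ (h d' j' hb).1).1 _ _) j
      · simp only [sub, if_true]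
        exact .refl _
    refine ⟨fun d j => ?_, fun d j d' j' hne => ?_⟩
    · simp only [sub]
      split_ifs with h1 h2
      · exact hr0
      · exact (ih' d j ⟨h2, fun h => h1 h.1⟩).1 _ _
      · exact key i A a u y hr0 ih' d j h2
    · by_cases h1 : d = a
      · subst h1
        refine Rel.trans ?_ (hbind j d' j' hne.symm).symm
        simp only [sub, if_true]
        exact .refl _
      by_cases h2 : d' = a
      · subst h2
        refine (hbind j' d j hne).trans ?_
        simp only [sub, if_true]
        exact .refl _
      by_cases hd : d ∈ A <;> by_cases hd' : d' ∈ A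
      · have hb : InDom i A a d j := ⟨hd, fun h => h1 h.1⟩
        have hb' : InDom i A a d' j' := ⟨hd', fun h => h2 h.1⟩
        simp only [sub, hd, hd', h1, h2, if_true, if_false]
        refine ((ih' d j hb).2 _ _ _ _ (Ne.symm h2)).trans (Rel.trans ?_
          ((ih' d' j' hb').2 _ _ _ _ h1))
        exact sub_rel ((ih' d j hb).1 _ _) ((ih' d' j' hb').1 _ _)
          ((h d j hb).2.2.2 d' j' hb' hne) a i
      · have hb : InDom i A a d j := ⟨hd, fun h => h1 h.1⟩
        simp only [sub, hd, hd', h1, h2, if_true, if_false]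
        exact (ih' d j hb).2 _ _ _ _ (Ne.symm h2)
      · have hb' : InDom i A a d' j' := ⟨hd', fun h => h2 h.1⟩
        simp only [sub, hd, hd', h1, h2, if_true, if_false]
        exact ((ih' d' j' hb').2 _ _ _ _ (Ne.symm h1)).symm
      · simp only [sub, hd, hd', h1, h2, if_false]
        rw [Y.sub_comm _ _ _ _ _ hne]
        exact .comp_congr fun b k hb => (ih' b k hb).2 _ _ _ _ hne

/-- Well-formed formal elements up to `Rel`. -/
instance setoid (f : X ⟶ Y) : Setoid {r : Raw 𝔸 X Y // WF f r} where
  r r r' := Rel r.1 r'.1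
  iseqv := ⟨fun _ => .refl _, fun h => h.symm, fun h h' => h.trans h'⟩

end Raw

variable {𝔸 : Type u} [DecidableEq 𝔸] [Infinite 𝔸] {X Y : Sub01 𝔸}

instance (f : X ⟶ Y) : MulAction (FinPerm 𝔸) (Quotient (Raw.setoid f)) where
  smul π := Quotient.map (fun r => ⟨π • r.1, r.2.smul π⟩) fun _ _ h => h.smul π
  one_smul q := by
    induction q using Quotient.inductionOn with
    | h r => exact Quotient.sound (.of_eq (one_smul _ _))
  mul_smul π π' q := by
    induction q using Quotient.inductionOn with
    | h r => exact Quotient.sound (.of_eq (mul_smul _ _ _))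

theorem Raw.fresh_mk {f : X ⟶ Y} {a : 𝔸} {r : {r : Raw 𝔸 X Y // Raw.WF f r}} :
    (∃ S : Finset 𝔸, ∀ c ∉ S, sw a c • (⟦r⟧ : Quotient (Raw.setoid f)) = ⟦r⟧) ↔ Raw.Fr a r.1 :=
  exists_congr fun _ => forall₂_congr fun _ _ => Quotient.eq

theorem Raw.exists_supports_mk {f : X ⟶ Y} (q : Quotient (Raw.setoid f)) :
    ∃ S : Finset 𝔸, MulAction.Supports (FinPerm 𝔸) (S : Set 𝔸) q := by
  induction q using Quotient.inductionOn with
  | h r =>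
    obtain ⟨S, hS⟩ := Raw.exists_supp r.1
    refine ⟨S, fun π hπ => Quotient.sound ?_⟩
    have := hS π 1 fun s hs => by rw [hπ hs, one_smul]
    rwa [one_smul] at this


section Factorisation

variable {𝔸 : Type u} [DecidableEq 𝔸] [Infinite 𝔸]

/-- The object `K f` of the factorisation of `f`: the elements of `X`, the open boxes of `K f`
over `f`, and the abstracted boxes `⟨a⟩(u, y)`, freely generated. -/
def K {X Y : Sub01 𝔸} (f : X ⟶ Y) : Sub01 𝔸 where
  carrier := Quotient (Raw.setoid f)
  exists_supports := Raw.exists_supports_mk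
  sub q a i := Quotient.map (fun r => ⟨Raw.sub r.1 a i, (Raw.wf_sub_aux r.2).1 a i⟩)
    (fun r r' h => Raw.sub_rel r.2 r'.2 h a i) q
  smul_sub π q a i := by
    induction q using Quotient.inductionOn with
    | h r => exact Quotient.sound (.of_eq (Raw.smul_sub _ _ _ _))
  fresh_sub q a i := by
    induction q using Quotient.inductionOn with
    | h r =>
      exact (fresh_iff_sw Raw.exists_supports_mk).2
        (Raw.fresh_mk.2 ((Raw.sub_aux f r.1 r.2).1 a i))
  sub_of_fresh q a i h := by
    induction q using Quotient.inductionOn with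
    | h r =>
      exact Quotient.sound (Raw.sub_of_fr r.2
        (Raw.fresh_mk.1 ((fresh_iff_sw Raw.exists_supports_mk).1 h)) i)
  sub_comm q a i a' i' h := by
    induction q using Quotient.inductionOn with
    | h r => exact Quotient.sound ((Raw.wf_sub_aux r.2).2 _ _ _ _ h)

/-- The inclusion `λ_f : X ⟶ K f`. -/
def lam {X Y : Sub01 𝔸} (f : X ⟶ Y) : X ⟶ K f where
  toFun x := Quotient.mk (Raw.setoid f) ⟨.base x, trivial⟩
  map_smul _ _ := rfl
  map_sub _ _ _ := rfl

/-- The map `ρ_f : K f ⟶ Y`. -/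
def rho {X Y : Sub01 𝔸} (f : X ⟶ Y) : K f ⟶ Y where
  toFun := Quotient.lift (fun r => Raw.rho f r.1) fun _ _ h => Raw.rho_rel f h
  map_smul π q := by
    induction q using Quotient.inductionOn with
    | h r => exact Raw.rho_smul f π r.1
  map_sub q a i := by
    induction q using Quotient.inductionOn with
    | h r => exact Raw.rho_sub r.2 a i

theorem lam_rho {X Y : Sub01 𝔸} (f : X ⟶ Y) : lam f ≫ rho f = f := rfl

/-- `(u, y)` is an `i`-open `(A, a)`-box over `g`; only the values of `u` on `InDom i A a`
matter. -/
structure IsOpenBox {U V : Sub01 𝔸} (g : U ⟶ V) (i : Bool) (A : Finset 𝔸) (a : 𝔸)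
    (u : 𝔸 → Bool → U) (y : V) : Prop where
  mem : a ∈ A
  fresh : ∀ b j, InDom i A a b j → Fresh (𝔸 := 𝔸) b (u b j)
  adj : ∀ b j b' j', InDom i A a b j → InDom i A a b' j' → b ≠ b' →
    U.sub (u b j) b' j' = U.sub (u b' j') b j
  lies : ∀ b j, InDom i A a b j → g (u b j) = V.sub y b j

theorem IsOpenBox.map {U V U' V' : Sub01 𝔸} {g : U ⟶ V} {g' : U' ⟶ V'} {i A a u y}
    (h : IsOpenBox g i A a u y) (m : U ⟶ U') (n : V ⟶ V') (w : m ≫ g' = g ≫ n) :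
    IsOpenBox g' i A a (fun b j => m (u b j)) (n y) where
  mem := h.mem
  fresh b j hb := Sub01.fresh_hom m (h.fresh b j hb)
  adj b j b' j' hb hb' hne := by
    rw [← Sub01.hom_sub, ← Sub01.hom_sub, h.adj b j b' j' hb hb' hne]
  lies b j hb := by
    rw [← Sub01.comp_apply, w, Sub01.comp_apply, h.lies b j hb, Sub01.hom_sub]

/-- Uniform Kan filling operators for `g`, for both kinds of open boxes. -/
structure KanOp {U V : Sub01 𝔸} (g : U ⟶ V) where
  fill : Bool → Finset 𝔸 → 𝔸 → (𝔸 → Bool → U) → V → U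
  congr : ∀ {i A a u u' y}, IsOpenBox g i A a u y →
    (∀ b j, InDom i A a b j → u b j = u' b j) → fill i A a u y = fill i A a u' y
  face : ∀ {i A a u y}, IsOpenBox g i A a u y → ∀ b j, InDom i A a b j →
    U.sub (fill i A a u y) b j = u b j
  lies : ∀ {i A a u y}, IsOpenBox g i A a u y → g (fill i A a u y) = y
  perm : ∀ (π : FinPerm 𝔸) i A a u y,
    fill i (π • A) (π • a) (fun b j => π • u (π⁻¹ • b) j) (π • y) = π • fill i A a u y
  unif : ∀ {i A a u y}, IsOpenBox g i A a u y → ∀ c j, c ∉ A →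
    fill i A a (fun b k => U.sub (u b k) c j) (V.sub y c j) = U.sub (fill i A a u y) c j

section Filling

variable {X Y : Sub01 𝔸} {f : X ⟶ Y}

/-- The class in `K f` of a well-formed formal element. -/
def mk (r : Raw 𝔸 X Y) (h : Raw.WF f r) : K f := Quotient.mk (Raw.setoid f) ⟨r, h⟩

/-- A representative of an element of `K f`. -/
noncomputable def rep (q : K f) : Raw 𝔸 X Y := (Quotient.out (s := Raw.setoid f) q).1

theorem wf_rep (q : K f) : Raw.WF f (rep q) := (Quotient.out (s := Raw.setoid f) q).2

theorem mk_rep (q : K f) : mk (rep q) (wf_rep q) = q := Quotient.out_eq (s := Raw.setoid f) q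

theorem mk_eq_mk {r r' : Raw 𝔸 X Y} {h : Raw.WF f r} {h' : Raw.WF f r'} :
    mk r h = mk r' h' ↔ Raw.Rel r r' :=
  Quotient.eq (r := Raw.setoid f)

theorem rep_mk {r : Raw 𝔸 X Y} (h : Raw.WF f r) : Raw.Rel (rep (mk r h)) r :=
  mk_eq_mk.1 (mk_rep (mk r h))

theorem mk_surj (q : K f) : ∃ r h, q = mk r h := ⟨rep q, wf_rep q, (mk_rep q).symm⟩

theorem smul_mk (π : FinPerm 𝔸) {r : Raw 𝔸 X Y} (h : Raw.WF f r) :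
    π • mk r h = mk (π • r) (h.smul π) := rfl

theorem sub_mk {r : Raw 𝔸 X Y} (h : Raw.WF f r) (a i) :
    (K f).sub (mk r h) a i = mk (Raw.sub r a i) ((Raw.wf_sub_aux h).1 a i) := rfl

theorem rho_mk {r : Raw 𝔸 X Y} (h : Raw.WF f r) : rho f (mk r h) = Raw.rho f r := rfl

theorem fresh_mk {r : Raw 𝔸 X Y} (h : Raw.WF f r) {a : 𝔸} :
    Fresh (𝔸 := 𝔸) a (mk r h) ↔ Raw.Fr a r :=
  (fresh_iff_sw (K f).exists_supports).trans Raw.fresh_mk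

theorem wf_box_iff {i A a y} {u : 𝔸 → Bool → Raw 𝔸 X Y} {v : 𝔸 → Bool → K f}
    (h : ∀ b j, InDom i A a b j → ∃ hb, mk (u b j) hb = v b j) :
    Raw.WF f (.box i A a u y) ↔ IsOpenBox (rho f) i A a v y := by
  constructor
  · rintro ⟨ha, h'⟩
    refine ⟨ha, fun b j hb => ?_, fun b j b' j' hb hb' hne => ?_, fun b j hb => ?_⟩
    · obtain ⟨h1, h2⟩ := h b j hb
      rw [← h2, fresh_mk]
      exact (h' b j hb).2.1
    · obtain ⟨h1, h2⟩ := h b j hb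
      obtain ⟨h3, h4⟩ := h b' j' hb'
      rw [← h2, ← h4, sub_mk, sub_mk, mk_eq_mk]
      exact (h' b j hb).2.2.2 _ _ hb' hne
    · obtain ⟨h1, h2⟩ := h b j hb
      rw [← h2, rho_mk]
      exact (h' b j hb).2.2.1
  · rintro ⟨ha, h1, h2, h3⟩
    refine ⟨ha, fun b j hb => ?_⟩
    obtain ⟨hw, e⟩ := h b j hb
    refine ⟨hw, ?_, ?_, fun b' j' hb' hne => ?_⟩
    · rw [← fresh_mk hw, e]
      exact h1 b j hb
    · rw [← rho_mk hw, e]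
      exact h3 b j hb
    · obtain ⟨hw', e'⟩ := h b' j' hb'
      have := h2 b j b' j' hb hb' hne
      rwa [← e, ← e', sub_mk, sub_mk, mk_eq_mk] at this

theorem wf_rep_box {i A a y} {u : 𝔸 → Bool → K f} (h : IsOpenBox (rho f) i A a u y) :
    Raw.WF f (.box i A a (fun b j => rep (u b j)) y) :=
  (wf_box_iff fun b j _ => ⟨wf_rep (u b j), mk_rep (u b j)⟩).2 h

open Classical in
/-- Each open box `(u, y)` of `K f` over `ρ_f` is an element of `K f`, its own filler. -/
noncomputable def kfill (f : X ⟶ Y) (i : Bool) (A : Finset 𝔸) (a : 𝔸) (u : 𝔸 → Bool → K f)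
    (y : Y) : K f :=
  if h : IsOpenBox (rho f) i A a u y then mk _ (wf_rep_box h) else u a (!i)

theorem kfill_eq {i A a y} {u : 𝔸 → Bool → K f} (h : IsOpenBox (rho f) i A a u y)
    {r : 𝔸 → Bool → Raw 𝔸 X Y} (hr : ∀ b j, InDom i A a b j → ∃ hb, mk (r b j) hb = u b j) :
    kfill f i A a u y = mk (.box i A a r y) ((wf_box_iff hr).2 h) := by
  rw [kfill, dif_pos h, mk_eq_mk]
  refine .box fun b j hb => ?_
  obtain ⟨hw, e⟩ := hr b j hb
  rw [← e]
  exact rep_mk hw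

theorem IsOpenBox.smul {U V : Sub01 𝔸} {g : U ⟶ V} {i A a u y} (h : IsOpenBox g i A a u y)
    (π : FinPerm 𝔸) :
    IsOpenBox g i (π • A) (π • a) (fun b j => π • u (π⁻¹ • b) j) (π • y) where
  mem := Finset.smul_mem_smul_finset h.mem
  fresh b j hb := by
    have := (h.fresh _ _ (Raw.inDom_smul.1 hb)).smul π
    rwa [smul_inv_smul] at this
  adj b j b' j' hb hb' hne := by
    have := h.adj _ _ _ _ (Raw.inDom_smul.1 hb) (Raw.inDom_smul.1 hb') (by simpa using hne)
    have := congrArg (π • ·) this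
    simpa only [U.smul_sub, smul_inv_smul] using this
  lies b j hb := by
    rw [Sub01.hom_smul, h.lies _ _ (Raw.inDom_smul.1 hb), V.smul_sub, smul_inv_smul]

/-- The Kan filling operators of `ρ_f`. -/
noncomputable def kanK (f : X ⟶ Y) : KanOp (rho f) where
  fill := kfill f
  congr {i A a u u' y} h e := by
    have h' : IsOpenBox (rho f) i A a u' y :=
      ⟨h.mem, fun b j hb => e b j hb ▸ h.fresh b j hb,
        fun b j b' j' hb hb' hne => by
          rw [← e b j hb, ← e b' j' hb']; exact h.adj b j b' j' hb hb' hne,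
        fun b j hb => e b j hb ▸ h.lies b j hb⟩
    rw [kfill_eq h' fun b j _ => ⟨wf_rep _, mk_rep _⟩,
      kfill_eq h (r := fun b j => rep (u' b j)) fun b j hb => ⟨wf_rep _, by rw [mk_rep, e b j hb]⟩]
  face {i A a u y} h b j hb := by
    rw [kfill_eq h fun b j _ => ⟨wf_rep _, mk_rep _⟩, sub_mk]
    conv_rhs => rw [← mk_rep (u b j)]
    rw [mk_eq_mk]
    refine .of_eq ?_
    simp [Raw.sub, hb.1, hb.2]
  lies {i A a u y} h := by
    rw [kfill_eq h fun b j _ => ⟨wf_rep _, mk_rep _⟩]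
    rfl
  perm π i A a u y := by
    by_cases h : IsOpenBox (rho f) i A a u y
    swap
    · have h' : ¬IsOpenBox (rho f) i (π • A) (π • a) (fun b j => π • u (π⁻¹ • b) j) (π • y) :=
        fun h' => h (by simpa using h'.smul π⁻¹)
      rw [kfill, kfill, dif_neg h, dif_neg h', inv_smul_smul]
    rw [kfill_eq h fun b j _ => ⟨wf_rep _, mk_rep _⟩, smul_mk,
      kfill_eq (h.smul π) (r := fun b j => π • rep (u (π⁻¹ • b) j)) fun b j _ =>
        ⟨(wf_rep _).smul π, by rw [← smul_mk _ (wf_rep _), mk_rep]⟩]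
    rfl
  unif {i A a u y} h c j hc := by
    have e' : ∀ b k, InDom i A a b k → ∃ hb, mk (f := f) (Raw.sub (rep (u b k)) c j) hb =
        (K f).sub (u b k) c j :=
      fun b k _ => ⟨(Raw.wf_sub_aux (wf_rep _)).1 c j, by rw [← sub_mk (wf_rep _), mk_rep]⟩
    have hw := (Raw.wf_sub_aux (wf_rep_box h)).1 c j
    simp only [Raw.sub, hc, if_false] at hw
    rw [kfill_eq h fun b j _ => ⟨wf_rep _, mk_rep _⟩, sub_mk,
      kfill_eq ((wf_box_iff e').1 hw) e', mk_eq_mk]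
    exact .of_eq (by simp [Raw.sub, hc])

/-- Induction over `K f`. -/
theorem K_ind {P : K f → Prop} (base : ∀ x, P (lam f x))
    (box : ∀ i A a u y, IsOpenBox (rho f) i A a u y → (∀ b j, InDom i A a b j → P (u b j)) →
      P (kfill f i A a u y) ∧ P ((K f).sub (kfill f i A a u y) a i)) (q : K f) : P q := by
  obtain ⟨r, hr, rfl⟩ := mk_surj q
  have key : ∀ (i A a) (u : 𝔸 → Bool → Raw 𝔸 X Y) (y : Y) (h : Raw.WF f (.box i A a u y)),
      (∀ b j (h : Raw.WF f (u b j)), P (mk _ h)) →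
      P (mk (.box i A a u y) h) ∧ P (mk (.comp i A a u y) h) := by
    classical
    intro i A a u y h ih
    have hv : ∀ b j, InDom i A a b j → ∃ hb, mk (u b j) hb =
        if hb : InDom i A a b j then mk (u b j) (h.2 b j hb).1 else mk (f := f) _ h := by
      intro b j hb
      exact ⟨(h.2 b j hb).1, by rw [dif_pos hb]⟩
    have hbox := (wf_box_iff hv).1 h
    have := box i A a _ y hbox fun b j hb => by
      rw [dif_pos hb]
      exact ih b j _
    rw [kfill_eq hbox hv, sub_mk] at this
    simpa [Raw.sub, h.1] using this
  induction r with
  | base x => exact base x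
  | box i A a u y ih => exact (key i A a u y hr ih).1
  | comp i A a u y ih => exact (key i A a u y hr ih).2

end Filling

section Extension

variable {X Y U V : Sub01 𝔸} {f : X ⟶ Y} {g : U ⟶ V}

/-- Recursion on formal elements into a map with Kan filling operators. -/
def Raw.eval (H : KanOp g) (h : X ⟶ U) (k : Y ⟶ V) : Raw 𝔸 X Y → U
  | .base x => h x
  | .box i A a u y => H.fill i A a (fun b j => Raw.eval H h k (u b j)) (k y)
  | .comp i A a u y => U.sub (H.fill i A a (fun b j => Raw.eval H h k (u b j)) (k y)) a i

/-- The rank of a formal element is at most `n`. -/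
def Raw.Rank : ℕ → Raw 𝔸 X Y → Prop
  | _, .base _ => True
  | n, .box i A a u _ | n, .comp i A a u _ =>
      ∃ m < n, ∀ b j, InDom i A a b j → Raw.Rank m (u b j)

theorem Raw.Rank.mono {n n' : ℕ} (h : n ≤ n') {r : Raw 𝔸 X Y} (hr : Raw.Rank n r) :
    Raw.Rank n' r := by
  cases r with
  | base x => trivial
  | box i A a u y => exact hr.imp fun m hm => ⟨hm.1.trans_le h, hm.2⟩
  | comp i A a u y => exact hr.imp fun m hm => ⟨hm.1.trans_le h, hm.2⟩

theorem Raw.exists_rank (r : Raw 𝔸 X Y) : ∃ n, Raw.Rank n r := by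
  have key : ∀ (i A a) (u : 𝔸 → Bool → Raw 𝔸 X Y), (∀ b j, ∃ n, Raw.Rank n (u b j)) →
      ∃ n m, m < n ∧ ∀ b j, InDom i A a b j → Raw.Rank m (u b j) := by
    intro i A a u ih
    choose N hN using ih
    refine ⟨_, A.sup fun b => max (N b false) (N b true), Nat.lt_succ_self _, fun b j hb => ?_⟩
    refine (hN b j).mono (le_trans ?_ (Finset.le_sup (f := fun b => max (N b false) (N b true)) hb.1))
    cases j
    · exact le_max_left _ _
    · exact le_max_right _ _
  induction r with
  | base x => exact ⟨0, trivial⟩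
  | box i A a u y ih => exact key i A a u ih
  | comp i A a u y ih => exact key i A a u ih

theorem Raw.Rank.sub {n : ℕ} {r : Raw 𝔸 X Y} (hr : Raw.Rank n r) (d : 𝔸) (j : Bool) :
    Raw.Rank n (Raw.sub r d j) := by
  induction r generalizing n d j with
  | base x => trivial
  | box i A a u y ih =>
    obtain ⟨m, hm, h⟩ := hr
    simp only [Raw.sub]
    split_ifs with h1 h2
    · exact ⟨m, hm, h⟩
    · exact (h d j ⟨h1, h2⟩).mono hm.le
    · exact ⟨m, hm, fun b k hb => ih b k (h b k hb) d j⟩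
  | comp i A a u y ih =>
    obtain ⟨m, hm, h⟩ := hr
    simp only [Raw.sub]
    split_ifs with h1 h2
    · exact ⟨m, hm, h⟩
    · exact (ih d j (h d j ⟨h2, fun h => h1 h.1⟩) a i).mono hm.le
    · exact ⟨m, hm, fun b k hb => ih b k (h b k hb) d j⟩

theorem Raw.eval_smul (H : KanOp g) (h : X ⟶ U) (k : Y ⟶ V) (π : FinPerm 𝔸) (r : Raw 𝔸 X Y) :
    Raw.eval H h k (π • r) = π • Raw.eval H h k r := by
  induction r with
  | base x => exact Sub01.hom_smul h π x
  | box i A a u y ih =>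
    simp only [Raw.smul_box, Raw.eval, ih, ← H.perm, Sub01.hom_smul]
  | comp i A a u y ih =>
    simp only [Raw.smul_comp, Raw.eval, ih, U.smul_sub, ← H.perm, Sub01.hom_smul]

theorem Raw.eval_aux (H : KanOp g) (h : X ⟶ U) (k : Y ⟶ V) (w : h ≫ g = f ≫ k) (n : ℕ)
    (r : Raw 𝔸 X Y) (hn : Raw.Rank n r) (hr : Raw.WF f r) :
    (∀ r', Raw.WF f r' → Raw.Rel r r' → Raw.eval H h k r = Raw.eval H h k r') ∧
    (∀ d j, Raw.eval H h k (Raw.sub r d j) = U.sub (Raw.eval H h k r) d j) ∧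
    g (Raw.eval H h k r) = k (Raw.rho f r) := by
  induction n using Nat.strong_induction_on generalizing r with
  | _ n IH =>
  have hbox : ∀ (i A a) (u : 𝔸 → Bool → Raw 𝔸 X Y) (y : Y), Raw.Rank n (.box i A a u y) →
      Raw.WF f (.box i A a u y) →
      IsOpenBox g i A a (fun b j => Raw.eval H h k (u b j)) (k y) := by
    rintro i A a u y ⟨m, hm, hR⟩ ⟨ha, hW⟩
    refine ⟨ha, fun b j hb => ?_, fun b j b' j' hb hb' hne => ?_, fun b j hb => ?_⟩
    · obtain ⟨h1, ⟨S, hS⟩, -, -⟩ := hW b j hb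
      refine (fresh_iff_sw U.exists_supports).2 ⟨S, fun c hc => ?_⟩
      rw [← Raw.eval_smul]
      exact ((IH m hm _ (hR b j hb) h1).1 _ (h1.smul _) (hS c hc).symm).symm
    · obtain ⟨h1, -, -, h2⟩ := hW b j hb
      obtain ⟨h3, -⟩ := hW b' j' hb'
      rw [← (IH m hm _ (hR b j hb) h1).2.1, ← (IH m hm _ (hR b' j' hb') h3).2.1]
      exact (IH m hm _ ((hR b j hb).sub _ _) ((Raw.wf_sub_aux h1).1 _ _)).1 _
        ((Raw.wf_sub_aux h3).1 _ _) (h2 b' j' hb' hne)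
    · obtain ⟨h1, -, h2, -⟩ := hW b j hb
      rw [(IH m hm _ (hR b j hb) h1).2.2, h2, Sub01.hom_sub]
  have hunif : ∀ (i A a) (u : 𝔸 → Bool → Raw 𝔸 X Y) (y : Y), Raw.Rank n (.box i A a u y) →
      Raw.WF f (.box i A a u y) → ∀ d j, d ∉ A →
      H.fill i A a (fun b l => Raw.eval H h k (Raw.sub (u b l) d j)) (k (Y.sub y d j)) =
        U.sub (H.fill i A a (fun b l => Raw.eval H h k (u b l)) (k y)) d j := by
    intro i A a u y hR hW d j hd
    have hR' := hR.sub d j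
    have hW' := (Raw.wf_sub_aux hW).1 d j
    simp only [Raw.sub, hd, if_false] at hR' hW'
    rw [← H.unif (hbox i A a u y hR hW) d j hd, ← Sub01.hom_sub]
    refine H.congr (hbox _ _ _ _ _ hR' hW') fun b l hb => ?_
    obtain ⟨m, hm, hR⟩ := hR
    exact (IH m hm _ (hR b l hb) (hW.2 b l hb).1).2.1 d j
  cases r with
  | base x =>
    refine ⟨fun r' _ e => by cases e; rfl, fun d j => Sub01.hom_sub h x d j, ?_⟩
    change (h ≫ g) x = (f ≫ k) x
    rw [w]
  | box i A a u y =>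
    have hb0 := hbox i A a u y hn hr
    have hun := hunif i A a u y hn hr
    obtain ⟨m, hm, hR⟩ := hn
    refine ⟨fun r' hr' e => ?_, fun d j => ?_, H.lies hb0⟩
    · cases e with
      | box e =>
        exact H.congr hb0 fun b j hb =>
          (IH m hm _ (hR b j hb) (hr.2 b j hb).1).1 _ (hr'.2 b j hb).1 (e b j hb)
    · simp only [Raw.sub]
      split_ifs with h1 h2
      · rw [h2.1, h2.2]
        rfl
      · exact (H.face hb0 d j ⟨h1, h2⟩).symm
      · exact hun d j h1
  | comp i A a u y =>
    have hb0 := hbox i A a u y hn hr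
    have hun := hunif i A a u y hn hr
    obtain ⟨m, hm, hR⟩ := hn
    refine ⟨fun r' hr' e => ?_, fun d j => ?_, ?_⟩
    · cases e with
      | @comp _ _ _ _ _ A' a' u' y' S hS =>
        obtain ⟨T, hT⟩ := (fresh_iff_sw U.exists_supports).1
          (U.fresh_sub (Raw.eval H h k (.box i A a u y)) a i)
        obtain ⟨T', hT'⟩ := (fresh_iff_sw U.exists_supports).1
          (U.fresh_sub (Raw.eval H h k (.box i A' a' u' y')) a' i)
        obtain ⟨c, hc⟩ := exists_notMem (S ∪ T ∪ T')
        simp only [Finset.mem_union, not_or] at hc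
        change U.sub (Raw.eval H h k (.box i A a u y)) a i =
          U.sub (Raw.eval H h k (.box i A' a' u' y')) a' i
        rw [← hT c hc.1.2, ← hT' c hc.2, U.smul_sub, U.smul_sub, sw_left, sw_left,
          ← Raw.eval_smul, ← Raw.eval_smul]
        congr 1
        obtain ⟨h1, h2, h3, h4⟩ := (hS c hc.1.1).box_inv
        have hb1 := hb0.smul (sw a c)
        simp only [Raw.smul_box, Raw.eval, ← h1, ← h2, ← h3]
        rw [Sub01.hom_smul]
        refine H.congr ?_ fun b j hb => ?_
        · simpa only [Raw.eval_smul] using hb1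
        have hb2 : InDom i (sw a' c • A') (sw a' c • a') b j := by rwa [← h1, ← h2]
        have h5 : Raw.Rel ((sw a c)⁻¹ • sw a c • u ((sw a c)⁻¹ • b) j)
          ((sw a c)⁻¹ • sw a' c • u' ((sw a' c)⁻¹ • b) j) := (h4 b j hb).smul (sw a c)⁻¹
        rw [inv_smul_smul] at h5
        have h6 := (IH m hm _ (hR _ _ (Raw.inDom_smul.1 hb)) (hr.2 _ _ (Raw.inDom_smul.1 hb)).1).1
          _ (((hr'.2 _ _ (Raw.inDom_smul.1 hb2)).1.smul _).smul _) h5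
        rw [Raw.eval_smul, h6, Raw.eval_smul, smul_inv_smul]
    · simp only [Raw.sub]
      split_ifs with h1 h2
      · rw [h1]
        exact (U.sub_of_fresh _ _ _ (U.fresh_sub _ _ _)).symm
      · have hb : InDom i A a d j := ⟨h2, fun h => h1 h.1⟩
        rw [(IH m hm _ (hR d j hb) (hr.2 d j hb).1).2.1]
        simp only [Raw.eval]
        rw [U.sub_comm _ _ _ _ _ (Ne.symm h1), H.face hb0 d j hb]
      · simp only [Raw.eval]
        rw [hun d j h2, U.sub_comm _ _ _ _ _ h1]
    · simp only [Raw.eval, Raw.rho]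
      rw [Sub01.hom_sub, H.lies hb0, Sub01.hom_sub]

/-- The extension of a square `(h, k) : f ⟶ g` along `λ_f`, determined by Kan filling operators
of `g`: it sends `x` to `h x` and commutes with filling. -/
def ext (H : KanOp g) (h : X ⟶ U) (k : Y ⟶ V) (w : h ≫ g = f ≫ k) : K f ⟶ U where
  toFun := Quotient.lift (fun r => Raw.eval H h k r.1) fun r r' e => by
    obtain ⟨n, hn⟩ := Raw.exists_rank r.1
    exact (Raw.eval_aux H h k w n r.1 hn r.2).1 r'.1 r'.2 e
  map_smul π q := by
    obtain ⟨r, hr, rfl⟩ := mk_surj q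
    exact Raw.eval_smul H h k π r
  map_sub q a i := by
    obtain ⟨r, hr, rfl⟩ := mk_surj q
    obtain ⟨n, hn⟩ := Raw.exists_rank r
    exact (Raw.eval_aux H h k w n r hn hr).2.1 a i

variable (H : KanOp g) (h : X ⟶ U) (k : Y ⟶ V) (w : h ≫ g = f ≫ k)

theorem lam_ext : lam f ≫ ext H h k w = h := rfl

theorem ext_rho : ext H h k w ≫ g = rho f ≫ k := by
  refine Sub01.hom_ext fun q => ?_
  obtain ⟨r, hr, rfl⟩ := mk_surj q
  obtain ⟨n, hn⟩ := Raw.exists_rank r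
  exact (Raw.eval_aux H h k w n r hn hr).2.2

theorem ext_fill {i A a u y} (hu : IsOpenBox (rho f) i A a u y) :
    ext H h k w (kfill f i A a u y) = H.fill i A a (fun b j => ext H h k w (u b j)) (k y) := by
  rw [kfill_eq hu fun b j _ => ⟨wf_rep _, mk_rep _⟩]
  change H.fill i A a (fun b j => ext H h k w (mk (rep (u b j)) (wf_rep _))) (k y) = _
  simp only [mk_rep]

theorem ext_unique {m m' : K f ⟶ U} (e : lam f ≫ m = lam f ≫ m') (hk : m ≫ g = rho f ≫ k)
    (hm : ∀ {i A a u y}, IsOpenBox (rho f) i A a u y →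
      m (kfill f i A a u y) = H.fill i A a (fun b j => m (u b j)) (k y))
    (hm' : ∀ {i A a u y}, IsOpenBox (rho f) i A a u y →
      m' (kfill f i A a u y) = H.fill i A a (fun b j => m' (u b j)) (k y)) : m = m' := by
  refine Sub01.hom_ext fun q => ?_
  induction q using K_ind with
  | base x => exact congrArg (fun s => s x) e
  | box i A a u y hu ih =>
    have : m (kfill f i A a u y) = m' (kfill f i A a u y) := by
      rw [hm hu, hm' hu]
      exact H.congr (hu.map m k hk) ih
    exact ⟨this, by rw [Sub01.hom_sub, Sub01.hom_sub, this]⟩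

end Extension

end Factorisation

section General

universe v w v' w'

variable {C : Type w} [Category.{v} C]

/-- A functorial factorisation: a functor `K` on arrows together with natural maps
`λ_f : X ⟶ K f` and `ρ_f : K f ⟶ Y` whose composite is `f`. -/
structure FunctorialFactorisation (C : Type w) [Category.{v} C] where
  K : Arrow C ⥤ C
  lam : ∀ f : Arrow C, f.left ⟶ K.obj f
  rho : ∀ f : Arrow C, K.obj f ⟶ f.right
  fac : ∀ f : Arrow C, lam f ≫ rho f = f.hom
  lam_nat : ∀ {f g : Arrow C} (s : f ⟶ g), s.left ≫ lam g = lam f ≫ K.map s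
  rho_nat : ∀ {f g : Arrow C} (s : f ⟶ g), K.map s ≫ rho g = rho f ≫ s.right

namespace FunctorialFactorisation

variable (F : FunctorialFactorisation C)

/-- The endofunctor `f ↦ λ_f`. -/
def L : Arrow C ⥤ Arrow C where
  obj f := Arrow.mk (F.lam f)
  map s := Arrow.homMk s.left (F.K.map s) (F.lam_nat s)

/-- The copoint `L ⟶ 𝟭`. -/
def counit : F.L ⟶ 𝟭 (Arrow C) where
  app f := Arrow.homMk (𝟙 f.left) (F.rho f) ((Category.id_comp _).trans (F.fac f).symm)
  naturality f g s := by
    refine Arrow.hom_ext _ _ ?_ (F.rho_nat s)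
    exact (Category.comp_id s.left).trans (Category.id_comp s.left).symm

/-- The endofunctor `f ↦ ρ_f`. -/
def R : Arrow C ⥤ Arrow C where
  obj f := Arrow.mk (F.rho f)
  map s := Arrow.homMk (F.K.map s) s.right (F.rho_nat s)

/-- The point `𝟭 ⟶ R`. -/
def unit : 𝟭 (Arrow C) ⟶ F.R where
  app f := Arrow.homMk (F.lam f) (𝟙 f.right) ((F.fac f).trans (Category.comp_id _).symm)
  naturality f g s := by
    refine Arrow.hom_ext _ _ (F.lam_nat s) ?_
    exact (Category.comp_id s.right).trans (Category.id_comp s.right).symm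

end FunctorialFactorisation

/-- An algebraic weak factorisation system: a functorial factorisation with a comultiplication
making `L` a comonad and a multiplication making `R` a monad. -/
structure AWFS (C : Type w) [Category.{v} C] extends FunctorialFactorisation C where
  comult : toFunctorialFactorisation.L ⟶ toFunctorialFactorisation.L ⋙ toFunctorialFactorisation.L
  comult_coassoc : ∀ f, comult.app f ≫ toFunctorialFactorisation.L.map (comult.app f) =
    comult.app f ≫ comult.app (toFunctorialFactorisation.L.obj f)
  comult_left : ∀ f, comult.app f ≫
    toFunctorialFactorisation.counit.app (toFunctorialFactorisation.L.obj f) = 𝟙 _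
  comult_right : ∀ f, comult.app f ≫
    toFunctorialFactorisation.L.map (toFunctorialFactorisation.counit.app f) = 𝟙 _
  mult : toFunctorialFactorisation.R ⋙ toFunctorialFactorisation.R ⟶ toFunctorialFactorisation.R
  mult_assoc : ∀ f, toFunctorialFactorisation.R.map (mult.app f) ≫ mult.app f =
    mult.app (toFunctorialFactorisation.R.obj f) ≫ mult.app f
  mult_left : ∀ f,
    toFunctorialFactorisation.unit.app (toFunctorialFactorisation.R.obj f) ≫ mult.app f = 𝟙 _
  mult_right : ∀ f,
    toFunctorialFactorisation.R.map (toFunctorialFactorisation.unit.app f) ≫ mult.app f = 𝟙 _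

/-- The category `U^⋔` for `U : J ⥤ C^𝟚`: arrows with a choice of diagonal fillers against the
arrows in the image of `U`, natural in `J`. -/
structure Pitchfork {J : Type w'} [Category.{v'} J] (U : J ⥤ Arrow C) where
  arr : Arrow C
  lift : ∀ j : J, (U.obj j ⟶ arr) → ((U.obj j).right ⟶ arr.left)
  lift_left : ∀ j (s : U.obj j ⟶ arr), (U.obj j).hom ≫ lift j s = s.left
  lift_right : ∀ j (s : U.obj j ⟶ arr), lift j s ≫ arr.hom = s.right
  natural : ∀ {j j' : J} (m : j ⟶ j') (s : U.obj j' ⟶ arr),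
    lift j (U.map m ≫ s) = (U.map m).right ≫ lift j' s

namespace Pitchfork

variable {J : Type w'} [Category.{v'} J] {U : J ⥤ Arrow C}

/-- Morphisms are the squares that commute with the chosen fillers. -/
@[ext] structure Hom (P Q : Pitchfork U) where
  sq : P.arr ⟶ Q.arr
  comm : ∀ j (s : U.obj j ⟶ P.arr), P.lift j s ≫ sq.left = Q.lift j (s ≫ sq)

instance : Category (Pitchfork U) where
  Hom := Hom
  id P := ⟨𝟙 P.arr, fun j s => by simp⟩
  comp f g := ⟨f.sq ≫ g.sq, fun j s => by
    rw [Arrow.comp_left, ← Category.assoc, f.comm, g.comm, Category.assoc]⟩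
  id_comp _ := Hom.ext (Category.id_comp _)
  comp_id _ := Hom.ext (Category.comp_id _)
  assoc _ _ _ := Hom.ext (Category.assoc _ _ _)

/-- The functor `η^⋔ : U'^⋔ ⥤ U^⋔` induced by a functor `η` over `C^𝟚`. -/
def restrict {J' : Type*} [Category* J'] {U' : J' ⥤ Arrow C} (η : J ⥤ J') (hη : η ⋙ U' = U) :
    Pitchfork U' ⥤ Pitchfork U :=
  match U, hη with
  | _, rfl =>
    { obj := fun P =>
        { arr := P.arr
          lift := fun j s => P.lift (η.obj j) s
          lift_left := fun j s => P.lift_left (η.obj j) s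
          lift_right := fun j s => P.lift_right (η.obj j) s
          natural := fun m s => P.natural (η.map m) s }
      map := fun f => ⟨f.sq, fun j s => f.comm (η.obj j) s⟩
      map_id := fun _ => rfl
      map_comp := fun _ _ => rfl }

end Pitchfork

namespace AWFS

variable (W : AWFS C)

/-- The comonad of left maps. -/
def comonad : Comonad (Arrow C) where
  toFunctor := W.L
  ε := W.counit
  δ := W.comult
  coassoc := W.comult_coassoc
  left_counit := W.comult_left
  right_counit := W.comult_right

/-- The monad of right maps. -/
def monad : Monad (Arrow C) where
  toFunctor := W.R
  η := W.unit
  μ := W.mult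
  assoc := W.mult_assoc
  left_unit := W.mult_left
  right_unit := W.mult_right

/-- The category of coalgebras of the comonad `L`. -/
abbrev LMap := W.comonad.Coalgebra

/-- The category of algebras of the monad `R`. -/
abbrev RMap := W.monad.Algebra

/-- The forgetful functor from coalgebras to arrows. -/
abbrev forgetL : W.LMap ⥤ Arrow C := W.comonad.forget

/-- The underlying map `(B.A).right ⟶ K B.A` of a coalgebra. -/
def costr (B : W.LMap) : B.A.right ⟶ W.K.obj B.A := Arrow.Hom.right B.a

/-- The underlying map `K A.A ⟶ (A.A).left` of an algebra. -/
def str (A : W.RMap) : W.K.obj A.A ⟶ A.A.left := Arrow.Hom.left A.a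

theorem hom_costr (B : W.LMap) : B.A.hom ≫ W.costr B = W.lam B.A := by
  have h1 : Arrow.Hom.left B.a ≫ 𝟙 B.A.left = 𝟙 B.A.left := congrArg (fun s => Arrow.Hom.left s) B.counit
  have h2 : Arrow.Hom.left B.a ≫ W.lam B.A = B.A.hom ≫ W.costr B := Arrow.w B.a
  have h3 : Arrow.Hom.left B.a = 𝟙 B.A.left := (Category.comp_id _).symm.trans h1
  rw [← h2]
  exact (congrArg (fun t => t ≫ W.lam B.A) h3).trans (Category.id_comp _)

theorem costr_rho (B : W.LMap) : W.costr B ≫ W.rho B.A = 𝟙 B.A.right :=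
  congrArg (fun s => Arrow.Hom.right s) B.counit

theorem lam_str (A : W.RMap) : W.lam A.A ≫ W.str A = 𝟙 A.A.left :=
  congrArg (fun s => Arrow.Hom.left s) A.unit

theorem str_hom (A : W.RMap) : W.str A ≫ A.A.hom = W.rho A.A := by
  obtain ⟨A, a, hu, -⟩ := A
  obtain ⟨p, q, w⟩ := a
  have h1 : W.rho A ≫ q = W.rho A := by
    have : 𝟙 A.right ≫ q = 𝟙 A.right := congrArg (fun s => Arrow.Hom.right s) hu
    exact (congrArg (fun t => W.rho A ≫ t) ((Category.id_comp _).symm.trans this)).trans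
      (Category.comp_id _)
  have h2 : p ≫ A.hom = W.rho A ≫ q := w
  exact h2.trans h1

theorem costr_map {B B' : W.LMap} (m : B ⟶ B') :
    W.costr B ≫ W.K.map m.f = m.f.right ≫ W.costr B' :=
  congrArg (fun s => Arrow.Hom.right s) m.h

theorem map_str {A A' : W.RMap} (m : A ⟶ A') :
    W.K.map m.f ≫ W.str A' = W.str A ≫ m.f.left :=
  congrArg (fun s => Arrow.Hom.left s) m.h

/-- The canonical filler of a square from a coalgebra to an algebra: the composite of the coalgebra
structure, `K s`, and the algebra structure. -/
def filler (B : W.LMap) (A : W.RMap) (s : B.A ⟶ A.A) : B.A.right ⟶ A.A.left :=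
  W.costr B ≫ W.K.map s ≫ W.str A

theorem hom_filler (B : W.LMap) (A : W.RMap) (s : B.A ⟶ A.A) :
    B.A.hom ≫ W.filler B A s = s.left := by
  rw [filler, ← Category.assoc, W.hom_costr, ← Category.assoc, ← W.lam_nat s, Category.assoc,
    W.lam_str, Category.comp_id]

theorem filler_hom (B : W.LMap) (A : W.RMap) (s : B.A ⟶ A.A) :
    W.filler B A s ≫ A.A.hom = s.right := by
  rw [filler, Category.assoc, Category.assoc, W.str_hom, W.rho_nat s, ← Category.assoc,
    W.costr_rho, Category.id_comp]

theorem filler_costr {B B' : W.LMap} (m : B ⟶ B') (A : W.RMap) (s : B'.A ⟶ A.A) :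
    W.filler B A (m.f ≫ s) = m.f.right ≫ W.filler B' A s := by
  rw [filler, filler, ← Category.assoc m.f.right, ← W.costr_map, Functor.map_comp]
  simp only [Category.assoc]

theorem filler_str (B : W.LMap) {A A' : W.RMap} (m : A ⟶ A') (s : B.A ⟶ A.A) :
    W.filler B A s ≫ m.f.left = W.filler B A' (s ≫ m.f) := by
  rw [filler, filler, Functor.map_comp, Category.assoc, Category.assoc, Category.assoc, W.map_str]

/-- The canonical functor `R-Map ⥤ L-Map^⋔`. -/
def lift : W.RMap ⥤ Pitchfork W.forgetL where
  obj A :=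
    { arr := A.A
      lift := fun B s => W.filler B A s
      lift_left := fun B s => W.hom_filler B A s
      lift_right := fun B s => W.filler_hom B A s
      natural := fun m s => W.filler_costr m A s }
  map m := ⟨m.f, fun B s => W.filler_str B m s⟩

end AWFS

/-- `F` is an isomorphism of categories. -/
def IsIsoOfCategories {D : Type w} [Category.{v} D] {E : Type w'} [Category.{v'} E] (F : D ⥤ E) :
    Prop :=
  ∃ G : E ⥤ D, F ⋙ G = 𝟭 D ∧ G ⋙ F = 𝟭 E

end General

section KanAWFS

variable {𝔸 : Type u} [DecidableEq 𝔸] [Infinite 𝔸]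

section Pres

variable {U V W U' V' W' U'' V'' : Sub01 𝔸} {g : U ⟶ V} {g' : U' ⟶ V'} {g'' : U'' ⟶ V''}

/-- The square `(m, n)` preserves the chosen fillers. -/
structure Pres (H : KanOp g) (H' : KanOp g') (m : U ⟶ U') (n : V ⟶ V') : Prop where
  out : ∀ {i A a u y}, IsOpenBox g i A a u y →
    m (H.fill i A a u y) = H'.fill i A a (fun b j => m (u b j)) (n y)

theorem Pres.comp {H : KanOp g} {H' : KanOp g'} {H'' : KanOp g''} {m : U ⟶ U'} {n : V ⟶ V'}
    {m' : U' ⟶ U''} {n' : V' ⟶ V''} (h' : Pres H' H'' m' n') (w : m ≫ g' = g ≫ n)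
    (h : Pres H H' m n) : Pres H H'' (m ≫ m') (n ≫ n') := ⟨fun hu =>
  (congrArg m' (h.out hu)).trans (h'.out (hu.map m n w))⟩

theorem Pres.id (H : KanOp g) : Pres H H (𝟙 U) (𝟙 V) := ⟨fun _ => rfl⟩

theorem IsOpenBox.left {k : V ⟶ W} {i A a} {u : 𝔸 → Bool → U} {y : W}
    (h : IsOpenBox (g ≫ k) i A a u y) : IsOpenBox k i A a (fun b j => g (u b j)) y :=
  h.map g (𝟙 W) rfl

theorem IsOpenBox.lift {k : V ⟶ W} {i A a} {u : 𝔸 → Bool → U} {y : W}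
    (h : IsOpenBox (g ≫ k) i A a u y) (H : KanOp k) :
    IsOpenBox g i A a u (H.fill i A a (fun b j => g (u b j)) y) :=
  ⟨h.mem, h.fresh, h.adj, fun b j hb => (H.face h.left b j hb).symm⟩

/-- Kan filling operators of a composite. -/
def KanOp.comp {k : V ⟶ W} (H : KanOp g) (H' : KanOp k) : KanOp (g ≫ k) where
  fill i A a u y := H.fill i A a u (H'.fill i A a (fun b j => g (u b j)) y)
  congr {i A a u u' y} h e := by
    rw [H.congr (h.lift H') e, H'.congr h.left fun b j hb => congrArg g (e b j hb)]
  face h b j hb := H.face (h.lift H') b j hb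
  lies h := (congrArg k (H.lies (h.lift H'))).trans (H'.lies h.left)
  perm π i A a u y := by
    have e := H'.perm π i A a (fun b j => g (u b j)) y
    simp only [Sub01.hom_smul]
    exact (congrArg (fun t => H.fill i (π • A) (π • a) (fun b j => π • u (π⁻¹ • b) j) t) e).trans
      (H.perm π i A a u _)
  unif h c j hc := by
    simp only [Sub01.hom_sub]
    rw [H'.unif h.left c j hc, H.unif (h.lift H') c j hc]

theorem Pres.stack {k : V ⟶ W} {k' : V' ⟶ W'} {H : KanOp g} {H₂ : KanOp k} {H' : KanOp g'}
    {H₂' : KanOp k'} {m : U ⟶ U'} {n : V ⟶ V'} {l : W ⟶ W'} (w : m ≫ g' = g ≫ n)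
    (h : Pres H H' m n) (h₂ : Pres H₂ H₂' n l) :
    Pres (H.comp H₂) (H'.comp H₂') m l := ⟨fun {i A a u y} hu => by
  refine (h.out (hu.lift H₂)).trans ?_
  rw [h₂.out hu.left]
  have : ∀ b j, n (g (u b j)) = g' (m (u b j)) := fun b j =>
    (congrArg (fun t : U ⟶ V' => t (u b j)) w).symm
  simp only [this]
  rfl⟩

/-- The first map of a composite preserves fillers. -/
theorem Pres.fst {k : V ⟶ W} (H : KanOp g) (H' : KanOp k) :
    Pres (H.comp H') H' g (𝟙 W) := ⟨fun hu => H.lies (hu.lift H')⟩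

theorem Pres.ext {X Y : Sub01 𝔸} {f : X ⟶ Y} (H : KanOp g) (h : X ⟶ U) (k : Y ⟶ V)
    (w : h ≫ g = f ≫ k) : Pres (kanK f) H (ext H h k w) k := ⟨fun hu => ext_fill H h k w hu⟩

theorem Pres.unique {X Y : Sub01 𝔸} {f : X ⟶ Y} {H : KanOp g} {k : Y ⟶ V} {m m' : K f ⟶ U}
    (e : lam f ≫ m = lam f ≫ m') (hk : m ≫ g = rho f ≫ k) (hm : Pres (kanK f) H m k)
    (hm' : Pres (kanK f) H m' k) : m = m' :=
  ext_unique H k e hk hm.out hm'.out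

end Pres

/-- The action of `K` on squares: `(u, y)` is sent to `(K(h, k) ∘ u, k y)`. -/
noncomputable def Kmap {X Y U V : Sub01 𝔸} {f : X ⟶ Y} {g : U ⟶ V} (h : X ⟶ U) (k : Y ⟶ V)
    (w : h ≫ g = f ≫ k) : K f ⟶ K g :=
  ext (kanK g) (h ≫ lam g) k w

section Maps

variable {X Y U V : Sub01 𝔸} {f : X ⟶ Y} {g : U ⟶ V} (h : X ⟶ U) (k : Y ⟶ V) (w : h ≫ g = f ≫ k)

theorem lam_Kmap : lam f ≫ Kmap h k w = h ≫ lam g := rfl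

theorem Kmap_rho : Kmap h k w ≫ rho g = rho f ≫ k := ext_rho (kanK g) (h ≫ lam g) k w

theorem Kmap_pres : Pres (kanK f) (kanK g) (Kmap h k w) k :=
  Pres.ext (kanK g) (h ≫ lam g) k w

/-- The comultiplication `σ_f`: it sends `(u, y)` to `(σ_f ∘ u, (u, y))`. -/
noncomputable def sigma (f : X ⟶ Y) : K f ⟶ K (lam f) :=
  ext ((kanK (lam f)).comp (kanK f)) (lam (lam f)) (𝟙 Y) rfl

theorem lam_sigma : lam f ≫ sigma f = lam (lam f) := rfl

theorem sigma_pres : Pres (kanK f) ((kanK (lam f)).comp (kanK f)) (sigma f) (𝟙 Y) :=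
  Pres.ext _ _ _ _

theorem sigma_rho_rho : sigma f ≫ rho (lam f) ≫ rho f = rho f ≫ 𝟙 Y := ext_rho _ _ _ _

theorem sigma_rho : sigma f ≫ rho (lam f) = 𝟙 (K f) :=
  Pres.unique (H := kanK f) (k := 𝟙 Y) rfl sigma_rho_rho
    ((Pres.fst (kanK (lam f)) (kanK f)).comp sigma_rho_rho sigma_pres) (Pres.id _)

/-- The multiplication `π_f`: it sends `(u, y)` to `(π_f ∘ u, y)`. -/
noncomputable def pi (f : X ⟶ Y) : K (rho f) ⟶ K f := ext (kanK f) (𝟙 (K f)) (𝟙 Y) rfl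

theorem lam_pi : lam (rho f) ≫ pi f = 𝟙 (K f) := rfl

theorem pi_rho : pi f ≫ rho f = rho (rho f) ≫ 𝟙 Y := ext_rho _ _ _ _

theorem pi_pres : Pres (kanK (rho f)) (kanK f) (pi f) (𝟙 Y) := Pres.ext _ _ _ _

section Laws

theorem sigma_nat : Kmap h k w ≫ sigma g = sigma f ≫ Kmap h (Kmap h k w) (lam_Kmap h k w).symm := by
  have w' := Kmap_rho h (Kmap h k w) (lam_Kmap h k w).symm
  refine Pres.unique (H := (kanK (lam g)).comp (kanK g)) (k := k) rfl ?_ ?_ ?_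
  · rw [Category.assoc, sigma_rho_rho, Category.comp_id, Kmap_rho]
  · exact Pres.comp sigma_pres (Kmap_rho h k w) (Kmap_pres h k w)
  · exact Pres.comp (Pres.stack w' (Kmap_pres _ _ _) (Kmap_pres _ _ _)) sigma_rho_rho sigma_pres

variable (f)

theorem sigma_counit (w : 𝟙 X ≫ f = lam f ≫ rho f) :
    sigma f ≫ Kmap (𝟙 X) (rho f) w = 𝟙 (K f) := by
  refine Pres.unique (H := kanK f) (k := 𝟙 Y) rfl ?_ ?_ (Pres.id _)
  · rw [Category.assoc, Kmap_rho, sigma_rho_rho]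
  · refine Pres.comp (H' := (kanK (lam f)).comp (kanK f)) (n' := 𝟙 Y) ⟨fun {i A a u y} hu => ?_⟩
      sigma_rho_rho sigma_pres
    refine ((Kmap_pres (𝟙 X) (rho f) w).out (hu.lift (kanK f))).trans ?_
    rw [(kanK f).lies hu.left]
    rfl

theorem sigma_coassoc (w : 𝟙 X ≫ lam (lam f) = lam f ≫ sigma f) :
    sigma f ≫ Kmap (𝟙 X) (sigma f) w = sigma f ≫ sigma (lam f) := by
  refine Pres.unique (H := (kanK (lam (lam f))).comp ((kanK (lam f)).comp (kanK f)))
    (k := 𝟙 Y) rfl ?_ ?_ ?_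
  · rw [Category.assoc, ← Category.assoc (Kmap _ _ _), Kmap_rho, Category.assoc, sigma_rho_rho,
      ← Category.assoc, sigma_rho, Category.id_comp]
  · exact Pres.comp (n' := 𝟙 Y) (Pres.stack (Kmap_rho _ _ w) (Kmap_pres _ _ w) sigma_pres)
      sigma_rho_rho sigma_pres
  · exact Pres.comp (n' := 𝟙 Y)
      (Pres.stack (sigma_rho_rho (f := lam f)) sigma_pres (Pres.id (kanK f))) sigma_rho_rho
      sigma_pres

theorem pi_unit (w : lam f ≫ rho f = f ≫ 𝟙 Y) : Kmap (lam f) (𝟙 Y) w ≫ pi f = 𝟙 (K f) := by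
  refine Pres.unique (H := kanK f) (k := 𝟙 Y) rfl ?_ ?_ (Pres.id _)
  · rw [Category.assoc, pi_rho, Category.comp_id, Kmap_rho]
  · exact pi_pres.comp (n' := 𝟙 Y) (Kmap_rho _ _ w) (Kmap_pres _ _ w)

theorem pi_assoc (w : pi f ≫ rho f = rho (rho f) ≫ 𝟙 Y) :
    Kmap (pi f) (𝟙 Y) w ≫ pi f = pi (rho f) ≫ pi f := by
  refine Pres.unique (f := rho (rho f)) (H := kanK f) (k := 𝟙 Y) rfl ?_ ?_ ?_
  · rw [Category.assoc, pi_rho, Category.comp_id, Kmap_rho]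
  · exact pi_pres.comp (n' := 𝟙 Y) (Kmap_rho _ _ w) (Kmap_pres _ _ w)
  · exact pi_pres.comp (n' := 𝟙 Y) pi_rho pi_pres

variable {f}

theorem pi_nat : Kmap (Kmap h k w) k (Kmap_rho h k w) ≫ pi g = pi f ≫ Kmap h k w := by
  refine Pres.unique (f := rho f) (H := kanK g) (k := k) rfl ?_ ?_ ?_
  · rw [Category.assoc, pi_rho, Category.comp_id, Kmap_rho]
  · exact pi_pres.comp (Kmap_rho _ _ _) (Kmap_pres _ _ _)
  · exact (Kmap_pres _ _ _).comp pi_rho pi_pres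

end Laws

end Maps

/-- The functorial factorisation `X ⟶ K f ⟶ Y`. -/
noncomputable def kanFactorisation (𝔸 : Type u) [DecidableEq 𝔸] [Infinite 𝔸] :
    FunctorialFactorisation (Sub01 𝔸) where
  K :=
    { obj := fun f => K f.hom
      map := fun s => Kmap s.left s.right s.w
      map_id := fun f => Pres.unique (H := kanK f.hom) (k := 𝟙 _) rfl (Kmap_rho _ _ _)
        (Kmap_pres _ _ _) (Pres.id _)
      map_comp := fun s t => Pres.unique (k := s.right ≫ t.right) rfl (Kmap_rho _ _ _)
        (Kmap_pres _ _ _) ((Kmap_pres t.left t.right t.w).comp (Kmap_rho _ _ _) (Kmap_pres _ _ _)) }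
  lam f := lam f.hom
  rho f := rho f.hom
  fac f := lam_rho f.hom
  lam_nat _ := rfl
  rho_nat s := Kmap_rho s.left s.right s.w

/-- The algebraic weak factorisation system on 01-substitution sets. -/
noncomputable def kanAWFS (𝔸 : Type u) [DecidableEq 𝔸] [Infinite 𝔸] : AWFS (Sub01 𝔸) where
  toFunctorialFactorisation := kanFactorisation 𝔸
  comult :=
    { app := fun f => Arrow.homMk (𝟙 f.left) (sigma f.hom) rfl
      naturality := fun _ _ s => Arrow.hom_ext _ _ rfl (sigma_nat s.left s.right s.w) }
  comult_left _ := Arrow.hom_ext _ _ rfl sigma_rho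
  comult_right f := Arrow.hom_ext _ _ rfl (sigma_counit f.hom rfl)
  comult_coassoc f := Arrow.hom_ext _ _ rfl (sigma_coassoc f.hom rfl)
  mult :=
    { app := fun f => Arrow.homMk (pi f.hom) (𝟙 f.right) pi_rho
      naturality := fun _ _ s => Arrow.hom_ext _ _ (pi_nat s.left s.right s.w) rfl }
  mult_left _ := Arrow.hom_ext _ _ rfl rfl
  mult_right f := Arrow.hom_ext _ _ (pi_unit f.hom rfl) rfl
  mult_assoc f := Arrow.hom_ext _ _ (pi_assoc f.hom pi_rho) rfl

end KanAWFS

section Diagram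

variable {𝔸 : Type u}

/-- A partial function given by `f : α → β ⊕ 2` is injective where defined. -/
def InjDef {α β : Type u} (f : α → β ⊕ Bool) : Prop :=
  ∀ x x' b, f x = .inl b → f x' = .inl b → x = x'

/-- Composition of `f : α → β ⊕ 2` with `g : β → γ ⊕ 2`, constant on `2`. -/
def subComp {α β γ : Type u} (f : α → β ⊕ Bool) (g : β → γ ⊕ Bool) (x : α) : γ ⊕ Bool :=
  (f x).elim g .inr

theorem InjDef.subComp {α β γ : Type u} {f : α → β ⊕ Bool} {g : β → γ ⊕ Bool} (hf : InjDef f)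
    (hg : InjDef g) : InjDef (subComp f g) := by
  intro x x' c h h'
  cases hx : f x with
  | inr j => simp [ZeroOneSub.subComp, hx] at h
  | inl b =>
    cases hx' : f x' with
    | inr j => simp [ZeroOneSub.subComp, hx'] at h'
    | inl b' =>
      simp only [ZeroOneSub.subComp, hx, hx', Sum.elim_inl] at h h'
      obtain rfl := hg _ _ _ h h'
      exact hf _ _ _ hx hx'

theorem subComp_inl {α β : Type u} (f : α → β ⊕ Bool) : subComp f Sum.inl = f := funext fun x => by
  simp only [subComp]
  cases f x <;> rfl

theorem subComp_assoc {α β γ δ : Type u} (r : α → β ⊕ Bool) (q : β → γ ⊕ Bool) (p : γ → δ ⊕ Bool) :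
    subComp (subComp r q) p = subComp r (subComp q p) := funext fun x => by
  simp only [subComp]
  cases r x <;> rfl

theorem injDef_inl {α β : Type u} {f : α → β} (hf : Function.Injective f) :
    InjDef (fun x => Sum.inl (f x)) := fun _ _ _ h h' =>
  hf (Sum.inl_injective (h.trans h'.symm))

variable [DecidableEq 𝔸] [Infinite 𝔸]

/-- The 01-substitution set of elements of `X` satisfying a stable predicate. -/
def subobj (X : Sub01 𝔸) (P : X → Prop) (hπ : ∀ (π : FinPerm 𝔸) x, P x → P (π • x))
    (hs : ∀ x a i, P x → P (X.sub x a i)) : Sub01 𝔸 :=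
  letI : MulAction (FinPerm 𝔸) {x // P x} :=
    { smul := fun π x => ⟨π • x.1, hπ π x.1 x.2⟩
      one_smul := fun x => Subtype.ext (one_smul _ x.1)
      mul_smul := fun π π' x => Subtype.ext (mul_smul π π' x.1) }
  have hsupp : ∀ (S : Set 𝔸) (x : {x // P x}), MulAction.Supports (FinPerm 𝔸) S x ↔
      MulAction.Supports (FinPerm 𝔸) S x.1 := fun S x =>
    ⟨fun h π hπ => congrArg Subtype.val (h π hπ), fun h π hπ => Subtype.ext (h π hπ)⟩
  have hfresh : ∀ (a : 𝔸) (x : {x // P x}), Fresh (𝔸 := 𝔸) a x ↔ Fresh (𝔸 := 𝔸) a x.1 :=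
    fun a x => by simp only [Fresh, hsupp]
  { carrier := {x // P x}
    exists_supports := fun x => (X.exists_supports x.1).imp fun S h => (hsupp _ _).2 h
    sub := fun x a i => ⟨X.sub x.1 a i, hs x.1 a i x.2⟩
    smul_sub := fun π x a i => Subtype.ext (X.smul_sub π x.1 a i)
    fresh_sub := fun x a i => (hfresh _ _).2 (X.fresh_sub x.1 a i)
    sub_of_fresh := fun x a i h => Subtype.ext (X.sub_of_fresh x.1 a i ((hfresh _ _).1 h))
    sub_comm := fun x a i a' i' h => Subtype.ext (X.sub_comm x.1 a i a' i' h) }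

/-- The inclusion of `subobj X P` in `X`. -/
def subobjIncl (X : Sub01 𝔸) (P : X → Prop) (hπ : ∀ (π : FinPerm 𝔸) x, P x → P (π • x))
    (hs : ∀ x a i, P x → P (X.sub x a i)) : subobj X P hπ hs ⟶ X where
  toFun x := x.1
  map_smul _ _ := rfl
  map_sub _ _ _ := rfl

theorem fresh_prod {X Y : Sub01 𝔸} {a : 𝔸} {p : X × Y} :
    Fresh (𝔸 := 𝔸) a p ↔ Fresh (𝔸 := 𝔸) a p.1 ∧ Fresh (𝔸 := 𝔸) a p.2 := by
  simp only [fresh_name_iff]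
  constructor
  · rintro ⟨S, hS, ha⟩
    exact ⟨⟨S, fun π hπ => congrArg Prod.fst (hS π hπ), ha⟩,
      ⟨S, fun π hπ => congrArg Prod.snd (hS π hπ), ha⟩⟩
  · rintro ⟨⟨S, hS, ha⟩, ⟨T, hT, ha'⟩⟩
    refine ⟨S ∪ T, fun π hπ => Prod.ext ?_ ?_, by simp [ha, ha']⟩
    · exact hS π fun b hb => hπ (by simp_all)
    · exact hT π fun b hb => hπ (by simp_all)

/-- The product of 01-substitution sets. -/
def prod (X Y : Sub01 𝔸) : Sub01 𝔸 where
  carrier := X × Y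
  exists_supports p := by
    obtain ⟨S, hS⟩ := X.exists_supports p.1
    obtain ⟨T, hT⟩ := Y.exists_supports p.2
    refine ⟨S ∪ T, fun π hπ => Prod.ext ?_ ?_⟩
    · exact hS π fun b hb => hπ (by simp_all)
    · exact hT π fun b hb => hπ (by simp_all)
  sub p a i := (X.sub p.1 a i, Y.sub p.2 a i)
  smul_sub π p a i := Prod.ext (X.smul_sub π p.1 a i) (Y.smul_sub π p.2 a i)
  fresh_sub p a i := fresh_prod.2 ⟨X.fresh_sub p.1 a i, Y.fresh_sub p.2 a i⟩
  sub_of_fresh p a i h := Prod.ext (X.sub_of_fresh p.1 a i (fresh_prod.1 h).1)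
    (Y.sub_of_fresh p.2 a i (fresh_prod.1 h).2)
  sub_comm p a i a' i' h := Prod.ext (X.sub_comm p.1 a i a' i' h) (Y.sub_comm p.2 a i a' i' h)

/-- The separated product `X ∗ Y` of pairs `(x, y)` with `x # y`. -/
def sep (X Y : Sub01 𝔸) : Sub01 𝔸 :=
  subobj (prod X Y) (fun p => Fresh (𝔸 := 𝔸) p.1 p.2) (fun π _ h => h.smul π)
    fun _ a i ⟨S, T, hS, hT, hd⟩ =>
      ⟨S, T, X.supports_sub hS a i, Y.supports_sub hT a i, hd⟩

/-- Functoriality of the separated product. -/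
def sepMap {X Y X' Y' : Sub01 𝔸} (m : X ⟶ X') (n : Y ⟶ Y') : sep X Y ⟶ sep X' Y' where
  toFun p := ⟨(m p.1.1, n p.1.2), by
    obtain ⟨S, T, hS, hT, hd⟩ := p.2
    exact ⟨S, T, Sub01.supports_hom m hS, Sub01.supports_hom n hT, hd⟩⟩
  map_smul π p := Subtype.ext (Prod.ext (m.map_smul π p.1.1) (n.map_smul π p.1.2))
  map_sub p a i := Subtype.ext (Prod.ext (m.map_sub p.1.1 a i) (n.map_sub p.1.2 a i))

section Cube

variable (A : Finset 𝔸)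

/-- Functions `A → 𝔸 ⊕ 2` that are injective where defined. -/
def CubeSet : Type u := {f : A → 𝔸 ⊕ Bool // InjDef f}

variable {A}

instance : MulAction (FinPerm 𝔸) (CubeSet A) where
  smul π f := ⟨fun x => (f.1 x).map (π • ·) id, fun x x' b h h' => by
    cases hx : f.1 x with
    | inr j => simp [hx] at h
    | inl c =>
      cases hx' : f.1 x' with
      | inr j => simp [hx'] at h'
      | inl c' =>
        simp only [hx, hx', Sum.map_inl, Sum.inl.injEq] at h h'
        obtain rfl := smul_left_cancel π (h.trans h'.symm)
        exact f.2 _ _ _ hx hx'⟩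
  one_smul f := Subtype.ext (funext fun x => by
    change (f.1 x).map _ _ = f.1 x
    cases f.1 x <;> simp)
  mul_smul π π' f := Subtype.ext (funext fun x => by
    change (f.1 x).map _ _ = ((f.1 x).map _ _).map _ _
    cases f.1 x <;> simp [mul_smul])

theorem CubeSet.smul_apply (π : FinPerm 𝔸) (f : CubeSet A) (x : A) :
    (π • f).1 x = (f.1 x).map (π • ·) id := rfl

theorem CubeSet.exists_supports (f : CubeSet A) : ∃ S : Finset 𝔸,
    MulAction.Supports (FinPerm 𝔸) (S : Set 𝔸) f ∧ ∀ a ∈ S, ∃ x, f.1 x = .inl a := by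
  refine ⟨Finset.univ.biUnion fun x => (f.1 x).elim (fun a => {a}) fun _ => ∅,
    fun π hπ => Subtype.ext (funext fun x => ?_), fun a ha => ?_⟩
  · rw [CubeSet.smul_apply]
    cases h : f.1 x with
    | inr j => rfl
    | inl a =>
      refine congrArg Sum.inl (hπ ?_)
      simp only [Finset.coe_biUnion, Set.mem_iUnion]
      exact ⟨x, by simp, by simp [h]⟩
  · simp only [Finset.mem_biUnion, Finset.mem_univ, true_and] at ha
    obtain ⟨x, hx⟩ := ha
    refine ⟨x, ?_⟩
    cases h : f.1 x with
    | inr j => simp [h] at hx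
    | inl b => simp_all

theorem CubeSet.fresh_iff {f : CubeSet A} {a : 𝔸} : Fresh (𝔸 := 𝔸) a f ↔ ∀ x, f.1 x ≠ .inl a := by
  rw [fresh_name_iff]
  constructor
  · rintro ⟨S, hS, ha⟩ x hx
    obtain ⟨c, hc⟩ := exists_notMem (insert a S)
    simp only [Finset.mem_insert, not_or] at hc
    have := hS (sw a c) fun b hb => sw_ne (fun h => ha (h ▸ hb)) (fun h => hc.2 (h ▸ hb))
    have := congrArg (fun g => g.1 x) this
    simp only [CubeSet.smul_apply, hx, Sum.map_inl, sw_left, Sum.inl.injEq] at this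
    exact hc.1 this
  · intro h
    obtain ⟨S, hS, h'⟩ := f.exists_supports
    exact ⟨S, hS, fun ha => (h' a ha).elim h⟩

/-- The value of `f(a := i)` at a point where `f` has the value `v`. -/
def subVal (a : 𝔸) (i : Bool) : 𝔸 ⊕ Bool → 𝔸 ⊕ Bool
  | .inl b => if b = a then .inr i else .inl b
  | .inr j => .inr j

variable (A)

/-- The standard cube `□_A`. -/
def cube : Sub01 𝔸 where
  carrier := CubeSet A
  exists_supports f := f.exists_supports.imp fun _ h => h.1
  sub f a i := ⟨fun x => subVal a i (f.1 x), fun x x' b h h' => by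
    cases hx : f.1 x <;> cases hx' : f.1 x' <;> simp only [hx, hx', subVal] at h h'
    · split_ifs at h h'
      exact f.2 _ _ _ (hx.trans h) (hx'.trans h')
    all_goals simp at h h'⟩
  smul_sub π f a i := Subtype.ext (funext fun x => by
    change (subVal a i (f.1 x)).map _ _ = subVal (π • a) i ((f.1 x).map _ _)
    cases f.1 x <;> simp [subVal]
    split_ifs <;> simp)
  fresh_sub f a i := CubeSet.fresh_iff.2 fun x => by
    change subVal a i (f.1 x) ≠ _
    cases f.1 x <;> simp [subVal]
    split_ifs <;> simp_all
  sub_of_fresh f a i h := Subtype.ext (funext fun x => by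
    change subVal a i (f.1 x) = f.1 x
    have := CubeSet.fresh_iff.1 h x
    cases hx : f.1 x <;> simp_all [subVal])
  sub_comm f a i a' i' h := Subtype.ext (funext fun x => by
    change subVal a' i' (subVal a i (f.1 x)) = subVal a i (subVal a' i' (f.1 x))
    cases hx : f.1 x with
    | inr j => rfl
    | inl b =>
      simp only [subVal]
      split_ifs <;> simp_all)

variable {A}

/-- The map `□_A ⟶ □_B` given by precomposition with `g : B → A ⊕ 2`. -/
def cubeMap {B : Finset 𝔸} (g : B → A ⊕ Bool) (hg : InjDef g) : cube A ⟶ cube B where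
  toFun f := ⟨subComp g f.1, hg.subComp f.2⟩
  map_smul π f := Subtype.ext (funext fun x => by
    change (g x).elim _ _ = ((g x).elim f.1 Sum.inr).map (π • ·) id
    cases g x <;> rfl)
  map_sub f a i := Subtype.ext (funext fun x => by
    change (g x).elim _ _ = subVal a i ((g x).elim f.1 Sum.inr)
    cases g x <;> rfl)

/-- `f` belongs to the standard `i`-open `(A, a)`-box. -/
def IsInBox (i : Bool) (A : Finset 𝔸) (a : 𝔸) (f : cube A) : Prop :=
  ∃ (b : A) (j : Bool), InDom i A a b j ∧ f.1 b = .inr j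

/-- The standard `i`-open `(A, a)`-box: `⊔_{A,a}` for `i = 1` and `⊓_{A,a}` for `i = 0`. -/
def openBox (i : Bool) (A : Finset 𝔸) (a : 𝔸) : Sub01 𝔸 :=
  subobj (cube A) (IsInBox i A a)
    (fun π f ⟨b, j, hb, h⟩ => ⟨b, j, hb, by
      change (f.1 b).map (π • ·) id = _; rw [h]; rfl⟩)
    (fun f c k ⟨b, j, hb, h⟩ => ⟨b, j, hb, by change subVal c k (f.1 b) = _; rw [h]; rfl⟩)

/-- The inclusion of the standard open box in the cube. -/
def openBoxIncl (i : Bool) (A : Finset 𝔸) (a : 𝔸) : openBox i A a ⟶ cube A :=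
  subobjIncl _ _ _ _

/-- Precomposition with a bijection that respects the distinguished names, on open boxes. -/
def openBoxMap {i i' : Bool} {A' : Finset 𝔸} {a a' : 𝔸} (ha : a ∈ A) (ha' : a' ∈ A') (hi : i = i')
    (e : A' ≃ A) (he : e ⟨a', ha'⟩ = ⟨a, ha⟩) : openBox i A a ⟶ openBox i' A' a' where
  toFun f := ⟨cubeMap (fun x => .inl (e x)) (injDef_inl e.injective) f.1, by
    obtain ⟨b, j, ⟨hb, hb'⟩, h⟩ := f.2
    refine ⟨e.symm b, j, ⟨(e.symm b).2, fun hc => hb' ?_⟩, ?_⟩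
    · have : e.symm b = ⟨a', ha'⟩ := Subtype.ext hc.1
      rw [Equiv.symm_apply_eq, he] at this
      exact ⟨congrArg Subtype.val this, hc.2.trans hi.symm⟩
    · change f.1.1 (e (e.symm b)) = _
      rw [Equiv.apply_symm_apply, h]⟩
  map_smul π f := Subtype.ext 
    ((cubeMap (fun x => .inl (e x)) (injDef_inl e.injective)).map_smul π f.1)
  map_sub f c k := Subtype.ext 
    ((cubeMap (fun x => .inl (e x)) (injDef_inl e.injective)).map_sub f.1 c k)

end Cube

/-- The objects `(i, A, a, B)` of the category `𝒥` of generating open box inclusions. -/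
structure GenBox (𝔸 : Type u) : Type u where
  i : Bool
  A : Finset 𝔸
  a : 𝔸
  mem : a ∈ A
  B : Finset 𝔸

namespace GenBox

/-- A morphism `(i, A, a, B) ⟶ (i', A', a', B')`, where `i = i'`: a bijection `f : A' ≃ A` with
`f a' = a` and a map `g : B' → B ⊕ 2` that is injective where defined. -/
@[ext] structure Hom (x y : GenBox 𝔸) : Type u where
  eq : x.i = y.i
  f : y.A ≃ x.A
  map : f ⟨y.a, y.mem⟩ = ⟨x.a, x.mem⟩
  g : y.B → x.B ⊕ Bool
  inj : InjDef g

instance : Category (GenBox 𝔸) where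
  Hom := Hom
  id x := ⟨rfl, Equiv.refl _, rfl, Sum.inl, injDef_inl Function.injective_id⟩
  comp p q := ⟨p.eq.trans q.eq, q.f.trans p.f, by rw [Equiv.trans_apply, q.map, p.map],
    subComp q.g p.g, q.inj.subComp p.inj⟩
  id_comp p := Hom.ext (Equiv.ext fun _ => rfl) (subComp_inl p.g)
  comp_id p := Hom.ext (Equiv.ext fun _ => rfl) rfl
  assoc p q r := Hom.ext (Equiv.ext fun _ => rfl) (subComp_assoc r.g q.g p.g).symm

/-- The functor `J : 𝒥 ⥤ 01Sub^𝟚`, sending `(i, A, a, B)` to the inclusion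
`⊔_{A,a} ∗ □_B ⟶ □_A ∗ □_B` (with `⊓_{A,a}` for `i = 0`). -/
def J (𝔸 : Type u) [DecidableEq 𝔸] [Infinite 𝔸] : GenBox 𝔸 ⥤ Arrow (Sub01 𝔸) where
  obj x := Arrow.mk (sepMap (openBoxIncl x.i x.A x.a) (𝟙 (cube x.B)))
  map {x y} p := Arrow.homMk
    (sepMap (openBoxMap x.mem y.mem p.eq p.f p.map) (cubeMap p.g p.inj))
    (sepMap (cubeMap (fun b => .inl (p.f b)) (injDef_inl p.f.injective)) (cubeMap p.g p.inj)) rfl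
  map_id x := Arrow.hom_ext _ _ (Sub01.hom_ext fun _ => rfl) (Sub01.hom_ext fun _ => rfl)
  map_comp p q := by
    refine Arrow.hom_ext _ _ (Sub01.hom_ext fun s => ?_) (Sub01.hom_ext fun s => ?_)
    · exact Subtype.ext (Prod.ext rfl (Subtype.ext (subComp_assoc q.g p.g s.1.2.1)))
    · exact Subtype.ext (Prod.ext rfl (Subtype.ext (subComp_assoc q.g p.g s.1.2.1)))

end GenBox

end Diagram

end ZeroOneSub

/-! Algebras and objects of `𝒥^⋔` both describe the same structure on a map `g`, namely `KanOp g`: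
fillers of all open boxes that are equivariant and commute with substitution for names outside the
box.

On the algebra side, `K g` is the free extension of `g` by fillers. An algebra `t : K g ⟶ U` fills
`(u, y)` by `t (u, y)`. Associativity says that `t` itself preserves fillers (`algKanOp_pres`), so
by freeness the operators determine `t` (`Pres.unique`). Conversely, any operators extend the
identity of `U` to an algebra (`KanOp.algebra`).

On the lifting side, `□_Z` represents the elements supported by `Z` (`yon`, `cube_hom_ext`), and
`□_A ∗ □_B` behaves like `□_{A ∪ B}` when `A` and `B` are disjoint. A square from such a generator
to `g` is therefore an open box with data supported by `A ∪ B`, and a diagonal filler of the square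
fills the box. Every open box comes from such a square (`exists_represents`), and two squares that
present the same box are compared along morphisms of `𝒥` (`lift_eq_lift`). Hence natural diagonal
fillers give a well-defined filler of each box. It is equivariant and uniform because a diagonal
filler is a morphism, evaluated at renamings and substitution instances of one element.

In the other direction, operators on `g` solve every lifting problem against a generator
(`fillCube`). An element of `□_A ∗ □_B` lies in the open box, or is total (all coordinates of its
first component are names), or is the missing face of a total element. A total element is sent to
the filler of the box of its faces, and a missing face to the missing face of that filler. This is
well defined because a missing face determines the total element up to renaming its bound direction
(`Total.eq_of_sub_nm_eq`), just as for abstracted boxes in `K g`.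

Solving the lifting problem against `ρ` with the free operators makes each generator a coalgebra,
which defines `η`. Since `fillCube` is natural in the operators (`fillCube_pres`), the canonical
filler against an algebra is `fillCube` for its own operators (`filler_eta`). So the composite
functor replaces operators by the fillers they induce. It is bijective on objects by the two
translations above, and fully faithful because a square that commutes with these fillers preserves
the operators (`rmap_comm`). -/

namespace ZeroOneSub

/-! ### Cubes are representable: maps `□_Z ⟶ Y` are elements of `Y` supported by `Z` -/

section Yoneda

variable {𝔸 : Type u} [DecidableEq 𝔸] [Infinite 𝔸]

/-- A function that is injective on a finite set of names extends to a finite permutation. -/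
theorem exists_finPerm (h : 𝔸 → 𝔸) (T : Finset 𝔸) (hT : Set.InjOn h T) :
    ∃ π : FinPerm 𝔸, ∀ z ∈ T, π • z = h z := by
  induction T using Finset.induction_on with
  | empty => exact ⟨1, by simp⟩
  | insert t T ht ih =>
    obtain ⟨π, hπ⟩ := ih (hT.mono (by simp))
    -- The extra transposition corrects the image of `t`. It leaves the images of `T` alone, since
    -- these differ from both `π • t` and `h t` by injectivity.
    refine ⟨sw (π • t) (h t) * π, fun z hz => ?_⟩
    rw [mul_smul]
    rcases Finset.mem_insert.1 hz with rfl | hz'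
    · rw [sw_left]
    · have hne : z ≠ t := fun e => ht (e ▸ hz')
      rw [sw_ne (by simpa using hne), hπ z hz']
      rw [hπ z hz']
      exact fun e => hne (hT (by simp [hz']) (by simp) e)

variable {X Y : Sub01 𝔸}

/-- The order of substitutions must not matter for a fold over a finite set to make sense. Repeated
names cause no conflict because the substituted value is a function of the name. -/
instance (Y : Sub01 𝔸) (τ : 𝔸 → Bool) : LeftCommutative fun a (y : Y) => Y.sub y a (τ a) :=
  ⟨fun a a' y => by
    by_cases h : a = a'
    · rw [h]
    · exact Y.sub_comm _ _ _ _ _ (Ne.symm h)⟩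

/-- The simultaneous substitution of `τ a` for all names `a ∈ S`. -/
def msub (Y : Sub01 𝔸) (τ : 𝔸 → Bool) (S : Finset 𝔸) (y : Y) : Y :=
  S.val.foldr (fun a y => Y.sub y a (τ a)) y

theorem msub_empty (τ : 𝔸 → Bool) (y : Y) : msub Y τ ∅ y = y := rfl

theorem msub_insert (τ : 𝔸 → Bool) {S : Finset 𝔸} {a : 𝔸} (h : a ∉ S) (y : Y) :
    msub Y τ (insert a S) y = Y.sub (msub Y τ S y) a (τ a) := by
  rw [msub, Finset.insert_val_of_notMem h, Multiset.foldr_cons]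
  rfl

theorem msub_congr {τ τ' : 𝔸 → Bool} {S : Finset 𝔸} (h : ∀ a ∈ S, τ a = τ' a) (y : Y) :
    msub Y τ S y = msub Y τ' S y := by
  induction S using Finset.induction_on with
  | empty => rfl
  | insert a S ha ih =>
    rw [msub_insert τ ha, msub_insert τ' ha, h a (by simp), ih fun b hb => h b (by simp [hb])]

theorem hom_msub (m : X ⟶ Y) (τ : 𝔸 → Bool) (S : Finset 𝔸) (x : X) :
    m (msub X τ S x) = msub Y τ S (m x) := by
  induction S using Finset.induction_on with
  | empty => rfl
  | insert a S ha ih => rw [msub_insert τ ha, msub_insert τ ha, Sub01.hom_sub, ih]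

/-- If `π` fixes `S` except possibly `a`, choose a very fresh `c`. As `(a c)` fixes `y`, one may
replace `π` by `π (a c)`, and then correct it by `(a πc)`, which also fixes `y`. The resulting
permutation fixes all of `S`, including `a`. -/
theorem supports_diff {S : Finset 𝔸} {y : Y} {a : 𝔸}
    (h : MulAction.Supports (FinPerm 𝔸) (S : Set 𝔸) y) (ha : Fresh (𝔸 := 𝔸) a y) :
    MulAction.Supports (FinPerm 𝔸) ((S.erase a : Finset 𝔸) : Set 𝔸) y := by
  intro π hπ
  obtain ⟨T, hT, haT⟩ := fresh_name_iff.1 ha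
  obtain ⟨c, hc⟩ := exists_notMem (insert a (S ∪ T ∪ π⁻¹ • S ∪ π⁻¹ • T))
  simp only [Finset.mem_insert, Finset.mem_union, not_or, Finset.mem_inv_smul_finset_iff] at hc
  have h1 : sw a c • y = y := hT _ fun t ht => sw_ne (fun e => haT (e ▸ ht))
    (fun e => hc.2.1.1.2 (e ▸ ht))
  have h2 : π • y = (sw (π • a) (π • c) * π) • y := by rw [← mul_sw, mul_smul, h1]
  have h3 : (sw a (π • c) * (sw (π • a) (π • c) * π)) • y = y := by
    refine h _ fun s hs => ?_
    have hs' : π • c ≠ s := fun e => hc.2.1.2 (e ▸ hs)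
    by_cases hsa : s = a
    · rw [hsa, mul_smul, mul_smul, sw_left, sw_right]
    · have : π • s = s := hπ (by simp [hsa, Finset.mem_coe.1 hs])
      rw [mul_smul, mul_smul, this, sw_ne _ hs'.symm, sw_ne hsa hs'.symm]
      rw [← this]
      simpa using hsa
  have h4 : sw a (π • c) • y = y := by
    refine hT _ fun t ht => sw_ne (fun e => haT (e ▸ ht)) fun e => ?_
    subst e
    exact hc.2.2 ht
  rw [h2]
  rw [mul_smul, ← eq_inv_smul_iff, sw_inv, h4] at h3
  exact h3

theorem supports_msub (τ : 𝔸 → Bool) (S : Finset 𝔸) {Z : Finset 𝔸} {y : Y}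
    (h : MulAction.Supports (FinPerm 𝔸) (Z : Set 𝔸) y) :
    MulAction.Supports (FinPerm 𝔸) ((Z \ S : Finset 𝔸) : Set 𝔸) (msub Y τ S y) := by
  induction S using Finset.induction_on with
  | empty => simpa [msub_empty] using h
  | insert a S ha ih =>
    rw [msub_insert τ ha, Finset.sdiff_insert]
    exact supports_diff (Y.supports_sub ih _ _) (Y.fresh_sub _ _ _)

variable {Z : Finset 𝔸}

/-- The values of an element of the standard cube. -/
def cubeVal (σ : cube Z) : Z → 𝔸 ⊕ Bool := Subtype.val (p := InjDef) σ

theorem cubeVal_injDef (σ : cube Z) : InjDef (cubeVal σ) := Subtype.property (p := InjDef) σ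

theorem cubeVal_ext {σ σ' : cube Z} (h : ∀ z, cubeVal σ z = cubeVal σ' z) : σ = σ' :=
  Subtype.ext (p := InjDef) (funext h)

theorem cubeVal_smul (π : FinPerm 𝔸) (σ : cube Z) (z : Z) :
    cubeVal (π • σ) z = (cubeVal σ z).map (π • ·) id := rfl

theorem cubeVal_sub (σ : cube Z) (a i) (z : Z) :
    cubeVal ((cube Z).sub σ a i) z = subVal a i (cubeVal σ z) := rfl

theorem fresh_cube_iff {σ : cube Z} {a : 𝔸} :
    Fresh (𝔸 := 𝔸) a σ ↔ ∀ z, cubeVal σ z ≠ .inl a := CubeSet.fresh_iff (f := (σ : CubeSet Z))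

/-- The element `σ` of `□_Z` substitutes `τ` on `S` and renames the other elements of `Z`
along `π`. -/
structure CubeDecomp (σ : cube Z) (S : Finset 𝔸) (τ : 𝔸 → Bool) (π : FinPerm 𝔸) : Prop where
  subset : S ⊆ Z
  inr : ∀ z : Z, z.1 ∈ S → cubeVal σ z = .inr (τ z)
  inl : ∀ z : Z, z.1 ∉ S → cubeVal σ z = .inl (π • z.1)

theorem exists_cubeDecomp (σ : cube Z) : ∃ S τ π, CubeDecomp σ S τ π := by
  classical
  -- `h` and `τ` read off the two kinds of values of `σ`. Their values elsewhere are junk: `h` is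
  -- used only on coordinates whose value is a name, `τ` only on the others.
  let h : 𝔸 → 𝔸 := fun z => if hz : z ∈ Z then (cubeVal σ ⟨z, hz⟩).elim id fun _ => z else z
  let τ : 𝔸 → Bool := fun z =>
    if hz : z ∈ Z then (cubeVal σ ⟨z, hz⟩).elim (fun _ => false) id else false
  have hl : ∀ (z : Z) c, cubeVal σ z = .inl c → h z = c := fun z c hc => by simp [h, hc]
  have hr : ∀ (z : Z) j, cubeVal σ z = .inr j → τ z = j := fun z c hc => by simp [τ, hc]
  have hinj : Set.InjOn h ((Z.filter fun z => ∃ (hz : z ∈ Z) (c : 𝔸), cubeVal σ ⟨z, hz⟩ = .inl c :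
      Finset 𝔸) : Set 𝔸) := by
    intro z hz z' hz' e
    simp only [Finset.coe_filter, Set.mem_ofPred_eq] at hz hz'
    obtain ⟨-, hz, c, hc⟩ := hz
    obtain ⟨-, hz', c', hc'⟩ := hz'
    have e1 := hl ⟨z, hz⟩ c hc
    have e2 := hl ⟨z', hz'⟩ c' hc'
    simp only at e1 e2
    have : c = c' := by rw [← e1, ← e2, e]
    exact congrArg Subtype.val (cubeVal_injDef σ _ _ _ hc (this ▸ hc'))
  obtain ⟨π, hπ⟩ := exists_finPerm h _ hinj
  refine ⟨Z.filter fun z => ¬∃ (hz : z ∈ Z) (c : 𝔸), cubeVal σ ⟨z, hz⟩ = .inl c, τ, π,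
    Finset.filter_subset _ _, fun z hz => ?_, fun z hz => ?_⟩
  · simp only [Finset.mem_filter, not_exists] at hz
    cases hσ : cubeVal σ z with
    | inl c => exact absurd hσ (hz.2 z.2 c)
    | inr j => rw [hr z j hσ]
  · simp only [Finset.mem_filter, not_and, not_not] at hz
    obtain ⟨hz', c, hc⟩ := hz z.2
    rw [hπ z (by simp only [Finset.mem_filter]; exact ⟨hz', hz', c, hc⟩), hl z c hc]
    exact hc

/-- `σ` determines `S`, the values of `τ` on `S` and those of `π` on `Z \ S`. The rest of `π` is
irrelevant because substituting for all of `S` leaves an element supported by `Z \ S`. -/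
theorem CubeDecomp.unique {σ : cube Z} {S S' τ τ' π π'} (h : CubeDecomp σ S τ π)
    (h' : CubeDecomp σ S' τ' π') {y : Y} (hy : MulAction.Supports (FinPerm 𝔸) (Z : Set 𝔸) y) :
    π • msub Y τ S y = π' • msub Y τ' S' y := by
  have hS : S = S' := by
    ext z
    constructor
    · intro hz
      by_contra hc
      have := (h.inr ⟨z, h.subset hz⟩ hz).symm.trans (h'.inl ⟨z, h.subset hz⟩ hc)
      simp at this
    · intro hz
      by_contra hc
      have := (h'.inr ⟨z, h'.subset hz⟩ hz).symm.trans (h.inl ⟨z, h'.subset hz⟩ hc)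
      simp at this
  subst hS
  rw [msub_congr (τ' := τ') fun z hz => Sum.inr_injective
    ((h.inr ⟨z, h.subset hz⟩ hz).symm.trans (h'.inr ⟨z, h.subset hz⟩ hz))]
  refine Y.smul_eq_of_agree (supports_msub τ' S hy) fun z hz => ?_
  rw [Finset.mem_sdiff] at hz
  exact Sum.inl_injective ((h.inl ⟨z, hz.1⟩ hz.2).symm.trans (h'.inl ⟨z, hz.1⟩ hz.2))

/-- The value at `σ` of the map `□_Z ⟶ Y` that classifies `y`. -/
noncomputable def yonVal (y : Y) (σ : cube Z) : Y :=
  (exists_cubeDecomp σ).choose_spec.choose_spec.choose •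
    msub Y (exists_cubeDecomp σ).choose_spec.choose (exists_cubeDecomp σ).choose y

theorem yonVal_eq {y : Y} (hy : MulAction.Supports (FinPerm 𝔸) (Z : Set 𝔸) y) {σ : cube Z}
    {S τ π} (h : CubeDecomp σ S τ π) : yonVal y σ = π • msub Y τ S y :=
  (exists_cubeDecomp σ).choose_spec.choose_spec.choose_spec.unique h hy

/-- The map `□_Z ⟶ Y` that classifies an element `y` supported by `Z`. -/
noncomputable def yon (y : Y) (hy : MulAction.Supports (FinPerm 𝔸) (Z : Set 𝔸) y) : cube Z ⟶ Y where
  toFun := yonVal y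
  map_smul ρ σ := by
    obtain ⟨S, τ, π, h⟩ := exists_cubeDecomp σ
    have h' : CubeDecomp (ρ • σ) S τ (ρ * π) :=
      ⟨h.subset, fun z hz => by rw [cubeVal_smul, h.inr z hz]; rfl,
        fun z hz => by rw [cubeVal_smul, h.inl z hz, mul_smul]; rfl⟩
    exact (yonVal_eq hy h').trans ((mul_smul _ _ _).trans (congrArg (ρ • ·) (yonVal_eq hy h).symm))
  map_sub σ c k := by
    obtain ⟨S, τ, π, h⟩ := exists_cubeDecomp σ
    by_cases hc : Fresh (𝔸 := 𝔸) c σ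
    · rw [(cube Z).sub_of_fresh _ _ _ hc, yonVal_eq hy h, Y.sub_of_fresh]
      refine fresh_name_iff.2 ⟨_, supports_smul π (supports_msub τ S hy), fun hm => ?_⟩
      rw [← Finset.inv_smul_mem_iff, Finset.mem_sdiff] at hm
      refine fresh_cube_iff.1 hc ⟨_, hm.1⟩ ?_
      rw [h.inl ⟨_, hm.1⟩ hm.2, smul_inv_smul]
    · rw [fresh_cube_iff] at hc
      push Not at hc
      -- Here `c` is the name at coordinate `z`, so substituting for `c` moves `z` into the set `S`
      -- of substituted coordinates and leaves `π` unchanged.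
      obtain ⟨z, hz⟩ := hc
      have hzS : z.1 ∉ S := fun hzS => by simp [h.inr z hzS] at hz
      have hπz : π • z.1 = c := Sum.inl_injective ((h.inl z hzS).symm.trans hz)
      have hup : ∀ z' : 𝔸, z' ∈ S → Function.update τ z.1 k z' = τ z' := fun z' hz' =>
        Function.update_of_ne (fun e => hzS (e.subst hz' : z.1 ∈ S)) _ _
      have h' : CubeDecomp ((cube Z).sub σ c k) (insert z.1 S)
          (Function.update τ z.1 k) π := by
        refine ⟨Finset.insert_subset z.2 h.subset, fun z' hz' => ?_, fun z' hz' => ?_⟩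
        · change subVal c k (cubeVal σ z') = _
          rcases Finset.mem_insert.1 hz' with e | hz'
          · rw [Subtype.ext e, hz]
            simp [subVal]
          · rw [h.inr z' hz', hup _ hz']
            rfl
        · simp only [Finset.mem_insert, not_or] at hz'
          change subVal c k (cubeVal σ z') = _
          rw [h.inl z' hz'.2]
          simp [subVal, ← hπz, hz'.1]
      rw [yonVal_eq hy h, yonVal_eq hy h', msub_insert _ hzS, Function.update_self, Y.smul_sub, hπz,
        msub_congr hup]

/-- The generic element of `□_Z`. -/
def cubeId (Z : Finset 𝔸) : cube Z :=
  (⟨fun z => .inl z.1, injDef_inl Subtype.val_injective⟩ : cube Z)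

theorem yon_id {y : Y} (hy : MulAction.Supports (FinPerm 𝔸) (Z : Set 𝔸) y) :
    yon y hy (cubeId Z) = y := by
  have h : CubeDecomp (cubeId Z : cube Z) ∅ (fun _ => false) 1 :=
    ⟨by simp, by simp, fun z _ => by rw [one_smul]; rfl⟩
  exact (yonVal_eq hy h).trans (one_smul _ _)

/-- The generic element generates the cube under substitutions and permutations. This is the
uniqueness half of the Yoneda lemma, used in `cube_hom_ext`. -/
theorem CubeDecomp.eq {σ : cube Z} {S τ π} (h : CubeDecomp σ S τ π) :
    σ = π • msub (cube Z) τ S (cubeId Z) := by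
  have key : ∀ S : Finset 𝔸, ∀ z : Z, cubeVal (msub (cube Z) τ S (cubeId Z)) z =
      if z.1 ∈ S then .inr (τ z) else .inl z.1 := by
    intro S z
    induction S using Finset.induction_on with
    | empty => rfl
    | insert a S ha ih =>
      rw [msub_insert τ ha]
      rw [cubeVal_sub, ih]
      by_cases h1 : z.1 ∈ S
      · simp [h1, subVal]
      · by_cases h2 : z.1 = a
        · simp [h2, ha, subVal]
        · simp [h1, h2, subVal]
  refine cubeVal_ext fun z => ?_
  rw [cubeVal_smul, key]
  by_cases hz : z.1 ∈ S
  · rw [if_pos hz, h.inr z hz]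
    rfl
  · rw [if_neg hz, h.inl z hz]
    rfl

theorem cube_hom_ext {m m' : cube Z ⟶ Y} (h : m (cubeId Z) = m' (cubeId Z)) : m = m' := by
  refine Sub01.hom_ext fun σ => ?_
  obtain ⟨S, τ, π, hσ⟩ := exists_cubeDecomp σ
  rw [hσ.eq, Sub01.hom_smul, Sub01.hom_smul, hom_msub, hom_msub, h]

end Yoneda

/-! ### Elements of `□_A ∗ □_B` and solutions of lifting problems -/

section Generators

variable {𝔸 : Type u} [DecidableEq 𝔸] [Infinite 𝔸]

section Sep

variable {X Y : Sub01 𝔸}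

/-- The first projection of a separated product. -/
def sepFst : sep X Y ⟶ X where
  toFun p := p.1.1
  map_smul _ _ := rfl
  map_sub _ _ _ := rfl

/-- The second projection of a separated product. -/
def sepSnd : sep X Y ⟶ Y where
  toFun p := p.1.2
  map_smul _ _ := rfl
  map_sub _ _ _ := rfl

theorem sep_ext {p q : sep X Y} (h : sepFst p = sepFst q) (h' : sepSnd p = sepSnd q) : p = q :=
  Subtype.ext (Prod.ext h h')

theorem sep_fresh (p : sep X Y) : Fresh (𝔸 := 𝔸) (sepFst p) (sepSnd p) := p.2

theorem fresh_sep {a : 𝔸} {p : sep X Y} (h : Fresh (𝔸 := 𝔸) a (sepFst p))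
    (h' : Fresh (𝔸 := 𝔸) a (sepSnd p)) : Fresh (𝔸 := 𝔸) a p := by
  rw [fresh_name_iff] at h h' ⊢
  obtain ⟨S, hS, ha⟩ := h
  obtain ⟨T, hT, ha'⟩ := h'
  refine ⟨S ∪ T, fun π hπ => sep_ext ?_ ?_, by simp [ha, ha']⟩
  · rw [Sub01.hom_smul]
    exact hS π fun b hb => hπ (by simp_all)
  · rw [Sub01.hom_smul]
    exact hT π fun b hb => hπ (by simp_all)

/-- Pairs in the separated product. -/
def sepMk (x : X) (y : Y) (h : Fresh (𝔸 := 𝔸) x y) : sep X Y := ⟨(x, y), h⟩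

theorem supports_of_injective {m : X ⟶ Y} (hm : Function.Injective m) {S : Set 𝔸} {x : X}
    (h : MulAction.Supports (FinPerm 𝔸) S (m x)) : MulAction.Supports (FinPerm 𝔸) S x :=
  fun π hπ => hm (by rw [Sub01.hom_smul, h π hπ])

end Sep

/-- The names among the values of an element of a cube support it and lie in every finite support,
so separation just says that no name is shared. -/
theorem fresh_cube_cube_iff {A B : Finset 𝔸} {f : cube A} {g : cube B} :
    Fresh (𝔸 := 𝔸) f g ↔ ∀ z z' c, cubeVal f z = .inl c → cubeVal g z' ≠ .inl c := by
  constructor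
  · rintro ⟨S, T, hS, hT, hd⟩ z z' c hz hz'
    have h1 : c ∈ S := by
      by_contra h
      exact fresh_cube_iff.1 (fresh_name_iff.2 ⟨S, hS, h⟩) z hz
    have h2 : c ∈ T := by
      by_contra h
      exact fresh_cube_iff.1 (fresh_name_iff.2 ⟨T, hT, h⟩) z' hz'
    exact Finset.disjoint_left.1 hd h1 h2
  · intro h
    obtain ⟨S, hS, hS'⟩ := CubeSet.exists_supports (f : CubeSet A)
    obtain ⟨T, hT, hT'⟩ := CubeSet.exists_supports (g : CubeSet B)
    refine ⟨S, T, hS, hT, Finset.disjoint_left.2 fun c hc hc' => ?_⟩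
    obtain ⟨z, hz⟩ := hS' c hc
    obtain ⟨z', hz'⟩ := hT' c hc'
    exact h z z' c hz hz'

/-! ### The three kinds of elements: open box, total, missing face -/

namespace GenBox

variable (x : GenBox 𝔸)

/-- The domain `⊔_{A,a} ∗ □_B` of a generating open box inclusion. -/
abbrev dom : Sub01 𝔸 := sep (openBox x.i x.A x.a) (cube x.B)

/-- The codomain `□_A ∗ □_B` of a generating open box inclusion. -/
abbrev cod : Sub01 𝔸 := sep (cube x.A) (cube x.B)

/-- The generating open box inclusion. -/
abbrev incl : x.dom ⟶ x.cod := sepMap (openBoxIncl x.i x.A x.a) (𝟙 (cube x.B))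

variable {x}

theorem incl_injective : Function.Injective x.incl := fun _ _ h =>
  sep_ext (Subtype.ext (congrArg (fun p : x.cod => sepFst p) h))
    (congrArg (fun p : x.cod => sepSnd p) h)

/-- Only the separation condition needs an argument: the inclusion of the open box in the cube is
injective and equivariant, so a support in the cube is already a support in the open box. -/
theorem exists_incl_iff {p : x.cod} : (∃ q, x.incl q = p) ↔
    ∃ (z : x.A) (j : Bool), InDom x.i x.A x.a z j ∧ cubeVal (sepFst p) z = .inr j := by
  constructor
  · rintro ⟨q, rfl⟩
    exact (sepFst q).2
  · intro h
    let f : openBox x.i x.A x.a := ⟨sepFst p, h⟩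
    refine ⟨sepMk f (sepSnd p) ?_, rfl⟩
    obtain ⟨S, T, hS, hT, hd⟩ := sep_fresh p
    exact ⟨S, T, supports_of_injective (m := openBoxIncl x.i x.A x.a)
      (fun _ _ h => Subtype.ext h) (x := f) hS, hT, hd⟩

/-- The name `f z`, if there is one, for an element `(f, g)` of `□_A ∗ □_B`. -/
def nameAt (p : x.cod) (z : x.A) : 𝔸 := (cubeVal (sepFst p) z).elim id fun _ => z

/-- All values of `f` are names, for an element `(f, g)` of `□_A ∗ □_B`. -/
def Total (p : x.cod) : Prop := ∀ z, cubeVal (sepFst p) z = .inl (nameAt p z)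

/-- The image of `f`, for an element `(f, g)` of `□_A ∗ □_B` such that `f` is total. -/
def im (p : x.cod) : Finset 𝔸 := Finset.univ.image (nameAt p)

/-- The name `f a`, for an element `(f, g)` of `□_A ∗ □_B` such that `f` is total. -/
def nm (p : x.cod) : 𝔸 := nameAt p ⟨x.a, x.mem⟩

theorem nameAt_eq {p : x.cod} {z : x.A} {c : 𝔸} (h : cubeVal (sepFst p) z = .inl c) :
    nameAt p z = c := by
  rw [nameAt, h]
  rfl

theorem total_of {p : x.cod} {f : x.A → 𝔸} (h : ∀ z, cubeVal (sepFst p) z = .inl (f z)) :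
    Total p ∧ nameAt p = f := by
  have : nameAt p = f := funext fun z => nameAt_eq (h z)
  exact ⟨fun z => by rw [h, this], this⟩

theorem im_congr {y : GenBox 𝔸} {p : x.cod} {p' : y.cod} (e : y.A ≃ x.A)
    (h : ∀ z, nameAt p' z = nameAt p (e z)) : im p' = im p := by
  ext c
  simp only [im, Finset.mem_image, Finset.mem_univ, true_and, h]
  exact e.surjective.exists (p := fun z => nameAt p z = c) |>.symm

theorem Total.nm_mem (p : x.cod) : nm p ∈ im p :=
  Finset.mem_image_of_mem _ (Finset.mem_univ _)

theorem Total.injective {p : x.cod} (hp : Total p) : Function.Injective (nameAt p) :=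
  fun z z' h => cubeVal_injDef _ _ _ _ (hp z) (by rw [hp z', h])

theorem Total.smul {p : x.cod} (hp : Total p) (π : FinPerm 𝔸) :
    Total (π • p) ∧ im (π • p) = π • im p ∧ nm (π • p) = π • nm p := by
  obtain ⟨h1, h2⟩ := total_of (p := π • p) (f := fun z => π • nameAt p z) fun z => by
    rw [Sub01.hom_smul, cubeVal_smul, hp z]
    rfl
  refine ⟨h1, ?_, by rw [nm, h2, nm]⟩
  rw [im, h2, im, Finset.smul_finset_def, Finset.image_image]
  rfl

theorem Total.sub {p : x.cod} (hp : Total p) {d : 𝔸} (hd : d ∉ im p) (j : Bool) :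
    Total (x.cod.sub p d j) ∧ im (x.cod.sub p d j) = im p ∧ nm (x.cod.sub p d j) = nm p := by
  obtain ⟨h1, h2⟩ := total_of (p := x.cod.sub p d j) (f := nameAt p) fun z => by
    rw [Sub01.hom_sub, cubeVal_sub, hp z, subVal, if_neg]
    exact fun e => hd (e ▸ Finset.mem_image_of_mem _ (Finset.mem_univ _))
  exact ⟨h1, by rw [im, h2, im], by rw [nm, h2, nm]⟩

theorem Total.exists_face {p : x.cod} (hp : Total p) {d : 𝔸} {j : Bool}
    (hd : InDom x.i (im p) (nm p) d j) : ∃ q, x.incl q = x.cod.sub p d j := by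
  obtain ⟨hd, hd'⟩ := hd
  simp only [im, Finset.mem_image, Finset.mem_univ, true_and] at hd
  obtain ⟨z, rfl⟩ := hd
  refine exists_incl_iff.2 ⟨z, j, ⟨z.2, fun h => hd' ⟨?_, h.2⟩⟩, ?_⟩
  · exact congrArg (nameAt p) (Subtype.ext h.1)
  · rw [Sub01.hom_sub, cubeVal_sub, hp z]
    simp [subVal]

theorem Total.not_incl {p : x.cod} (hp : Total p) (q : x.dom) : x.incl q ≠ p := fun h => by
  obtain ⟨z, j, -, hz⟩ := exists_incl_iff.1 ⟨q, h⟩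
  rw [hp z] at hz
  simp at hz

/-- The coordinates of a total element are distinct names, so the missing face changes only the
coordinate `a`. The next two lemmas deduce that missing faces are neither in the open box nor total.
-/
theorem Total.val_sub_nm {p : x.cod} (hp : Total p) (z : x.A) :
    cubeVal (sepFst (x.cod.sub p (nm p) x.i)) z =
      if z.1 = x.a then .inr x.i else .inl (nameAt p z) := by
  rw [Sub01.hom_sub, cubeVal_sub, hp z, subVal]
  have : nameAt p z = nm p ↔ z.1 = x.a :=
    (hp.injective.eq_iff (b := ⟨x.a, x.mem⟩)).trans Subtype.ext_iff
  simp only [this]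

theorem Total.sub_nm_not_incl {p : x.cod} (hp : Total p) (q : x.dom) :
    x.incl q ≠ x.cod.sub p (nm p) x.i := fun h => by
  obtain ⟨z, j, hd, hz⟩ := exists_incl_iff.1 ⟨q, h⟩
  rw [hp.val_sub_nm] at hz
  split_ifs at hz with h1
  exact hd.2 ⟨h1, (Sum.inr_injective hz).symm⟩

theorem Total.sub_nm_not_total {p : x.cod} (hp : Total p) : ¬Total (x.cod.sub p (nm p) x.i) :=
  fun h => by
    have := h ⟨x.a, x.mem⟩
    rw [hp.val_sub_nm, if_pos rfl] at this
    simp at this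

theorem Total.fresh_snd {p : x.cod} (hp : Total p) (z : x.A) :
    Fresh (𝔸 := 𝔸) (nameAt p z) (sepSnd p) :=
  fresh_cube_iff.2 fun z' => fresh_cube_cube_iff.1 (sep_fresh p) z z' _ (hp z)

/-- Freshness of `a` and of `b` is witnessed by possibly different supports; `supports_diff`
produces one that avoids both. -/
theorem sw_smul_of_fresh {X : Sub01 𝔸} {a b : 𝔸} {w : X} (ha : Fresh (𝔸 := 𝔸) a w)
    (hb : Fresh (𝔸 := 𝔸) b w) : sw a b • w = w := by
  obtain ⟨S, hS, haS⟩ := fresh_name_iff.1 ha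
  refine supports_diff hS hb _ fun s hs => ?_
  simp only [Finset.coe_erase, Set.mem_sdiff, Set.mem_singleton_iff, Finset.mem_coe] at hs
  exact sw_ne (fun e => haS (e ▸ hs.1)) hs.2

/-- This is `α`-equivalence inside the cube: the missing face retains all data of `p` except the
name at the coordinate `a`, and that name is fresh for the other coordinates and for the second
component. -/
theorem Total.eq_of_sub_nm_eq {p p' : x.cod} (hp : Total p) (hp' : Total p')
    (h : x.cod.sub p (nm p) x.i = x.cod.sub p' (nm p') x.i) :
    p' = sw (nm p) (nm p') • p ∧ (nm p' = nm p ∨ Fresh (𝔸 := 𝔸) (nm p') p) := by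
  have h2 : sepSnd p = sepSnd p' := by
    have := congrArg (fun r : x.cod => sepSnd r) h
    simp only [Sub01.hom_sub] at this
    rwa [(cube x.B).sub_of_fresh _ (nm p) _ (hp.fresh_snd _),
      (cube x.B).sub_of_fresh _ (nm p') _ (hp'.fresh_snd _)] at this
  have hf : Fresh (𝔸 := 𝔸) (nm p') (sepSnd p) := by
    rw [h2]
    exact hp'.fresh_snd _
  have hne : ∀ z : x.A, z.1 ≠ x.a → nameAt p z ≠ nm p ∧ nameAt p z ≠ nm p' ∧
      nameAt p z = nameAt p' z := by
    intro z hz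
    have h1 := congrArg (fun r : x.cod => cubeVal (sepFst r) z) h
    simp only [hp.val_sub_nm, hp'.val_sub_nm, if_neg hz] at h1
    have h1 := Sum.inl_injective h1
    have hz' : z ≠ ⟨x.a, x.mem⟩ := fun e => hz (congrArg Subtype.val e)
    exact ⟨hp.injective.ne hz', h1 ▸ hp'.injective.ne hz', h1⟩
  refine ⟨sep_ext (cubeVal_ext fun z => ?_) ?_, ?_⟩
  · rw [Sub01.hom_smul, cubeVal_smul, hp' z, hp z]
    refine congrArg Sum.inl ?_
    change _ = sw (nm p) (nm p') • nameAt p z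
    by_cases hz : z.1 = x.a
    · obtain rfl : z = ⟨x.a, x.mem⟩ := Subtype.ext hz
      exact (sw_left _ _).symm
    · obtain ⟨h3, h4, h5⟩ := hne z hz
      rw [sw_ne h3 h4, h5]
  · rw [Sub01.hom_smul, ← h2]
    exact (sw_smul_of_fresh (hp.fresh_snd _) hf).symm
  · by_cases he : nm p' = nm p
    · exact .inl he
    refine .inr (fresh_sep (fresh_cube_iff.2 fun z hz => ?_) hf)
    rw [hp z] at hz
    have hz := Sum.inl_injective hz
    by_cases hza : z.1 = x.a
    · obtain rfl : z = ⟨x.a, x.mem⟩ := Subtype.ext hza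
      exact he hz.symm
    · exact (hne z hza).2.1 hz

/-- Every element of `□_A ∗ □_B` is in the open box, or total, or a face of a total element. -/
theorem cod_cases (p : x.cod) : (∃ q, x.incl q = p) ∨ Total p ∨
    ∃ p' : x.cod, Total p' ∧ x.cod.sub p' (nm p') x.i = p := by
  by_cases h : ∃ q, x.incl q = p
  · exact .inl h
  refine .inr ?_
  have h0 := fun z j hd hz => h (exists_incl_iff.2 ⟨z, j, hd, hz⟩)
  have hne : ∀ z : x.A, z.1 ≠ x.a → cubeVal (sepFst p) z = .inl (nameAt p z) := by
    intro z hz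
    cases hv : cubeVal (sepFst p) z with
    | inl c => rw [nameAt_eq hv]
    | inr j => exact (h0 z j ⟨z.2, fun e => hz e.1⟩ hv).elim
  cases hv : cubeVal (sepFst p) ⟨x.a, x.mem⟩ with
  | inl c =>
    refine .inl fun z => ?_
    by_cases hz : z.1 = x.a
    · obtain rfl : z = ⟨x.a, x.mem⟩ := Subtype.ext hz
      rw [nameAt_eq hv, hv]
    · exact hne z hz
  | inr j =>
    have hj : j = x.i := by
      by_contra hj
      exact h0 _ j ⟨x.mem, fun e => hj e.2⟩ hv
    -- The missing face is undone by putting a name `e`, fresh for `p`, at the coordinate `a`.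
    -- Freshness keeps the coordinates injective and the two components separated.
    obtain ⟨S, hS⟩ := x.cod.exists_supports p
    obtain ⟨e, he⟩ := exists_notMem S
    have he := fresh_name_iff.2 ⟨S, hS, he⟩
    have he1 := fresh_cube_iff.1 (Sub01.fresh_hom sepFst he)
    have he2 := fresh_cube_iff.1 (Sub01.fresh_hom sepSnd he)
    let v : x.A → 𝔸 := fun z => if z.1 = x.a then e else nameAt p z
    have hv' : Function.Injective v := by
      intro z z' hzz
      simp only [v] at hzz
      split_ifs at hzz with h1 h2 h2
      · exact Subtype.ext (h1.trans h2.symm)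
      · exact absurd (hzz ▸ hne z' h2) (he1 z')
      · exact absurd (hzz ▸ hne z h1) (he1 z)
      · exact cubeVal_injDef _ _ _ _ (hne z h1) (hzz ▸ hne z' h2)
    let f : cube x.A := (⟨fun z => .inl (v z), injDef_inl hv'⟩ : CubeSet x.A)
    have hf : Fresh (𝔸 := 𝔸) f (sepSnd p) := by
      refine fresh_cube_cube_iff.2 fun z z' c hc => ?_
      have hc : v z = c := Sum.inl_injective hc
      subst hc
      by_cases h1 : z.1 = x.a
      · simp only [v, h1, if_true]
        exact he2 z'
      · simp only [v, h1, if_false]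
        exact fresh_cube_cube_iff.1 (sep_fresh p) z z' _ (hne z h1)
    obtain ⟨ht, hn⟩ := total_of (p := (sepMk f (sepSnd p) hf : x.cod)) (f := v) fun _ => rfl
    refine .inr ⟨_, ht, sep_ext (cubeVal_ext fun z => ?_) ?_⟩
    · rw [ht.val_sub_nm, hn]
      split_ifs with h1
      · obtain rfl : z = ⟨x.a, x.mem⟩ := Subtype.ext h1
        rw [hv, hj]
      · simp only [v, h1, if_false]
        exact (hne z h1).symm
    · rw [Sub01.hom_sub]
      exact (cube x.B).sub_of_fresh _ _ _ (ht.fresh_snd _)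

/-- Maps out of `□_A ∗ □_B` are equal if they agree on the open box and on total elements. -/
theorem cod_hom_ext {U : Sub01 𝔸} {m m' : x.cod ⟶ U} (h : x.incl ≫ m = x.incl ≫ m')
    (h' : ∀ p, Total p → m p = m' p) : m = m' := by
  refine Sub01.hom_ext fun p => ?_
  obtain ⟨q, rfl⟩ | hp | ⟨p', hp', rfl⟩ := cod_cases p
  · exact congrArg (fun t : x.dom ⟶ U => t q) h
  · exact h' p hp
  · rw [Sub01.hom_sub, Sub01.hom_sub, h' p' hp']

/-! ### Filling operators solve lifting problems against the generators -/

section Fill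

variable {U V : Sub01 𝔸} {g : U ⟶ V}

/-- `u` lists the values of `l` at the faces of the total element `p` that lie in the open box. -/
def IsFaces (l : x.dom ⟶ U) (p : x.cod) (u : 𝔸 → Bool → U) : Prop :=
  ∀ d j q, InDom x.i (im p) (nm p) d j → x.incl q = x.cod.sub p d j → u d j = l q

theorem Total.exists_isFaces {p : x.cod} (hp : Total p) (l : x.dom ⟶ U) :
    ∃ u, IsFaces l p u := by
  classical
  -- A default value in `U` is needed off the faces. The face opposite to the missing one always
  -- belongs to the open box, so its image under `l` serves.
  obtain ⟨q₀, -⟩ := hp.exists_face (d := nm p) (j := !x.i) ⟨Total.nm_mem p, by simp⟩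
  refine ⟨fun d j => if h : ∃ q, x.incl q = x.cod.sub p d j then l h.choose else l q₀,
    fun d j q _ hq => ?_⟩
  have h : ∃ q, x.incl q = x.cod.sub p d j := ⟨q, hq⟩
  refine (dif_pos h).trans ?_
  exact congrArg l (incl_injective (h.choose_spec.trans hq.symm))

theorem IsFaces.isOpenBox {l : x.dom ⟶ U} {r : x.cod ⟶ V} (w : l ≫ g = x.incl ≫ r) {p : x.cod}
    (hp : Total p) {u : 𝔸 → Bool → U} (hu : IsFaces l p u) :
    IsOpenBox g x.i (im p) (nm p) u (r p) where
  mem := Total.nm_mem p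
  fresh d j hd := by
    obtain ⟨q, hq⟩ := hp.exists_face hd
    -- A face at `d` is its own substitution instance at `d`; this is what makes its image under `l`
    -- fresh for `d`.
    have : x.dom.sub q d j = q := incl_injective (by
      rw [Sub01.hom_sub, hq, x.cod.sub_of_fresh _ _ _ (x.cod.fresh_sub _ _ _)])
    rw [hu d j q hd hq, ← this]
    exact Sub01.fresh_hom l (x.dom.fresh_sub _ _ _)
  adj d j d' j' hd hd' hne := by
    obtain ⟨q, hq⟩ := hp.exists_face hd
    obtain ⟨q', hq'⟩ := hp.exists_face hd'
    rw [hu d j q hd hq, hu d' j' q' hd' hq', ← Sub01.hom_sub, ← Sub01.hom_sub]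
    refine congrArg l (incl_injective ?_)
    rw [Sub01.hom_sub, Sub01.hom_sub, hq, hq', x.cod.sub_comm _ _ _ _ _ hne]
  lies d j hd := by
    obtain ⟨q, hq⟩ := hp.exists_face hd
    rw [hu d j q hd hq, ← Sub01.comp_apply, w, Sub01.comp_apply, hq, Sub01.hom_sub]

variable (H : KanOp g) (l : x.dom ⟶ U) (r : x.cod ⟶ V)

/-- The filler at a total element. -/
noncomputable def fillTotal (p : x.cod) (hp : Total p) : U :=
  H.fill x.i (im p) (nm p) (hp.exists_isFaces l).choose (r p)

variable {l r} (w : l ≫ g = x.incl ≫ r)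
include w

theorem fillTotal_eq {p : x.cod} (hp : Total p) {u : 𝔸 → Bool → U} (hu : IsFaces l p u) :
    fillTotal H l r p hp = H.fill x.i (im p) (nm p) u (r p) := by
  have h := (hp.exists_isFaces l).choose_spec
  refine H.congr (h.isOpenBox w hp) fun d j hd => ?_
  obtain ⟨q, hq⟩ := hp.exists_face hd
  rw [h d j q hd hq, hu d j q hd hq]

theorem fillTotal_smul {p : x.cod} (hp : Total p) (π : FinPerm 𝔸) (hp' : Total (π • p)) :
    fillTotal H l r (π • p) hp' = π • fillTotal H l r p hp := by
  obtain ⟨-, h1, h2⟩ := hp.smul π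
  obtain ⟨u, hu⟩ := hp.exists_isFaces l
  rw [fillTotal_eq H w hp hu, ← H.perm, ← h1, ← h2, ← Sub01.hom_smul]
  refine fillTotal_eq H w hp' fun d j q hd hq => ?_
  rw [h1, h2, Raw.inDom_smul] at hd
  rw [hu _ j (π⁻¹ • q) hd, Sub01.hom_smul, smul_inv_smul]
  rw [Sub01.hom_smul, hq, x.cod.smul_sub, inv_smul_smul]

/-- Such a `d` occurs at most in the second component, so substituting for it keeps `p` total with
the same directions and substitutes in every face. The claim is then uniformity of the operators. -/
theorem fillTotal_sub {p : x.cod} (hp : Total p) {d : 𝔸} (hd : d ∉ im p) (j : Bool)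
    (hp' : Total (x.cod.sub p d j)) :
    fillTotal H l r (x.cod.sub p d j) hp' = U.sub (fillTotal H l r p hp) d j := by
  obtain ⟨-, h1, h2⟩ := hp.sub hd j
  obtain ⟨u, hu⟩ := hp.exists_isFaces l
  rw [fillTotal_eq H w hp hu, ← H.unif (hu.isOpenBox w hp) d j hd, ← Sub01.hom_sub]
  refine (fillTotal_eq H w hp' (u := fun b k => U.sub (u b k) d j) fun b k q hb hq => ?_).trans
    (by rw [h1, h2])
  rw [h1, h2] at hb
  obtain ⟨q', hq'⟩ := hp.exists_face hb
  refine (congrArg (fun t => U.sub t d j) (hu b k q' hb hq')).trans ?_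
  rw [← Sub01.hom_sub]
  refine congrArg l (incl_injective ?_)
  rw [Sub01.hom_sub, hq', hq, x.cod.sub_comm]
  exact fun e => hd (e ▸ hb.1)

theorem fillTotal_face {p : x.cod} (hp : Total p) {d : 𝔸} {j : Bool}
    (hd : InDom x.i (im p) (nm p) d j) {q : x.dom} (hq : x.incl q = x.cod.sub p d j) :
    U.sub (fillTotal H l r p hp) d j = l q := by
  obtain ⟨u, hu⟩ := hp.exists_isFaces l
  rw [fillTotal_eq H w hp hu, H.face (hu.isOpenBox w hp) d j hd, hu d j q hd hq]

/-- By `Total.eq_of_sub_nm_eq` the elements differ by transposing their bound names, and by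
equivariance so do their fillers. Both names are fresh for the missing face of the first filler, so
the transposition acts trivially there. -/
theorem fillTotal_comp_congr {p p' : x.cod} (hp : Total p) (hp' : Total p')
    (h : x.cod.sub p (nm p) x.i = x.cod.sub p' (nm p') x.i) :
    U.sub (fillTotal H l r p hp) (nm p) x.i = U.sub (fillTotal H l r p' hp') (nm p') x.i := by
  obtain ⟨he, hf⟩ := hp.eq_of_sub_nm_eq hp' h
  have key : ∀ (p'' : x.cod) (hp'' : Total p'') (π : FinPerm 𝔸), p'' = π • p →
      fillTotal H l r p'' hp'' = π • fillTotal H l r p hp := by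
    rintro _ hp'' π rfl
    exact fillTotal_smul H w hp π hp''
  have hs : U.sub (fillTotal H l r p' hp') (nm p') x.i =
      sw (nm p) (nm p') • U.sub (fillTotal H l r p hp) (nm p) x.i := by
    rw [key p' hp' _ he, U.smul_sub, sw_left]
  rw [hs]
  refine (sw_smul_of_fresh (U.fresh_sub _ _ _) ?_).symm
  rcases hf with hf | hf
  · rw [hf]
    exact U.fresh_sub _ _ _
  · obtain ⟨S, hS⟩ := (fresh_iff_sw x.cod.exists_supports).1 hf
    by_cases hn : nm p' = nm p
    · rw [hn]
      exact U.fresh_sub _ _ _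
    refine (fresh_iff_sw U.exists_supports).2 ⟨insert (nm p) S, fun c hc => ?_⟩
    simp only [Finset.mem_insert, not_or] at hc
    rw [U.smul_sub, ← key p hp _ (hS c hc.2).symm, sw_ne (Ne.symm hn) (Ne.symm hc.1)]

omit w

variable (l r)

/-- The graph of the map `fillCube`. -/
inductive FillRel : x.cod → U → Prop
  | box {p : x.cod} (q : x.dom) (e : x.incl q = p) : FillRel p (l q)
  | total {p : x.cod} (hp : Total p) : FillRel p (fillTotal H l r p hp)
  | face {p' : x.cod} (p : x.cod) (hp : Total p) (e : x.cod.sub p (nm p) x.i = p') :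
      FillRel p' (U.sub (fillTotal H l r p hp) (nm p) x.i)

theorem FillRel.exists (p : x.cod) : ∃ v, FillRel H l r p v := by
  obtain ⟨q, rfl⟩ | hp | ⟨p', hp', rfl⟩ := cod_cases p
  · exact ⟨_, .box q rfl⟩
  · exact ⟨_, .total hp⟩
  · exact ⟨_, .face p' hp' rfl⟩

variable {H l r}

/-- The three clauses concern disjoint kinds of elements. Within a clause, the value is determined
by injectivity of the inclusion, by definition, and by `fillTotal_comp_congr` respectively. -/
theorem FillRel.unique (w : l ≫ g = x.incl ≫ r) {p : x.cod} {v v' : U} (h : FillRel H l r p v)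
    (h' : FillRel H l r p v') : v = v' := by
  cases h with
  | box q e =>
    cases h' with
    | box q' e' => rw [incl_injective (e.trans e'.symm)]
    | total hp => exact (hp.not_incl q e).elim
    | face _ hp e' => exact (hp.sub_nm_not_incl q (e.trans e'.symm)).elim
  | total hp =>
    cases h' with
    | box q' e' => exact (hp.not_incl q' e').elim
    | total hp' => rfl
    | face _ hp' e' => exact (hp'.sub_nm_not_total (e' ▸ hp)).elim
  | face _ hp e =>
    cases h' with
    | box q' e' => exact (hp.sub_nm_not_incl q' (e'.trans e.symm)).elim
    | total hp' => exact (hp.sub_nm_not_total (e ▸ hp')).elim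
    | face _ hp' e' => exact fillTotal_comp_congr H w hp hp' (e.trans e'.symm)

theorem FillRel.smul (w : l ≫ g = x.incl ≫ r) {p : x.cod} {v : U} (h : FillRel H l r p v)
    (π : FinPerm 𝔸) : FillRel H l r (π • p) (π • v) := by
  cases h with
  | box q e =>
    rw [← Sub01.hom_smul]
    exact .box _ (by rw [Sub01.hom_smul, e])
  | total hp =>
    rw [← fillTotal_smul H w hp π (hp.smul π).1]
    exact .total _
  | face p hp e =>
    obtain ⟨h1, -, h2⟩ := hp.smul π
    rw [U.smul_sub, ← fillTotal_smul H w hp π h1, ← e, x.cod.smul_sub, ← h2]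
    exact .face _ _ rfl

theorem FillRel.sub (w : l ≫ g = x.incl ≫ r) {p : x.cod} {v : U} (h : FillRel H l r p v)
    (d : 𝔸) (j : Bool) : FillRel H l r (x.cod.sub p d j) (U.sub v d j) := by
  have hbox : ∀ (q : x.dom) d j, FillRel H l r (x.cod.sub (x.incl q) d j) (U.sub (l q) d j) := by
    intro q d j
    rw [← Sub01.hom_sub, ← Sub01.hom_sub]
    exact .box _ rfl
  cases h with
  | box q e => exact e ▸ hbox q d j
  | total hp =>
    by_cases hd : d ∈ im p
    · by_cases hd' : d = nm p ∧ j = x.i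
      · rw [hd'.1, hd'.2]
        exact .face p hp rfl
      · obtain ⟨q, hq⟩ := hp.exists_face ⟨hd, hd'⟩
        rw [fillTotal_face H w hp ⟨hd, hd'⟩ hq]
        exact .box q hq
    · rw [← fillTotal_sub H w hp hd j (hp.sub hd j).1]
      exact .total _
  | face p hp e =>
    subst e
    by_cases hd' : nm p = d
    · rw [U.sub_of_fresh _ d j (hd' ▸ U.fresh_sub _ _ _),
        x.cod.sub_of_fresh _ d j (hd' ▸ x.cod.fresh_sub _ _ _)]
      exact .face p hp rfl
    -- Substituting at `d` before passing to the missing face leaves a face in the open box if `d`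
    -- is a direction of `p`, and otherwise a total element with the same bound name.
    rw [U.sub_comm _ _ _ _ _ hd', x.cod.sub_comm _ _ _ _ _ hd']
    by_cases hd : d ∈ im p
    · have hd : InDom x.i (im p) (nm p) d j := ⟨hd, fun e => hd' e.1.symm⟩
      obtain ⟨q, hq⟩ := hp.exists_face hd
      rw [fillTotal_face H w hp hd hq, ← hq]
      exact hbox q _ _
    · obtain ⟨h1, -, h2⟩ := hp.sub hd j
      rw [← fillTotal_sub H w hp hd j h1, ← h2]
      exact .face _ h1 rfl

variable (H l r)

/-- The filler of a square from a generating open box inclusion to a map with Kan filling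
operators. -/
noncomputable def fillCube (w : l ≫ g = x.incl ≫ r) : x.cod ⟶ U where
  toFun p := (FillRel.exists H l r p).choose
  map_smul π p := (FillRel.exists H l r (π • p)).choose_spec.unique w
    ((FillRel.exists H l r p).choose_spec.smul w π)
  map_sub p d j := (FillRel.exists H l r (x.cod.sub p d j)).choose_spec.unique w
    ((FillRel.exists H l r p).choose_spec.sub w d j)

variable (w : l ≫ g = x.incl ≫ r)

theorem incl_fillCube : x.incl ≫ fillCube H l r w = l :=
  Sub01.hom_ext fun q => (FillRel.exists H l r (x.incl q)).choose_spec.unique w (.box q rfl)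

variable {l r}

theorem fillCube_total {p : x.cod} (hp : Total p) {u : 𝔸 → Bool → U} (hu : IsFaces l p u) :
    fillCube H l r w p = H.fill x.i (im p) (nm p) u (r p) :=
  ((FillRel.exists H l r p).choose_spec.unique w (.total hp)).trans (fillTotal_eq H w hp hu)

theorem fillCube_unique {m : x.cod ⟶ U} (hm : x.incl ≫ m = l)
    (hm' : ∀ p u, Total p → IsFaces l p u → m p = H.fill x.i (im p) (nm p) u (r p)) :
    m = fillCube H l r w := by
  refine cod_hom_ext (hm.trans (incl_fillCube H l r w).symm) fun p hp => ?_
  obtain ⟨u, hu⟩ := hp.exists_isFaces l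
  rw [fillCube_total H w hp hu, hm' p u hp hu]

theorem fillCube_comp : fillCube H l r w ≫ g = r := by
  refine cod_hom_ext ?_ fun p hp => ?_
  · rw [← Category.assoc, incl_fillCube, w]
  · obtain ⟨u, hu⟩ := hp.exists_isFaces l
    rw [Sub01.comp_apply, fillCube_total H w hp hu]
    exact H.lies (hu.isOpenBox w hp)

/-- Naturality in the operators. Both sides agree on the open box, and at a total element the claim
is exactly that `(m, n)` preserves the filler of its box of faces. -/
theorem fillCube_pres {U' V' : Sub01 𝔸} {g' : U' ⟶ V'} (H' : KanOp g') {m : U ⟶ U'} {n : V ⟶ V'}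
    (h : Pres H H' m n) (w' : (l ≫ m) ≫ g' = x.incl ≫ r ≫ n) :
    fillCube H l r w ≫ m = fillCube H' (l ≫ m) (r ≫ n) w' := by
  refine cod_hom_ext ?_ fun p hp => ?_
  · rw [incl_fillCube, ← Category.assoc, incl_fillCube]
  · obtain ⟨u, hu⟩ := hp.exists_isFaces l
    rw [Sub01.comp_apply, fillCube_total H w hp hu, h.out (hu.isOpenBox w hp)]
    exact (fillCube_total H' w' hp fun d j q hd hq => congrArg m (hu d j q hd hq)).symm

end Fill

/-! ### Naturality of the solutions in `𝒥` -/

section Map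

variable {y : GenBox 𝔸} (m : x ⟶ y)

/-- The map of domains given by a morphism of `𝒥`. -/
abbrev domMap : x.dom ⟶ y.dom :=
  sepMap (openBoxMap x.mem y.mem m.eq m.f m.map) (cubeMap m.g m.inj)

/-- The map of codomains given by a morphism of `𝒥`. -/
abbrev codMap : x.cod ⟶ y.cod :=
  sepMap (cubeMap (fun b => .inl (m.f b)) (injDef_inl m.f.injective)) (cubeMap m.g m.inj)

theorem domMap_incl : domMap m ≫ y.incl = x.incl ≫ codMap m := rfl

/-- A morphism of `𝒥` only reindexes the first component, by a bijection that respects the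
distinguished coordinate. Hence it preserves the set of directions and the bound name. -/
theorem Total.codMap {p : x.cod} (hp : Total p) :
    Total (codMap m p) ∧ im (codMap m p) = im p ∧ nm (codMap m p) = nm p := by
  obtain ⟨h1, h2⟩ := total_of (p := GenBox.codMap m p) (f := fun z => nameAt p (m.f z))
    fun z => hp (m.f z)
  refine ⟨h1, im_congr m.f fun z => by rw [h2], ?_⟩
  rw [nm, h2]
  exact congrArg (nameAt p) m.map

/-- The filler at a total element depends only on `i`, its directions, its bound name, the values at
its faces and the value of `r`. None of these changes along `codMap m`. -/
theorem fillCube_map {U V : Sub01 𝔸} {g : U ⟶ V} (H : KanOp g) {l : y.dom ⟶ U} {r : y.cod ⟶ V}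
    (w : l ≫ g = y.incl ≫ r) (w' : (domMap m ≫ l) ≫ g = x.incl ≫ codMap m ≫ r) :
    fillCube H (domMap m ≫ l) (codMap m ≫ r) w' = codMap m ≫ fillCube H l r w := by
  refine cod_hom_ext ?_ fun p hp => ?_
  · rw [incl_fillCube, ← Category.assoc, ← domMap_incl, Category.assoc, incl_fillCube]
  · obtain ⟨h1, h2, h3⟩ := hp.codMap m
    obtain ⟨u, hu⟩ := h1.exists_isFaces l
    rw [Sub01.comp_apply, fillCube_total H w h1 hu, h2, h3, ← m.eq]
    refine fillCube_total H w' hp fun d j q hd hq => ?_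
    refine hu d j (domMap m q) (by rwa [h2, h3, ← m.eq]) ?_
    rw [← Sub01.hom_sub, ← hq]
    rfl

end Map

end GenBox

end Generators

/-! ### Open boxes as squares out of generators -/

section Classify

variable {𝔸 : Type u} [DecidableEq 𝔸] [Infinite 𝔸]

/-- The restriction map `□_Z ⟶ □_A` for `A ⊆ Z`. -/
def cubeRestrict {A Z : Finset 𝔸} (h : A ⊆ Z) : cube Z ⟶ cube A :=
  cubeMap (fun z => .inl ⟨z.1, h z.2⟩)
    (injDef_inl fun _ _ e => Subtype.ext (congrArg (fun t => t.1) e))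

/-- The face map `σ ↦ σ(b := j)`, where `b` stands for the coordinate, on `□_Z`. -/
def cubeFace {Z : Finset 𝔸} (b : 𝔸) (j : Bool) : cube Z ⟶ cube Z :=
  cubeMap (fun z => if z.1 = b then .inr j else .inl z) fun z z' c h h' => by
    dsimp only at h h'
    split_ifs at h h'
    exact (Sum.inl_injective h).trans (Sum.inl_injective h').symm

theorem cubeVal_cubeFace {Z : Finset 𝔸} (b : 𝔸) (j : Bool) (σ : cube Z) (z : Z) :
    cubeVal (cubeFace b j σ) z = if z.1 = b then .inr j else cubeVal σ z := by
  change (if z.1 = b then Sum.inr j else Sum.inl z : Z ⊕ Bool).elim (cubeVal σ) Sum.inr = _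
  split_ifs <;> rfl

theorem cubeFace_eq {Z : Finset 𝔸} {b : Z} {j : Bool} {σ : cube Z} (h : cubeVal σ b = .inr j) :
    cubeFace b.1 j σ = σ := by
  refine cubeVal_ext fun z => ?_
  rw [cubeVal_cubeFace]
  split_ifs with hz
  · rw [← h, Subtype.ext hz]
  · rfl

theorem cubeFace_id {Z : Finset 𝔸} (b : 𝔸) (j : Bool) :
    cubeFace b j (cubeId Z) = (cube Z).sub (cubeId Z) b j := by
  refine cubeVal_ext fun z => ?_
  rw [cubeVal_cubeFace, cubeVal_sub]
  rfl

/-- The face map followed by the map classifying `y` classifies `y(b := j)`, and an element with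
value `j` at `b` is fixed by the face map. So on such elements only the face of `y` matters. -/
theorem yonVal_sub {Z : Finset 𝔸} {Y : Sub01 𝔸} {y : Y}
    (hy : MulAction.Supports (FinPerm 𝔸) (Z : Set 𝔸) y) {b : Z} {j : Bool} {σ : cube Z}
    (h : cubeVal σ b = .inr j) : yonVal (Y.sub y b j) σ = yonVal y σ := by
  have : yon (Y.sub y b j) (Y.supports_sub hy _ _) = cubeFace b.1 j ≫ yon y hy := by
    refine cube_hom_ext ?_
    rw [yon_id, Sub01.comp_apply, cubeFace_id, Sub01.hom_sub, yon_id]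
  exact (congrArg (fun m : cube Z ⟶ Y => m σ) this).trans (congrArg (yonVal y) (cubeFace_eq h))

namespace GenBox

variable {x : GenBox 𝔸}

/-! ### The generic element of `□_A ∗ □_B` for disjoint `A` and `B` -/

section Generic

variable (hx : Disjoint x.A x.B)

/-- The map `□_{A ∪ B} ⟶ □_A ∗ □_B` for disjoint `A` and `B`. -/
def split : cube (x.A ∪ x.B) ⟶ x.cod where
  toFun σ := sepMk
    (cubeRestrict Finset.subset_union_left σ) (cubeRestrict Finset.subset_union_right σ)
    (fresh_cube_cube_iff.2 fun z z' c hz hz' => Finset.disjoint_left.1 hx z.2 (by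
      have : z.1 = z'.1 := congrArg Subtype.val (cubeVal_injDef σ _ _ c hz hz')
      exact this ▸ z'.2))
  map_smul π σ :=
    sep_ext (Sub01.hom_smul (cubeRestrict Finset.subset_union_left) π σ)
      (Sub01.hom_smul (cubeRestrict Finset.subset_union_right) π σ)
  map_sub σ a i :=
    sep_ext (Sub01.hom_sub (cubeRestrict Finset.subset_union_left) σ a i)
      (Sub01.hom_sub (cubeRestrict Finset.subset_union_right) σ a i)

theorem cubeVal_split_fst (σ : cube (x.A ∪ x.B)) (z : x.A) : cubeVal (sepFst (split hx σ)) z =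
    cubeVal σ ⟨z.1, Finset.mem_union_left _ z.2⟩ := rfl

theorem cubeVal_split_snd (σ : cube (x.A ∪ x.B)) (z : x.B) : cubeVal (sepSnd (split hx σ)) z =
    cubeVal σ ⟨z.1, Finset.mem_union_right _ z.2⟩ := rfl

/-- The values of the amalgamation of `f` and `g`, for an element `(f, g)` of `□_A ∗ □_B`. -/
def joinVal (p : x.cod) (z : (x.A ∪ x.B : Finset 𝔸)) : 𝔸 ⊕ Bool :=
  if hz : z.1 ∈ x.A then cubeVal (sepFst p) ⟨z.1, hz⟩
  else cubeVal (sepSnd p) ⟨z.1, (Finset.mem_union.1 z.2).resolve_left hz⟩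

theorem joinVal_injDef (p : x.cod) : InjDef (joinVal p) := by
  intro z z' c h h'
  unfold joinVal at h h'
  refine Subtype.ext ?_
  split_ifs at h h' with h1 h2 h2
  · exact congrArg (fun t => t.1) (cubeVal_injDef _ _ _ _ h h')
  · exact (fresh_cube_cube_iff.1 (sep_fresh p) _ _ _ h h').elim
  · exact (fresh_cube_cube_iff.1 (sep_fresh p) _ _ _ h' h).elim
  · exact congrArg (fun t => t.1) (cubeVal_injDef _ _ _ _ h h')

/-- The map `□_A ∗ □_B ⟶ □_{A ∪ B}`. -/
def join : x.cod ⟶ cube (x.A ∪ x.B) where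
  toFun p := (⟨joinVal p, joinVal_injDef p⟩ : CubeSet (x.A ∪ x.B))
  map_smul π p := cubeVal_ext fun z => by
    change joinVal (π • p) z = (joinVal p z).map _ _
    unfold joinVal
    split_ifs
    · rw [Sub01.hom_smul, cubeVal_smul]
    · rw [Sub01.hom_smul, cubeVal_smul]
  map_sub p a i := cubeVal_ext fun z => by
    change joinVal (x.cod.sub p a i) z = subVal a i (joinVal p z)
    unfold joinVal
    split_ifs
    · rw [Sub01.hom_sub, cubeVal_sub]
    · rw [Sub01.hom_sub, cubeVal_sub]

theorem cubeVal_join_of_mem (p : x.cod) {z : (x.A ∪ x.B : Finset 𝔸)} (hz : z.1 ∈ x.A) :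
    cubeVal (join p) z = cubeVal (sepFst p) ⟨z.1, hz⟩ := dif_pos hz

theorem cubeVal_join_of_notMem (p : x.cod) {z : (x.A ∪ x.B : Finset 𝔸)} (hz : z.1 ∉ x.A) :
    cubeVal (join p) z =
      cubeVal (sepSnd p) ⟨z.1, (Finset.mem_union.1 z.2).resolve_left hz⟩ := dif_neg hz

/-- This exhibits `□_A ∗ □_B` as a retract of `□_{A ∪ B}`. Together with `join_gen` it suffices to
transfer the Yoneda lemma to the separated product. -/
theorem split_join (p : x.cod) : split hx (join p) = p := by
  refine sep_ext (cubeVal_ext fun z => ?_) (cubeVal_ext fun z => ?_)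
  · rw [cubeVal_split_fst, cubeVal_join_of_mem p z.2]
  · rw [cubeVal_split_snd, cubeVal_join_of_notMem p (Finset.disjoint_right.1 hx z.2)]

/-- The generic element of `□_A ∗ □_B` for disjoint `A` and `B`. -/
def gen : x.cod := split hx (cubeId _)

theorem join_gen : join (gen hx) = cubeId _ := by
  refine cubeVal_ext fun z => ?_
  by_cases hz : z.1 ∈ x.A
  · rw [cubeVal_join_of_mem _ hz]
    rfl
  · rw [cubeVal_join_of_notMem _ hz]
    rfl

theorem total_gen : Total (gen hx) ∧ im (gen hx) = x.A ∧ nm (gen hx) = x.a := by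
  obtain ⟨h1, h2⟩ := total_of (p := gen hx) (f := fun z => z.1) fun _ => rfl
  refine ⟨h1, ?_, by rw [nm, h2]⟩
  rw [im, h2]
  ext c
  simp

theorem cod_hom_ext_gen {V : Sub01 𝔸} {m m' : x.cod ⟶ V} (h : m (gen hx) = m' (gen hx)) :
    m = m' := by
  have : split hx ≫ m = split hx ≫ m' := cube_hom_ext h
  refine Sub01.hom_ext fun p => ?_
  rw [← split_join hx p]
  exact congrArg (fun t : cube (x.A ∪ x.B) ⟶ V => t (join p)) this

/-- A map to `□_A ∗ □_B` with values in the open box. -/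
noncomputable def domLift {W : Sub01 𝔸} (m : W ⟶ x.cod) (h : ∀ w, ∃ q, x.incl q = m w) :
    W ⟶ x.dom where
  toFun w := (h w).choose
  map_smul π w := incl_injective 
    ((h (π • w)).choose_spec.trans (by rw [Sub01.hom_smul, Sub01.hom_smul, (h w).choose_spec]))
  map_sub w a i := incl_injective 
    ((h (W.sub w a i)).choose_spec.trans (by rw [Sub01.hom_sub, Sub01.hom_sub, (h w).choose_spec]))

theorem domLift_incl {W : Sub01 𝔸} (m : W ⟶ x.cod) (h : ∀ w, ∃ q, x.incl q = m w) (w : W) :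
    x.incl (domLift m h w) = m w := (h w).choose_spec

/-- The open box is covered by its faces `b = j`. Each of these is the image of `□_{A ∪ B}` under a
face map, so it is generated by the corresponding face of the generic element. -/
theorem dom_hom_ext_gen {U : Sub01 𝔸} {m m' : x.dom ⟶ U}
    (h : ∀ b j q, InDom x.i x.A x.a b j → x.incl q = x.cod.sub (gen hx) b j → m q = m' q) :
    m = m' := by
  refine Sub01.hom_ext fun q => ?_
  obtain ⟨b, j, hb, hv⟩ := exists_incl_iff.1 ⟨q, rfl⟩
  let F : cube (x.A ∪ x.B) ⟶ x.dom := domLift (cubeFace b.1 j ≫ split hx) fun σ =>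
    exists_incl_iff.2 ⟨b, j, hb, by
      rw [Sub01.comp_apply, cubeVal_split_fst, cubeVal_cubeFace, if_pos rfl]⟩
  have hF : F ≫ m = F ≫ m' := by
    refine cube_hom_ext (h b j _ hb ?_)
    rw [domLift_incl, Sub01.comp_apply, cubeFace_id, Sub01.hom_sub]
    rfl
  have hq : F (join (x.incl q)) = q := incl_injective (by
    rw [domLift_incl, Sub01.comp_apply,
      cubeFace_eq (b := ⟨b.1, Finset.mem_union_left _ b.2⟩), split_join]
    rw [cubeVal_join_of_mem _ b.2, hv])
  rw [← hq]
  exact congrArg (fun t : cube (x.A ∪ x.B) ⟶ U => t (join (x.incl q))) hF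

variable {U V : Sub01 𝔸} {g : U ⟶ V} {u : 𝔸 → Bool → U} {y : V}

/-- On the face `b = j` the map has to classify `u b j`. These maps glue because, where two faces
meet, `yonVal_sub` rewrites both values in terms of the common face given by the adjacency
condition. -/
theorem exists_domMap (h : IsOpenBox g x.i x.A x.a u y)
    (hu : ∀ b j, InDom x.i x.A x.a b j →
      MulAction.Supports (FinPerm 𝔸) ((x.A ∪ x.B : Finset 𝔸) : Set 𝔸) (u b j)) :
    ∃ l : x.dom ⟶ U, ∀ b j q, InDom x.i x.A x.a b j → x.incl q = x.cod.sub (gen hx) b j →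
      l q = u b j := by
  have hbox : ∀ q : x.dom, ∃ (z : x.A) (j : Bool),
      InDom x.i x.A x.a z j ∧ cubeVal (sepFst (x.incl q)) z = .inr j :=
    fun q => exists_incl_iff.1 ⟨q, rfl⟩
  -- `B q` and `J q` name an arbitrary face containing `q`; `key` shows that the value does not
  -- depend on the choice, which then yields equivariance and compatibility with substitution.
  choose B J hB hJ using hbox
  have key : ∀ (q : x.dom) (b : x.A) (j : Bool), InDom x.i x.A x.a b j →
      cubeVal (sepFst (x.incl q)) b = .inr j →
      yonVal (u (B q) (J q)) (join (x.incl q)) = yonVal (u b j) (join (x.incl q)) := by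
    intro q b j hb hj
    have hv : ∀ (b : x.A) j, cubeVal (sepFst (x.incl q)) b = .inr j →
        cubeVal (join (x.incl q)) ⟨b.1, Finset.mem_union_left _ b.2⟩ = .inr j := fun b j h => by
      rw [cubeVal_join_of_mem _ b.2, h]
    by_cases e : B q = b
    · subst e
      rw [Sum.inr_injective ((hJ q).symm.trans hj)]
    · have e' : (B q).1 ≠ b.1 := fun h => e (Subtype.ext h)
      rw [← yonVal_sub (hu _ _ (hB q)) (hv b j hj), ← yonVal_sub (hu _ _ hb) (hv _ _ (hJ q)),
        h.adj _ _ _ _ (hB q) hb e']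
  refine ⟨⟨fun q => yonVal (u (B q) (J q)) (join (x.incl q)), fun π q => ?_, fun q a i => ?_⟩,
    fun b j q hb hq => ?_⟩
  · rw [key (π • q) (B q) (J q) (hB q), Sub01.hom_smul, Sub01.hom_smul]
    · exact Sub01.hom_smul (yon _ (hu _ _ (hB q))) π _
    · rw [Sub01.hom_smul, Sub01.hom_smul, cubeVal_smul, hJ]
      rfl
  · rw [key (x.dom.sub q a i) (B q) (J q) (hB q), Sub01.hom_sub, Sub01.hom_sub]
    · exact Sub01.hom_sub (yon _ (hu _ _ (hB q))) _ a i
    · rw [Sub01.hom_sub, Sub01.hom_sub, cubeVal_sub, hJ]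
      rfl
  · have hv : cubeVal (sepFst (x.incl q)) ⟨b, hb.1⟩ = .inr j := by
      rw [hq, Sub01.hom_sub, cubeVal_sub]
      exact if_pos rfl
    -- At the generic face the value is `u(b, j)(b := j)`, which is `u(b, j)` by the freshness
    -- condition on open boxes.
    refine (key q ⟨b, hb.1⟩ j hb hv).trans ?_
    rw [hq, Sub01.hom_sub, join_gen]
    refine (Sub01.hom_sub (yon _ (hu _ _ hb)) _ b j).trans ?_
    rw [yon_id, U.sub_of_fresh _ _ _ (h.fresh b j hb)]

end Generic

/-- The element `p` of `□_A ∗ □_B` is total, and the square `(l, r)` sends it and its faces to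
the open box `(u, y)`. -/
structure Represents {U V : Sub01 𝔸} (l : x.dom ⟶ U) (r : x.cod ⟶ V) (p : x.cod) (i : Bool)
    (A : Finset 𝔸) (a : 𝔸) (u : 𝔸 → Bool → U) (y : V) : Prop where
  total : Total p
  i_eq : x.i = i
  im_eq : im p = A
  nm_eq : nm p = a
  right : r p = y
  left : ∀ b j q, InDom i A a b j → x.incl q = x.cod.sub p b j → l q = u b j

/-! ### Presenting open boxes by squares -/

section Represents

variable {U V : Sub01 𝔸} {g : U ⟶ V} {i : Bool} {A : Finset 𝔸} {a : 𝔸} {u : 𝔸 → Bool → U} {y : V}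

/-- Take `B` to contain all names outside `A` from chosen supports of `y` and of the faces. Then `A
∪ B` supports all the data, and the box is represented at the generic element. -/
theorem exists_represents (h : IsOpenBox g i A a u y) : ∃ (x : GenBox 𝔸) (l : x.dom ⟶ U)
    (r : x.cod ⟶ V) (p : x.cod), l ≫ g = x.incl ≫ r ∧ Represents l r p i A a u y := by
  choose S hS using fun b j => U.exists_supports (u b j)
  obtain ⟨T, hT⟩ := V.exists_supports y
  let x : GenBox 𝔸 := ⟨i, A, a, h.mem, (T ∪ A.biUnion fun b => S b false ∪ S b true) \ A⟩
  have hx : Disjoint x.A x.B := Finset.disjoint_sdiff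
  have hxx : x.A ∪ x.B = A ∪ (T ∪ A.biUnion fun b => S b false ∪ S b true) :=
    Finset.union_sdiff_self_eq_union
  have hy : MulAction.Supports (FinPerm 𝔸) ((x.A ∪ x.B : Finset 𝔸) : Set 𝔸) y := by
    rw [hxx]
    exact hT.mono fun t ht => by simp_all
  obtain ⟨l, hl⟩ := exists_domMap hx (u := u) (y := y) (g := g) h fun b j hb => by
    rw [hxx]
    refine (hS b j).mono fun t ht => ?_
    simp only [Finset.coe_union, Finset.coe_biUnion, Set.mem_union, Set.mem_iUnion]
    refine .inr (.inr ⟨b, hb.1, ?_⟩)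
    cases j
    · exact .inl ht
    · exact .inr ht
  have hr : (join ≫ yon y hy) (gen hx) = y := by rw [Sub01.comp_apply, join_gen, yon_id]
  obtain ⟨h1, h2, h3⟩ := total_gen hx
  refine ⟨x, l, join ≫ yon y hy, gen hx, dom_hom_ext_gen hx fun b j q hb hq => ?_,
    h1, rfl, h2, h3, hr, hl⟩
  rw [Sub01.comp_apply, hl b j q hb hq, Sub01.comp_apply, hq, Sub01.hom_sub, hr]
  exact h.lies b j hb

/-- The coordinates of `p` are themselves a morphism of `𝒥`: a total first component is a bijection
onto its image, and the second component is an injective-where-defined map to `y.B ⊕ 2`. -/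
theorem exists_codMap_gen {p : x.cod} (hp : Total p) {y : GenBox 𝔸} (hy : Disjoint y.A y.B)
    (hi : y.i = x.i) (hA : y.A = im p) (ha : y.a = nm p)
    (hB : ∀ z c, cubeVal (sepSnd p) z = .inl c → c ∈ y.B) :
    ∃ m : y ⟶ x, codMap m (gen hy) = p := by
  have hg : ∀ z : x.B, ∃ v : y.B ⊕ Bool, v.map Subtype.val id = cubeVal (sepSnd p) z := by
    intro z
    cases hz : cubeVal (sepSnd p) z with
    | inl c => exact ⟨.inl ⟨c, hB z c hz⟩, rfl⟩
    | inr j => exact ⟨.inr j, rfl⟩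
  choose G hG using hg
  have hmem : ∀ z : x.A, nameAt p z ∈ y.A := fun z =>
    hA ▸ Finset.mem_image_of_mem _ (Finset.mem_univ _)
  let f : x.A ≃ y.A := Equiv.ofBijective (fun z => ⟨nameAt p z, hmem z⟩)
    ⟨fun z z' h => hp.injective (congrArg Subtype.val h), fun c => by
      have : c.1 ∈ im p := hA.subst (motive := fun s => c.1 ∈ s) c.2
      rw [im, Finset.mem_image] at this
      obtain ⟨z, -, hz⟩ := this
      exact ⟨z, Subtype.ext hz⟩⟩
  let m : Hom y x := ⟨hi, f, Subtype.ext ha.symm, G, fun z z' c h h' => by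
    refine cubeVal_injDef (sepSnd p) z z' c ?_ ?_
    · rw [← hG, h]
      rfl
    · rw [← hG, h']
      rfl⟩
  refine ⟨m, sep_ext (cubeVal_ext fun z => (hp z).symm) (cubeVal_ext fun z => ?_)⟩
  rw [← hG z]
  change (G z).elim (cubeVal (sepSnd (gen hy))) Sum.inr = _
  cases G z <;> rfl

theorem Represents.congr {l : x.dom ⟶ U} {r : x.cod ⟶ V} {p : x.cod}
    (h : Represents l r p i A a u y) {u' : 𝔸 → Bool → U}
    (e : ∀ b j, InDom i A a b j → u b j = u' b j) : Represents l r p i A a u' y :=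
  { h with left := fun b j q hb hq => (h.left b j q hb hq).trans (e b j hb) }

/-- One square represents a whole orbit of boxes. With `Represents.sub` below, this reduces
equivariance and uniformity of the induced operators to the fact that a diagonal filler is a
morphism. -/
theorem Represents.smul {l : x.dom ⟶ U} {r : x.cod ⟶ V} {p : x.cod}
    (h : Represents l r p i A a u y) (π : FinPerm 𝔸) :
    Represents l r (π • p) i (π • A) (π • a) (fun b j => π • u (π⁻¹ • b) j) (π • y) := by
  obtain ⟨h1, h2, h3⟩ := h.total.smul π
  refine ⟨h1, h.i_eq, by rw [h2, h.im_eq], by rw [h3, h.nm_eq], by rw [Sub01.hom_smul, h.right],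
    fun b j q hb hq => ?_⟩
  rw [← h.left _ j (π⁻¹ • q) (Raw.inDom_smul.1 hb), Sub01.hom_smul, smul_inv_smul]
  rw [Sub01.hom_smul, hq, x.cod.smul_sub, inv_smul_smul]

theorem Represents.exists_face {l : x.dom ⟶ U} {r : x.cod ⟶ V} {p : x.cod}
    (h : Represents l r p i A a u y) {b : 𝔸} {j : Bool} (hb : InDom i A a b j) :
    ∃ q, x.incl q = x.cod.sub p b j ∧ l q = u b j := by
  obtain ⟨q, hq⟩ := h.total.exists_face (by rwa [h.i_eq, h.im_eq, h.nm_eq])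
  exact ⟨q, hq, h.left b j q hb hq⟩

theorem Represents.sub {l : x.dom ⟶ U} {r : x.cod ⟶ V} {p : x.cod}
    (h : Represents l r p i A a u y) {c : 𝔸} (hc : c ∉ A) (k : Bool) :
    Represents l r (x.cod.sub p c k) i A a (fun b j => U.sub (u b j) c k) (V.sub y c k) := by
  obtain ⟨h1, h2, h3⟩ := h.total.sub (h.im_eq.symm ▸ hc) k
  refine ⟨h1, h.i_eq, by rw [h2, h.im_eq], by rw [h3, h.nm_eq], by rw [Sub01.hom_sub, h.right],
    fun b j q hb hq => ?_⟩
  obtain ⟨q', hq', e⟩ := h.exists_face hb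
  refine Eq.trans ?_ (congrArg (fun t => U.sub t c k) e)
  rw [← Sub01.hom_sub]
  refine congrArg l (incl_injective ?_)
  rw [Sub01.hom_sub, hq', hq, x.cod.sub_comm]
  exact fun e => hc (e ▸ hb.1)

end Represents

/-- A natural choice of fillers for the squares from generating open box inclusions to `g`. -/
structure Lifting {U V : Sub01 𝔸} (g : U ⟶ V) where
  lift : ∀ (x : GenBox 𝔸) (l : x.dom ⟶ U) (r : x.cod ⟶ V), l ≫ g = x.incl ≫ r → (x.cod ⟶ U)
  incl_lift : ∀ {x l r} (w : l ≫ g = x.incl ≫ r), x.incl ≫ lift x l r w = l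
  lift_comp : ∀ {x l r} (w : l ≫ g = x.incl ≫ r), lift x l r w ≫ g = r
  natural : ∀ {x y : GenBox 𝔸} (m : x ⟶ y) {l r} (w : l ≫ g = y.incl ≫ r)
    (w' : (domMap m ≫ l) ≫ g = x.incl ≫ codMap m ≫ r),
    lift x (domMap m ≫ l) (codMap m ≫ r) w' = codMap m ≫ lift y l r w

/-! ### Natural diagonal fillers determine filling operators -/

namespace Lifting

variable {U V : Sub01 𝔸} {g : U ⟶ V} (φ : Lifting g) {i : Bool} {A : Finset 𝔸} {a : 𝔸}
  {u : 𝔸 → Bool → U} {y : V}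

/-- Both `p` and `p'` are images of the generic element of one generator `x''`, whose parameter set
collects the names in both second components. The two squares restrict to the same square on `x''`,
since they agree at the generic element and its faces. Naturality along both morphisms then gives
the equality. -/
theorem lift_eq_lift {x x' : GenBox 𝔸} {l : x.dom ⟶ U} {r : x.cod ⟶ V} {p : x.cod}
    {l' : x'.dom ⟶ U} {r' : x'.cod ⟶ V} {p' : x'.cod} (w : l ≫ g = x.incl ≫ r)
    (w' : l' ≫ g = x'.incl ≫ r') (h : Represents l r p i A a u y)
    (h' : Represents l' r' p' i A a u y) : φ.lift x l r w p = φ.lift x' l' r' w' p' := by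
  obtain ⟨S, hS⟩ : ∃ S : Finset 𝔸, ∀ c, c ∈ S ↔ (∃ z, cubeVal (sepSnd p) z = .inl c) ∨
      ∃ z, cubeVal (sepSnd p') z = .inl c := by
    have hfin : ∀ {B : Finset 𝔸} (f : cube B), {c | ∃ z, cubeVal f z = .inl c}.Finite := by
      intro B f
      refine (Set.finite_range fun z => (cubeVal f z).elim id fun _ => z.1).subset ?_
      rintro c ⟨z, hz⟩
      exact ⟨z, by simp [hz]⟩
    exact ⟨((hfin (sepSnd p)).union (hfin (sepSnd p'))).toFinset, fun c => by simp⟩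
  have ha : a ∈ A := h.nm_eq ▸ h.im_eq ▸ Total.nm_mem p
  let x'' : GenBox 𝔸 := ⟨i, A, a, ha, S⟩
  -- `A` is the set of directions of `p` and also of `p'`, so separation keeps it disjoint from the
  -- names in either second component.
  have hx : Disjoint x''.A x''.B := by
    have hd : ∀ {x : GenBox 𝔸} {p : x.cod}, Total p → ∀ c ∈ im p, ∀ z,
        cubeVal (sepSnd p) z ≠ .inl c := by
      intro x p hp c hc z hz
      simp only [im, Finset.mem_image, Finset.mem_univ, true_and] at hc
      obtain ⟨z', rfl⟩ := hc
      exact fresh_cube_cube_iff.1 (sep_fresh p) z' z _ (hp z') hz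
    refine Finset.disjoint_left.2 fun c hc hc' => ?_
    obtain ⟨z, hz⟩ | ⟨z, hz⟩ := (hS c).1 hc'
    · exact hd h.total c (h.im_eq.symm ▸ hc) z hz
    · exact hd h'.total c (h'.im_eq.symm ▸ hc) z hz
  obtain ⟨m, hm⟩ := exists_codMap_gen h.total hx h.i_eq.symm h.im_eq.symm h.nm_eq.symm
    fun z c hz => (hS c).2 (.inl ⟨z, hz⟩)
  obtain ⟨m', hm'⟩ := exists_codMap_gen h'.total hx h'.i_eq.symm h'.im_eq.symm h'.nm_eq.symm
    fun z c hz => (hS c).2 (.inr ⟨z, hz⟩)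
  have er : codMap m ≫ r = codMap m' ≫ r' := cod_hom_ext_gen hx (by
    rw [Sub01.comp_apply, Sub01.comp_apply, hm, hm', h.right, h'.right])
  have el : domMap m ≫ l = domMap m' ≫ l' := dom_hom_ext_gen hx fun b j q hb hq => by
    rw [Sub01.comp_apply, Sub01.comp_apply, h.left b j _ hb, h'.left b j _ hb]
    · rw [← hm', ← Sub01.hom_sub, ← hq]
      rfl
    · rw [← hm, ← Sub01.hom_sub, ← hq]
      rfl
  have hw : (domMap m ≫ l) ≫ g = x''.incl ≫ codMap m ≫ r := by
    rw [Category.assoc, w, ← Category.assoc, domMap_incl, Category.assoc]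
  have hw' : (domMap m' ≫ l') ≫ g = x''.incl ≫ codMap m' ≫ r' := by
    rw [Category.assoc, w', ← Category.assoc, domMap_incl, Category.assoc]
  have e1 := congrArg (fun t : x''.cod ⟶ U => t (gen hx)) (φ.natural m w hw)
  have e2 := congrArg (fun t : x''.cod ⟶ U => t (gen hx)) (φ.natural m' w' hw')
  simp only [Sub01.comp_apply, hm, hm'] at e1 e2
  rw [← e1, ← e2]
  congr 2

open Classical in
/-- The filler of an open box determined by a choice of fillers of squares. -/
noncomputable def fill (i : Bool) (A : Finset 𝔸) (a : 𝔸) (u : 𝔸 → Bool → U) (y : V) : U :=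
  if h : IsOpenBox g i A a u y then
    φ.lift (exists_represents h).choose _ _
      (exists_represents h).choose_spec.choose_spec.choose_spec.choose_spec.1
      (exists_represents h).choose_spec.choose_spec.choose_spec.choose
  -- The `perm` field of `KanOp` is imposed on all data, open box or not, so the default value has
  -- to be equivariant.
  else u a (!i)

theorem fill_eq (h : IsOpenBox g i A a u y) {x : GenBox 𝔸} {l : x.dom ⟶ U} {r : x.cod ⟶ V}
    {p : x.cod} (w : l ≫ g = x.incl ≫ r) (hp : Represents l r p i A a u y) :
    φ.fill i A a u y = φ.lift x l r w p := by
  rw [fill, dif_pos h]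
  exact φ.lift_eq_lift _ w
    (exists_represents h).choose_spec.choose_spec.choose_spec.choose_spec.2 hp

theorem _root_.ZeroOneSub.IsOpenBox.congr {u' : 𝔸 → Bool → U} (h : IsOpenBox g i A a u y)
    (e : ∀ b j, InDom i A a b j → u b j = u' b j) : IsOpenBox g i A a u' y where
  mem := h.mem
  fresh b j hb := e b j hb ▸ h.fresh b j hb
  adj b j b' j' hb hb' hne := by
    rw [← e b j hb, ← e b' j' hb']
    exact h.adj b j b' j' hb hb' hne
  lies b j hb := e b j hb ▸ h.lies b j hb

theorem _root_.ZeroOneSub.IsOpenBox.sub (h : IsOpenBox g i A a u y) {c : 𝔸} (hc : c ∉ A)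
    (k : Bool) : IsOpenBox g i A a (fun b j => U.sub (u b j) c k) (V.sub y c k) :=
  have hne : ∀ {b j}, InDom i A a b j → b ≠ c := fun hb e => hc (e ▸ hb.1)
  { mem := h.mem
    fresh := fun b j hb => by
      -- Write `u(b, j)` as `u(b, j)(b := j)` and move this substitution outermost to see that `b`
      -- stays fresh.
      rw [← U.sub_of_fresh _ b j (h.fresh b j hb), U.sub_comm _ _ _ _ _ (hne hb)]
      exact U.fresh_sub _ _ _
    adj := fun b j b' j' hb hb' hbb => by
      rw [← U.sub_comm _ _ _ _ _ (hne hb'), h.adj b j b' j' hb hb' hbb,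
        U.sub_comm _ _ _ _ _ (hne hb)]
    lies := fun b j hb => by
      rw [Sub01.hom_sub, h.lies b j hb, V.sub_comm _ _ _ _ _ (hne hb)] }

/-- The Kan filling operators determined by a choice of fillers of squares. -/
noncomputable def kanOp : KanOp g where
  fill := φ.fill
  congr h e := by
    obtain ⟨x, l, r, p, w, hp⟩ := exists_represents h
    rw [φ.fill_eq h w hp, φ.fill_eq (h.congr e) w (hp.congr e)]
  face h b j hb := by
    obtain ⟨x, l, r, p, w, hp⟩ := exists_represents h
    obtain ⟨q, hq, e⟩ := hp.exists_face hb
    rw [φ.fill_eq h w hp, ← Sub01.hom_sub, ← hq, ← e]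
    exact congrArg (fun t : x.dom ⟶ U => t q) (φ.incl_lift w)
  lies h := by
    obtain ⟨x, l, r, p, w, hp⟩ := exists_represents h
    rw [φ.fill_eq h w hp, ← hp.right]
    exact congrArg (fun t : x.cod ⟶ V => t p) (φ.lift_comp w)
  perm π i A a u y := by
    by_cases h : IsOpenBox g i A a u y
    · obtain ⟨x, l, r, p, w, hp⟩ := exists_represents h
      rw [φ.fill_eq h w hp, φ.fill_eq (h.smul π) w (hp.smul π), Sub01.hom_smul]
    · have h' : ¬IsOpenBox g i (π • A) (π • a) (fun b j => π • u (π⁻¹ • b) j) (π • y) :=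
        fun h' => h (by simpa using h'.smul π⁻¹)
      rw [fill, fill, dif_neg h, dif_neg h', inv_smul_smul]
  unif h c k hc := by
    obtain ⟨x, l, r, p, w, hp⟩ := exists_represents h
    rw [φ.fill_eq h w hp, φ.fill_eq (h.sub hc k) w (hp.sub hc k), Sub01.hom_sub]

/-- No lifting data is lost in passing to the operators: a square itself represents, at each total
`p`, the box of faces of `p`, so the operator there returns the value of the given filler at `p`. -/
theorem lift_eq_fillCube {x : GenBox 𝔸} {l : x.dom ⟶ U} {r : x.cod ⟶ V}
    (w : l ≫ g = x.incl ≫ r) : φ.lift x l r w = fillCube φ.kanOp l r w :=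
  fillCube_unique φ.kanOp w (φ.incl_lift w) fun _ _ hp hu =>
    (φ.fill_eq (hu.isOpenBox w hp) w
      ⟨hp, rfl, rfl, rfl, rfl, fun b j q hb hq => (hu b j q hb hq).symm⟩).symm

end Lifting

end GenBox

end Classify

/-! ### A criterion for isomorphisms of categories -/

section IsoOfCategories

universe v w v' w'

variable {D : Type w} [Category.{v} D] {E : Type w'} [Category.{v'} E]

/-- A fully faithful functor that is bijective on objects is an isomorphism of categories. -/
theorem isIsoOfCategories_of_bijective (F : D ⥤ E) [F.Full] [F.Faithful]
    (hF : Function.Bijective F.obj) : IsIsoOfCategories F := by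
  obtain ⟨s, hs, hs'⟩ := Function.bijective_iff_has_inverse.1 hF
  let G : E ⥤ D :=
    { obj := s
      map := fun {X Y} f => F.preimage (eqToHom (hs' X) ≫ f ≫ eqToHom (hs' Y).symm)
      map_id := fun X => F.map_injective (by simp)
      map_comp := fun f g => F.map_injective (by simp) }
  refine ⟨G, CategoryTheory.Functor.ext hs fun X Y f => F.map_injective ?_,
    CategoryTheory.Functor.ext hs' fun X Y f => ?_⟩
  · simp [G, eqToHom_map]
  · simp [G]

end IsoOfCategories

namespace GenBox

variable {𝔸 : Type u} [DecidableEq 𝔸] [Infinite 𝔸]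

/-! ### The generators as coalgebras -/

section Coalgebra

variable (x : GenBox 𝔸)

theorem lam_comp_rho_incl : lam x.incl ≫ rho x.incl = x.incl ≫ 𝟙 x.cod := lam_rho _

/-- The map `□_A ∗ □_B ⟶ K J(i, A, a, B)` that sends a total element to its open box of faces. -/
noncomputable def costr : x.cod ⟶ K x.incl :=
  fillCube (kanK x.incl) (lam x.incl) (𝟙 x.cod) (lam_comp_rho_incl x)

theorem incl_costr : x.incl ≫ costr x = lam x.incl := incl_fillCube _ _ _ _

theorem costr_rho : costr x ≫ rho x.incl = 𝟙 x.cod := fillCube_comp _ _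

/-- By naturality both sides are cube fillers. The left one uses the composite operators on `ρ_λ ≫
ρ`, which first fill downstairs and then fill over the result; the right one fills over `costr x`
directly. At a total element the lower filler is the value of `costr x`, so the two agree. -/
theorem costr_sigma (w : 𝟙 x.dom ≫ lam x.incl = x.incl ≫ costr x) :
    costr x ≫ sigma x.incl = costr x ≫ Kmap (𝟙 x.dom) (costr x) w := by
  have w1 : (lam x.incl ≫ sigma x.incl) ≫ rho (lam x.incl) ≫ rho x.incl =
      x.incl ≫ 𝟙 x.cod ≫ 𝟙 x.cod := lam_comp_rho_incl x
  have w2 : (lam x.incl ≫ Kmap (𝟙 x.dom) (costr x) w) ≫ rho (lam x.incl) =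
      x.incl ≫ 𝟙 x.cod ≫ costr x := w
  have h1 : costr x ≫ sigma x.incl = _ :=
    fillCube_pres _ _ ((kanK (lam x.incl)).comp (kanK x.incl)) sigma_pres w1
  have h2 : costr x ≫ Kmap (𝟙 x.dom) (costr x) w = _ :=
    fillCube_pres _ _ (kanK (lam x.incl)) (Kmap_pres _ _ w) w2
  rw [h1, h2]
  refine cod_hom_ext ?_ fun p hp => ?_
  · rw [incl_fillCube, incl_fillCube]
    rfl
  · obtain ⟨u, hu⟩ := hp.exists_isFaces (lam (lam x.incl))
    have hu' : IsFaces (lam x.incl) p fun b j => rho (lam x.incl) (u b j) :=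
      fun d j q hd hq => congrArg (rho (lam x.incl)) (hu d j q hd hq)
    refine (fillCube_total _ w1 hp hu).trans (Eq.trans ?_ (fillCube_total _ w2 hp hu).symm)
    refine congrArg ((kanK (lam x.incl)).fill x.i (im p) (nm p) u) ?_
    exact (fillCube_total (kanK x.incl) (lam_comp_rho_incl x) hp hu').symm

variable {x} in
-- Both composites are the cube filler of the same square with the free operators, by naturality in
-- the operators on one side and in `𝒥` on the other.
theorem costr_Kmap {y : GenBox 𝔸} (m : x ⟶ y) (w : domMap m ≫ y.incl = x.incl ≫ codMap m) :
    costr x ≫ Kmap (domMap m) (codMap m) w = codMap m ≫ costr y := by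
  have w1 : (lam x.incl ≫ Kmap (domMap m) (codMap m) w) ≫ rho y.incl =
      x.incl ≫ 𝟙 x.cod ≫ codMap m := w
  exact (fillCube_pres _ _ (kanK y.incl) (Kmap_pres _ _ w) w1).trans
    (fillCube_map m (kanK y.incl) (lam_comp_rho_incl y) w1)

/-- The generating open box inclusions as coalgebras. -/
noncomputable def eta (𝔸 : Type u) [DecidableEq 𝔸] [Infinite 𝔸] :
    GenBox 𝔸 ⥤ (kanAWFS 𝔸).LMap where
  obj x :=
    { A := (J 𝔸).obj x
      a := Arrow.homMk (𝟙 x.dom) (costr x) (incl_costr x).symm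
      counit := Arrow.hom_ext _ _ rfl (costr_rho x)
      coassoc := Arrow.hom_ext _ _ rfl (costr_sigma x (incl_costr x).symm) }
  map m :=
    { f := (J 𝔸).map m
      h := Arrow.hom_ext _ _ rfl (costr_Kmap m rfl) }
  map_id x := Comonad.Coalgebra.Hom.ext ((J 𝔸).map_id x)
  map_comp m n := Comonad.Coalgebra.Hom.ext ((J 𝔸).map_comp m n)

theorem eta_forget : eta 𝔸 ⋙ (kanAWFS 𝔸).forgetL = J 𝔸 := rfl

end Coalgebra

/-! ### Algebras and their filling operators -/

section Algebra

variable {U V : Sub01 𝔸} {g : U ⟶ V}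

/-- The Kan filling operators of an algebra `t : K g ⟶ U`: the filler of `(u, y)` is
`t (u, y)`. -/
noncomputable def algKanOp (t : K g ⟶ U) (h : lam g ≫ t = 𝟙 U) (h' : t ≫ g = rho g) : KanOp g :=
  have hbox : ∀ {i A a u y}, IsOpenBox g i A a u y →
      IsOpenBox (rho g) i A a (fun b j => lam g (u b j)) y := fun hu => hu.map (lam g) (𝟙 V) rfl
  have hlam : ∀ v, t (lam g v) = v := fun v => congrArg (fun m : U ⟶ U => m v) h
  { fill := fun i A a u y => t ((kanK g).fill i A a (fun b j => lam g (u b j)) y)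
    congr := fun hu e => congrArg t ((kanK g).congr (hbox hu) fun b j hb =>
      congrArg (lam g) (e b j hb))
    face := fun hu b j hb => by
      rw [← Sub01.hom_sub, (kanK g).face (hbox hu) b j hb, hlam]
    lies := fun hu => (congrArg (fun m : K g ⟶ V => m _) h').trans ((kanK g).lies (hbox hu))
    perm := fun π i A a u y => by
      rw [← Sub01.hom_smul, ← (kanK g).perm]
      simp only [Sub01.hom_smul]
    unif := fun hu c j hc => by
      rw [← Sub01.hom_sub, ← (kanK g).unif (hbox hu) c j hc]
      simp only [Sub01.hom_sub] }

/-- Apply associativity to the box in `K ρ_g` whose faces are the generators `λ(u(b, j))`. The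
multiplication collapses it to `(u, y)`, while `K t` sends it to the box of generators `λ(t(u(b,
j)))`, whose image under `t` is by definition the filler of `(t ∘ u, y)`. -/
theorem algKanOp_pres (t : K g ⟶ U) (h : lam g ≫ t = 𝟙 U) (h' : t ≫ g = rho g)
    (w : t ≫ g = rho g ≫ 𝟙 V) (ht : pi g ≫ t = Kmap t (𝟙 V) w ≫ t) :
    Pres (kanK g) (algKanOp t h h') t (𝟙 V) := by
  refine ⟨fun {i A a u y} hu => ?_⟩
  have hu' : IsOpenBox (rho (rho g)) i A a (fun b j => lam (rho g) (u b j)) y :=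
    hu.map (lam (rho g)) (𝟙 V) rfl
  have e1 : pi g ((kanK (rho g)).fill i A a (fun b j => lam (rho g) (u b j)) y) =
      (kanK g).fill i A a u y := pi_pres.out hu'
  have e2 := (Kmap_pres t (𝟙 V) w).out hu'
  have e3 := congrArg (fun m : K (rho g) ⟶ U =>
    m ((kanK (rho g)).fill i A a (fun b j => lam (rho g) (u b j)) y)) ht
  simp only [Sub01.comp_apply, e1, e2] at e3
  exact e3

end Algebra

/-! ### Canonical fillers and morphisms of algebras -/

section RMap

variable (S : (kanAWFS 𝔸).RMap)

/-- The Kan filling operators of an algebra. -/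
noncomputable def rmapKanOp : KanOp S.A.hom :=
  algKanOp ((kanAWFS 𝔸).str S) ((kanAWFS 𝔸).lam_str S) ((kanAWFS 𝔸).str_hom S)

theorem rmap_right : Arrow.Hom.right S.a = 𝟙 S.A.right :=
  (Category.id_comp _).symm.trans (congrArg (fun s => Arrow.Hom.right s) S.unit)

theorem Kmap_congr {X Y U V : Sub01 𝔸} {f : X ⟶ Y} {g : U ⟶ V} {h h' : X ⟶ U} {k k' : Y ⟶ V}
    (w : h ≫ g = f ≫ k) (w' : h' ≫ g = f ≫ k') (e : h = h') (e' : k = k') :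
    Kmap h k w = Kmap h' k' w' := by
  subst e e'
  rfl

theorem fillCube_congr {x : GenBox 𝔸} {U V : Sub01 𝔸} {g : U ⟶ V} (H : KanOp g)
    {l l' : x.dom ⟶ U} {r r' : x.cod ⟶ V} (w : l ≫ g = x.incl ≫ r) (w' : l' ≫ g = x.incl ≫ r')
    (e : l = l') (e' : r = r') : fillCube H l r w = fillCube H l' r' w' := by
  subst e e'
  rfl

theorem str_pres : Pres (kanK S.A.hom) (rmapKanOp S) ((kanAWFS 𝔸).str S) (𝟙 S.A.right) := by
  have w : (kanAWFS 𝔸).str S ≫ S.A.hom = ZeroOneSub.rho S.A.hom ≫ 𝟙 S.A.right :=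
    ((kanAWFS 𝔸).str_hom S).trans (Category.comp_id _).symm
  refine algKanOp_pres _ _ _ w ?_
  have := congrArg (fun s => Arrow.Hom.left s) S.assoc
  refine Eq.trans this ?_
  exact congrArg (fun m => m ≫ (kanAWFS 𝔸).str S) (Kmap_congr (Arrow.w S.a) w rfl (rmap_right S))

/-- The coalgebra structure is a cube filler for the free operators, and both `K s` and the algebra
structure preserve fillers, so the composite is again a cube filler. Its boundary is `s` by the unit
law. -/
theorem filler_eta (x : GenBox 𝔸) (s : (J 𝔸).obj x ⟶ S.A) :
    (kanAWFS 𝔸).filler ((eta 𝔸).obj x) S s = fillCube (rmapKanOp S) s.left s.right s.w := by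
  have w : (lam x.incl ≫ Kmap s.left s.right s.w ≫ (kanAWFS 𝔸).str S) ≫ S.A.hom =
      x.incl ≫ 𝟙 x.cod ≫ s.right ≫ 𝟙 S.A.right := by
    have h : lam x.incl ≫ Kmap s.left s.right s.w ≫ (kanAWFS 𝔸).str S = s.left :=
      (congrArg (fun t => s.left ≫ t) ((kanAWFS 𝔸).lam_str S)).trans (Category.comp_id _)
    rw [h]
    exact s.w
  refine (fillCube_pres (kanK x.incl) (lam_comp_rho_incl x) (rmapKanOp S)
    ((str_pres S).comp (Kmap_rho _ _ s.w) (Kmap_pres _ _ s.w)) w).trans ?_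
  refine fillCube_congr _ _ _ ?_ ?_
  · exact (congrArg (fun t => s.left ≫ t) ((kanAWFS 𝔸).lam_str S)).trans (Category.comp_id _)
  · exact (Category.id_comp _).trans (Category.comp_id _)

theorem fillCube_represents {x : GenBox 𝔸} {U V : Sub01 𝔸} {g : U ⟶ V} (H : KanOp g)
    {l : x.dom ⟶ U} {r : x.cod ⟶ V} (w : l ≫ g = x.incl ≫ r) {p : x.cod} {i A a u y}
    (h : Represents l r p i A a u y) : fillCube H l r w p = H.fill i A a u y := by
  obtain ⟨hp, rfl, rfl, rfl, rfl, hl⟩ := h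
  exact fillCube_total H w hp fun b j q hb hq => (hl b j q hb hq).symm

/-- Any open box is represented by a square, and composing that square with `(m, n)` represents the
image box at the same total element. Evaluating the cube fillers there compares the two chosen
fillers. -/
theorem pres_of_fillCube {U V U' V' : Sub01 𝔸} {g : U ⟶ V} {g' : U' ⟶ V'} (H : KanOp g)
    (H' : KanOp g') {m : U ⟶ U'} {n : V ⟶ V'}
    (h : ∀ (x : GenBox 𝔸) (l : x.dom ⟶ U) (r : x.cod ⟶ V) (w : l ≫ g = x.incl ≫ r)
      (w' : (l ≫ m) ≫ g' = x.incl ≫ r ≫ n),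
      fillCube H l r w ≫ m = fillCube H' (l ≫ m) (r ≫ n) w')
    (hw : m ≫ g' = g ≫ n) : Pres H H' m n := by
  refine ⟨fun {i A a u y} hu => ?_⟩
  obtain ⟨x, l, r, p, w, hp⟩ := exists_represents hu
  have w' : (l ≫ m) ≫ g' = x.incl ≫ r ≫ n := by
    rw [Category.assoc, hw, ← Category.assoc, w, Category.assoc]
  have hp' : Represents (l ≫ m) (r ≫ n) p i A a (fun b j => m (u b j)) (n y) :=
    ⟨hp.total, hp.i_eq, hp.im_eq, hp.nm_eq, congrArg n hp.right,
      fun b j q hb hq => congrArg m (hp.left b j q hb hq)⟩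
  rw [← fillCube_represents H w hp, ← fillCube_represents H' w' hp', ← h x l r w w']
  rfl

/-- The hypothesis makes `s` preserve the filling operators. Then both ways around the algebra
square preserve fillers and restrict to the same map along `λ`, so they agree by freeness of `K`. -/
theorem rmap_comm {S S' : (kanAWFS 𝔸).RMap} (s : S.A ⟶ S'.A)
    (h : ∀ (x : GenBox 𝔸) (t : (J 𝔸).obj x ⟶ S.A),
      (kanAWFS 𝔸).filler ((eta 𝔸).obj x) S t ≫ s.left =
        (kanAWFS 𝔸).filler ((eta 𝔸).obj x) S' (t ≫ s)) :
    (kanAWFS 𝔸).R.map s ≫ S'.a = S.a ≫ s := by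
  have hs : Pres (rmapKanOp S) (rmapKanOp S') s.left s.right :=
    pres_of_fillCube _ _ (fun x l r w w' => by
      let t : (J 𝔸).obj x ⟶ S.A := Arrow.homMk (f := (J 𝔸).obj x) l r w
      exact (congrArg (fun q => q ≫ s.left) (filler_eta S x t)).symm.trans
        ((h x t).trans (filler_eta S' x (t ≫ s)))) s.w
  refine Arrow.hom_ext _ _ ?_ ?_
  · refine Pres.unique (f := S.A.hom) (H := rmapKanOp S') (k := s.right) ?_ ?_ ?_ ?_
    · exact ((congrArg (fun t => s.left ≫ t) ((kanAWFS 𝔸).lam_str S')).trans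
        (Category.comp_id _)).trans ((Category.id_comp _).symm.trans
          (congrArg (fun t => t ≫ s.left) ((kanAWFS 𝔸).lam_str S)).symm)
    · exact (congrArg (fun t => Kmap s.left s.right s.w ≫ t) ((kanAWFS 𝔸).str_hom S')).trans
        (Kmap_rho _ _ s.w)
    · exact (str_pres S').comp (n' := 𝟙 _) (Kmap_rho _ _ s.w) (Kmap_pres _ _ s.w)
    · exact hs.comp (n := 𝟙 _) ((kanAWFS 𝔸).str_hom S) (str_pres S)
  · exact (congrArg (fun t => s.right ≫ t) (rmap_right S')).trans
      ((Category.comp_id _).trans ((Category.id_comp _).symm.trans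
        (congrArg (fun t => t ≫ s.right) (rmap_right S)).symm))

end RMap

/-! ### The comparison functor is bijective on objects and fully faithful -/

section Main

/-- The lifting structure on the underlying map of an object of `𝒥^⋔`. -/
def toLifting (P : Pitchfork (J 𝔸)) : Lifting P.arr.hom where
  lift x l r w := P.lift x (Arrow.homMk l r w)
  incl_lift _ := P.lift_left _ _
  lift_comp _ := P.lift_right _ _
  natural m l r w _ := P.natural m (Arrow.homMk l r w)

/-- The algebra given by Kan filling operators. -/
noncomputable def _root_.ZeroOneSub.KanOp.algebra {f : Arrow (Sub01 𝔸)} (H : KanOp f.hom) :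
    (kanAWFS 𝔸).RMap where
  A := f
  a := Arrow.homMk (ZeroOneSub.ext H (𝟙 _) (𝟙 _) rfl) (𝟙 f.right) (ext_rho H (𝟙 _) (𝟙 _) rfl)
  unit := Arrow.hom_ext _ _ rfl rfl
  assoc := by
    refine Arrow.hom_ext _ _ ?_ rfl
    have hw := ext_rho (f := f.hom) H (𝟙 _) (𝟙 _) rfl
    refine Pres.unique (f := ZeroOneSub.rho f.hom) (H := H) (k := 𝟙 _) rfl ?_ ?_ ?_
    · exact (congrArg (fun t => pi f.hom ≫ t) hw).trans
        (congrArg (fun t => t ≫ 𝟙 f.right) pi_rho)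
    · exact Pres.comp (n' := 𝟙 _) (Pres.ext H (𝟙 f.left) (𝟙 f.right) rfl) pi_rho pi_pres
    · exact Pres.comp (n' := 𝟙 _) (Pres.ext H (𝟙 f.left) (𝟙 f.right) rfl) (Kmap_rho _ _ hw) (Kmap_pres _ _ hw)

/-- The operators read off from `H.algebra` are those of `H`: its structure map preserves fillers
and is the identity on generators. Stated as preservation along identities, this feeds directly into
`fillCube_pres`. -/
theorem algebra_pres {f : Arrow (Sub01 𝔸)} (H : KanOp f.hom) :
    Pres (rmapKanOp H.algebra) H (𝟙 f.left) (𝟙 f.right) := by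
  refine ⟨fun {i A a u y} hu => ?_⟩
  exact (Pres.ext H (𝟙 f.left) (𝟙 f.right) rfl).out (hu.map (lam f.hom) (𝟙 f.right) rfl)

theorem filler_algebra {f : Arrow (Sub01 𝔸)} (H : KanOp f.hom) (x : GenBox 𝔸)
    (s : (J 𝔸).obj x ⟶ f) :
    (kanAWFS 𝔸).filler ((eta 𝔸).obj x) H.algebra s = fillCube H s.left s.right s.w :=
  (filler_eta H.algebra x s).trans
    (fillCube_pres (rmapKanOp H.algebra) s.w H (algebra_pres H) s.w)

theorem _root_.ZeroOneSub.Pitchfork.mk_congr {C J : Type*} [Category* C] [Category* J]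
    {F : J ⥤ Arrow C} {P Q : Pitchfork F} (h : P.arr = Q.arr)
    (h' : ∀ j (s : F.obj j ⟶ P.arr), P.lift j s ≫ eqToHom (by rw [h]) =
      Q.lift j (s ≫ eqToHom h)) : P = Q := by
  obtain ⟨arr, lift, _, _, _⟩ := P
  obtain ⟨arr', lift', _, _, _⟩ := Q
  obtain rfl : arr = arr' := h
  obtain rfl : lift = lift' := by
    funext j s
    simpa using h' j s
  rfl

/-- The composite of `lift` and restriction along `η`. -/
noncomputable abbrev toPitchfork (𝔸 : Type u) [DecidableEq 𝔸] [Infinite 𝔸] :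
    (kanAWFS 𝔸).RMap ⥤ Pitchfork (J 𝔸) :=
  (kanAWFS 𝔸).lift ⋙ Pitchfork.restrict (eta 𝔸) eta_forget

instance : (toPitchfork 𝔸).Faithful where
  map_injective h := Monad.Algebra.Hom.ext (congrArg Pitchfork.Hom.sq h)

instance : (toPitchfork 𝔸).Full where
  map_surjective φ := ⟨⟨φ.sq, rmap_comm φ.sq φ.comm⟩, rfl⟩

/-- Equal fillers make the identity square, written as an `eqToHom`, commute with fillers. By
`rmap_comm` it is then an algebra morphism, which forces the structure maps to coincide. -/
theorem toPitchfork_obj_injective : Function.Injective (toPitchfork 𝔸).obj := by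
  intro S S' h
  have hA : S.A = S'.A := congrArg Pitchfork.arr h
  have key : ∀ (P P' : Pitchfork (J 𝔸)) (e : P = P') (j) (s : (J 𝔸).obj j ⟶ P.arr),
      P.lift j s ≫ (eqToHom (congrArg Pitchfork.arr e)).left =
        P'.lift j (s ≫ eqToHom (congrArg Pitchfork.arr e)) := by
    rintro P _ rfl j s
    simp
  have hc := rmap_comm (eqToHom hA) (key _ _ h)
  obtain ⟨A, a, _, _⟩ := S
  obtain ⟨A', a', _, _⟩ := S'
  obtain rfl : A = A' := hA
  obtain rfl : a = a' := by
    have h1 : (kanAWFS 𝔸).R.map (𝟙 A) ≫ a' = a ≫ 𝟙 A := hc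
    have h2 : (kanAWFS 𝔸).R.map (𝟙 A) ≫ a' = a' :=
      (congrArg (fun t => t ≫ a') ((kanAWFS 𝔸).R.map_id A)).trans (Category.id_comp a')
    exact (Category.comp_id a).symm.trans (h1.symm.trans h2)
  rfl

/-- The preimage is the algebra of the operators induced by the given fillers. Its canonical fillers
are the cube fillers of these operators, which are the original ones by `lift_eq_fillCube`. -/
theorem toPitchfork_obj_surjective : Function.Surjective (toPitchfork 𝔸).obj := by
  intro P
  refine ⟨(toLifting P).kanOp.algebra, Pitchfork.mk_congr (Q := P) rfl fun x s => ?_⟩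
  have h1 : (kanAWFS 𝔸).filler ((eta 𝔸).obj x) (toLifting P).kanOp.algebra s = P.lift x s :=
    (filler_algebra _ x s).trans ((toLifting P).lift_eq_fillCube s.w).symm
  exact (Category.comp_id _).trans (h1.trans (congrArg (P.lift x) (Category.comp_id s).symm))

end Main

end GenBox

end ZeroOneSub

theorem mainTheorem3 (𝔸 : Type u) [DecidableEq 𝔸] [Infinite 𝔸] :
    ∃ (η : ZeroOneSub.GenBox 𝔸 ⥤ (ZeroOneSub.kanAWFS 𝔸).LMap)
      (hη : η ⋙ (ZeroOneSub.kanAWFS 𝔸).forgetL = ZeroOneSub.GenBox.J 𝔸),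
      ZeroOneSub.IsIsoOfCategories
        ((ZeroOneSub.kanAWFS 𝔸).lift ⋙ ZeroOneSub.Pitchfork.restrict η hη) :=
  ⟨ZeroOneSub.GenBox.eta 𝔸, ZeroOneSub.GenBox.eta_forget,
    ZeroOneSub.isIsoOfCategories_of_bijective (ZeroOneSub.GenBox.toPitchfork 𝔸)
      ⟨ZeroOneSub.GenBox.toPitchfork_obj_injective,
        ZeroOneSub.GenBox.toPitchfork_obj_surjective⟩⟩
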